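/- Let $\mathcal X$ be a discrete set. For distributions $p,q$ on $\mathcal X$, a prior $\alpha\in(0,1/2]$ and $\delta>0$, let $n^*_{\mathrm B}(p,q,\alpha,\delta)\in\mathbb N\cup\{\infty\}$ be the smallest $n$ for which there is a test $\phi:\bigcup_{m\ge 0}\mathcal X^m\to\{p,q\}$ with $$\alpha\,\mathbb P_{X\sim p^{\otimes n}}\{\phi(X)\ne p\}+(1-\alpha)\,\mathbb P_{X\sim q^{\otimes n}}\{\phi(X)\ne q\}\le\delta ,$$ where the outputs $p$ and $q$ are regarded as two different labels, and $n^*_{\mathrm B}=\infty$ if there is no such $n$. For an integer $D\ge2$ and a set $\mathcal C$ of channels (stochastic maps) $\mathcal X\to[D]$, let $n^*_{\mathrm B}(p,q,\alpha,\delta;\mathcal C)$ be the smallest $n$ for which there are a single channel $f\in\mathcal C$ and a test $\phi:\bigcup_{m\ge 0}[D]^m\to\{p,q\}$ that satisfy the same inequality when $\phi$ is applied to $(Y_1,\dots,Y_n)$ instead of $X$, where $X_1,\dots,X_n$ are i.i.d. from $p$ (respectively $q$) and, conditionally on the $X_i$, the $Y_i\sim f(X_i)$ are independent. Let $n^*_{\mathrm{B,comm}}(p,q,\alpha,\delta,D)$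 be this number for the set $\mathcal C$ of all channels $\mathcal X\to[D]$. There is an absolute constant $C$ such that the following hold. 1. (Statistical cost) For every discrete $\mathcal X$, all distributions $p,q$ on $\mathcal X$, all $\alpha\in(0,1/2]$, $\delta\in(0,\alpha/4)$ and all integers $D\ge2$, with $n^*:=n^*_{\mathrm B}(p,q,\alpha,\delta)$, $$n^*\le C\,n^*_{\mathrm{B,comm}}(p,q,\alpha,\delta,D)\qquad\text{and}\qquad n^*_{\mathrm{B,comm}}(p,q,\alpha,\delta,D)\le C\,n^*\max\Bigl(1,\frac{\log(n^*/\alpha)}{D}\Bigr),$$ where the last expression is $\infty$ if $n^*=\infty$. 2. (Computational cost) There is an algorithm (one program for a real RAM, i.e. a random access machine with unit-cost exact arithmetic and comparison of real numbers, and with natural numbers as counters and array indices) that, on input two distributions $p,q$ on a finite set $\mathcal X=[k]$ (given by their probabilities), $\alpha\in(0,1/2]$, $\delta\in(0,\alpha/4)$ and an integer $D\ge 2$, halts after at most $\mathrm{poly}(|\mathcal X|,D,\log(1/\alpha),\log(1/\delta))$ steps, for a fixed polynomial, and outputs a quantizer $\hat f:\mathcal X\to[D]$ for which the resulting sample complexity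 satisfies $$n^*_{\mathrm B}\bigl(p,q,\alpha,\delta;\{\hat f\}\bigr)\le C\,n^*\max\Bigl(1,\frac{\log(n^*/\alpha)}{D}\Bigr).$$ -/

import Mathlib

open scoped NNReal ENNReal

/-! ### Bayesian simple binary hypothesis testing -/

namespace HypTest

/-- A test: a decision for every finite tuple of observations.
`true` stands for "the first hypothesis `p`", `false` for "the second hypothesis `q`". -/
abbrev Test (Y : Type*) : Type _ := (n : ℕ) → (Fin n → Y) → Bool

/-- The law `p^{⊗ n}` of `n` i.i.d. samples from `p`, as a mass function on `X^n`. -/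
noncomputable def iidMass {X : Type*} (p : PMF X) (n : ℕ) (x : Fin n → X) : ℝ≥0∞ :=
  ∏ i, p (x i)

/-- The law of `(Y_1, …, Y_n)`, where `X_1, …, X_n` are i.i.d. samples from `p` and, conditionally
on the samples, the `Y_i` are independent with `Y_i` distributed as `f (X_i)`. -/
noncomputable def outMass {X Y : Type*} (p : PMF X) (f : X → PMF Y) (n : ℕ) (y : Fin n → Y) :
    ℝ≥0∞ :=
  ∑' x : Fin n → X, iidMass p n x * ∏ i, f (x i) (y i)

/-- The average error `α · P(φ ≠ p) + (1 - α) · Q(φ ≠ q)` of a test `φ` on `n` observations, whose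
joint law is `P` under the first and `Q` under the second hypothesis. -/
noncomputable def avgError {Y : Type*} (α : ℝ) (n : ℕ) (P Q : (Fin n → Y) → ℝ≥0∞) (φ : Test Y) :
    ℝ≥0∞ :=
  ENNReal.ofReal α * (∑' y, if φ n y = true then 0 else P y) +
    ENNReal.ofReal (1 - α) * (∑' y, if φ n y = true then Q y else 0)

/-- `φ` solves the Bayesian simple binary hypothesis testing problem of `p` versus `q` under the
prior `(α, 1 - α)` with `n` samples and probability of error `δ`. -/
def Solves {X : Type*} (p q : PMF X) (α δ : ℝ) (n : ℕ) (φ : Test X) : Prop :=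
  avgError α n (iidMass p n) (iidMass q n) φ ≤ ENNReal.ofReal δ

/-- The sample complexity: the smallest `n` for which some test solves the problem
(`⊤` if there is none). -/
noncomputable def sampleComplexity {X : Type*} (p q : PMF X) (α δ : ℝ) : ℕ∞ :=
  sInf {m : ℕ∞ | ∃ n : ℕ, m = n ∧ ∃ φ : Test X, Solves p q α δ n φ}

/-- The test-modifier pair `(φ, f)` solves the distributed problem with `n` samples: the test sees
only `Y_i = f (X_i)`. -/
def SolvesVia {X Y : Type*} (p q : PMF X) (α δ : ℝ) (n : ℕ) (φ : Test Y) (f : X → PMF Y) : Prop :=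
  avgError α n (outMass p f n) (outMass q f n) φ ≤ ENNReal.ofReal δ

/-- The sample complexity under the constraint that the modifier lies in `𝒞`: the smallest `n` for
which some test-modifier pair solves the problem (`⊤` if there is none). -/
noncomputable def constrainedSampleComplexity {X Y : Type*} (p q : PMF X) (α δ : ℝ)
    (𝒞 : Set (X → PMF Y)) : ℕ∞ :=
  sInf {m : ℕ∞ | ∃ n : ℕ, m = n ∧ ∃ φ : Test Y, ∃ f ∈ 𝒞, SolvesVia p q α δ n φ f}

/-- The sample complexity under the communication constraint: all channels into `D` symbols. -/
noncomputable def commSampleComplexity {X : Type*} (p q : PMF X) (α δ : ℝ) (D : ℕ) : ℕ∞ :=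
  constrainedSampleComplexity p q α δ (Set.univ : Set (X → PMF (Fin D)))

/-- A deterministic map, as a channel. -/
noncomputable def detChannel {X Y : Type*} (f : X → Y) : X → PMF Y := fun x => PMF.pure (f x)

/-- The quantity `n · max(1, log(n / α) / D)`; it is `⊤` for `n = ⊤`. -/
noncomputable def commBound (n : ℕ∞) (α : ℝ) (D : ℕ) : ℝ≥0∞ :=
  (n : ℝ≥0∞) * max 1 (ENNReal.ofReal (Real.log ((n.toNat : ℝ) / α) / (D : ℝ)))

end HypTest

/-! ### A real random access machine

A structured real RAM: finitely many registers and arrays (those which the program mentions) that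
hold natural numbers or real numbers. The only constants of a program are naturals and rationals. Each instruction and each evaluation of a
condition takes one step. Real numbers support exact field operations and comparison, and natural
numbers serve as counters and as array indices; there is no rounding of reals to naturals, and no
multiplication of naturals. -/

namespace RealRAM

/-- A memory state: registers and arrays of naturals and of reals. -/
structure State where
  nreg : ℕ → ℕ
  rreg : ℕ → ℝ
  narr : ℕ → ℕ → ℕ
  rarr : ℕ → ℕ → ℝ

/-- Elementary instructions. Registers and arrays are referred to by their (fixed) numbers. -/
inductive Instr where
  | natConst (r c : ℕ)
  | natAdd (r a b : ℕ)
  | natSub (r a b : ℕ)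
  | natLoad (r arr idx : ℕ)
  | natStore (arr idx r : ℕ)
  | realConst (r : ℕ) (c : ℚ)
  | realAdd (r a b : ℕ)
  | realSub (r a b : ℕ)
  | realMul (r a b : ℕ)
  | realDiv (r a b : ℕ)
  | realLoad (r arr idx : ℕ)
  | realStore (arr idx r : ℕ)

/-- Assign a natural register. -/
def State.setN (s : State) (r v : ℕ) : State :=
  { s with nreg := Function.update s.nreg r v }

/-- Assign a real register. -/
noncomputable def State.setR (s : State) (r : ℕ) (v : ℝ) : State :=
  { s with rreg := Function.update s.rreg r v }

/-- The effect of an elementary instruction. Subtraction of naturals is truncated and division by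
zero returns zero. `natLoad r arr idx` is `r := arr[idx]` and `natStore arr idx r` is
`arr[idx] := r`, where the position is the current content of the natural register `idx`;
likewise for reals. -/
noncomputable def Instr.apply : Instr → State → State
  | .natConst r c, s => s.setN r c
  | .natAdd r a b, s => s.setN r (s.nreg a + s.nreg b)
  | .natSub r a b, s => s.setN r (s.nreg a - s.nreg b)
  | .natLoad r arr idx, s => s.setN r (s.narr arr (s.nreg idx))
  | .natStore arr idx r, s =>
      { s with
        narr := Function.update s.narr arr
          (Function.update (s.narr arr) (s.nreg idx) (s.nreg r)) }
  | .realConst r c, s => s.setR r (c : ℝ)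
  | .realAdd r a b, s => s.setR r (s.rreg a + s.rreg b)
  | .realSub r a b, s => s.setR r (s.rreg a - s.rreg b)
  | .realMul r a b, s => s.setR r (s.rreg a * s.rreg b)
  | .realDiv r a b, s => s.setR r (s.rreg a / s.rreg b)
  | .realLoad r arr idx, s => s.setR r (s.rarr arr (s.nreg idx))
  | .realStore arr idx r, s =>
      { s with
        rarr := Function.update s.rarr arr
          (Function.update (s.rarr arr) (s.nreg idx) (s.rreg r)) }

/-- Conditions: comparisons of two registers of the same kind. -/
inductive Cond where
  | natLt (a b : ℕ)
  | natLe (a b : ℕ)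
  | realLt (a b : ℕ)
  | realLe (a b : ℕ)

/-- When a condition holds in a state. -/
def Cond.Holds : Cond → State → Prop
  | .natLt a b, s => s.nreg a < s.nreg b
  | .natLe a b, s => s.nreg a ≤ s.nreg b
  | .realLt a b, s => s.rreg a < s.rreg b
  | .realLe a b, s => s.rreg a ≤ s.rreg b

/-- Programs. -/
inductive Prog where
  | skip
  | instr (i : Instr)
  | seq (c₁ c₂ : Prog)
  | ite (b : Cond) (c₁ c₂ : Prog)
  | loop (b : Cond) (c : Prog)

/-- `Exec c s t s'`: started in state `s`, the program `c` halts in state `s'` after exactly `t`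
steps. `Prog.loop b c` runs `c` as long as `b` holds. -/
inductive Exec : Prog → State → ℕ → State → Prop
  | skip (s : State) : Exec .skip s 0 s
  | instr (i : Instr) (s : State) : Exec (.instr i) s 1 (i.apply s)
  | seq {c₁ c₂ : Prog} {s₀ s₁ s₂ : State} {t₁ t₂ : ℕ} :
      Exec c₁ s₀ t₁ s₁ → Exec c₂ s₁ t₂ s₂ → Exec (.seq c₁ c₂) s₀ (t₁ + t₂) s₂
  | iteTrue {b : Cond} {c₁ c₂ : Prog} {s s' : State} {t : ℕ} :
      b.Holds s → Exec c₁ s t s' → Exec (.ite b c₁ c₂) s (t + 1) s'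
  | iteFalse {b : Cond} {c₁ c₂ : Prog} {s s' : State} {t : ℕ} :
      ¬ b.Holds s → Exec c₂ s t s' → Exec (.ite b c₁ c₂) s (t + 1) s'
  | loopFalse {b : Cond} {c : Prog} {s : State} :
      ¬ b.Holds s → Exec (.loop b c) s 1 s
  | loopTrue {b : Cond} {c : Prog} {s₀ s₁ s₂ : State} {t₁ t₂ : ℕ} :
      b.Holds s₀ → Exec c s₀ t₁ s₁ → Exec (.loop b c) s₁ t₂ s₂ →
        Exec (.loop b c) s₀ (t₁ + t₂ + 1) s₂

/-- The initial state on input `(p, q, α, δ, D)` for distributions on `k` symbols. The natural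
registers `0, 1` hold `k, D`, the real registers `0, 1` hold `α, δ`, and the real arrays `0, 1`
hold the probabilities of the symbols under `p, q`. Everything else is zero. -/
noncomputable def inputState {k : ℕ} (p q : PMF (Fin k)) (α δ : ℝ) (D : ℕ) : State where
  nreg := fun r => if r = 0 then k else if r = 1 then D else 0
  rreg := fun r => if r = 0 then α else if r = 1 then δ else 0
  narr := fun _ _ => 0
  rarr := fun a j =>
    if h : j < k then
      if a = 0 then (p ⟨j, h⟩).toReal else if a = 1 then (q ⟨j, h⟩).toReal else 0
    else 0

/-- The state `s` holds the map `f` as output: entry `x` of the natural array `0` is `f x`. -/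
def Outputs {k D : ℕ} (s : State) (f : Fin k → Fin D) : Prop :=
  ∀ x : Fin k, s.narr 0 x = f x

end RealRAM

/-! Let `a` and `b` round log₂(1/α) and log₂(α/δ), put `l = b/(4b+a)`, and let ρ = ∑ p^(1-l) q^l be
the affinity. Up to constants the sample complexity is the least n with n · log₂(1/ρ) ≥ b.
Chernoff's bound shows that ρ^n ≤ 2^(-3b) suffices (`exists_solves_of_affinity_pow_le`). Conversely,
by Hölder's inequality a successful test forces ρ^n below the affinity of two binary laws with small
errors, hence below 2^(-b/8000) (`affinity_pow_le_of_solves`). The order `l` balances the two: the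
prior costs only α^(-l) ≤ 2^b, while an error of size about 2^(-(a+b)), raised to the power `l`, is
still exponentially small in `b`.

A channel replaces p, q by their images, so the task is to find a quantizer whose affinity ρ' is not
much closer to 1 than ρ.

If ρ is small, so that O(b) samples suffice, one bit per sample is enough: some threshold of the
likelihood ratio has both error masses bounded by suitable powers of ρ (`exists_threshold`), with no
loss beyond a constant.

Otherwise log(1/ρ) is comparable to 1 - ρ, which is a sum of nonnegative pointwise gaps. Symbols are
grouped into levels, dyadic in p/q when p ≥ 2q and in |p - q|/q otherwise. Merging one level keeps a
constant share of its gap (`level_cell`). Ratios p/q beyond 2^(a+4) need no distinction because 1/l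
≤ a + 4, and symbols with |p - q| ≤ 2^(-M) q contribute at most 4^(-M) to the total weight. With 4^M
about n, only O(a + log n) levels count. The best block of D - 1 consecutive levels therefore
carries a share of order 1/max(1, log(n/α)/D) of the gap (`gap_le_levelMap`); the remaining symbols
share the last letter.

Infinite alphabets are reduced to finite ones by merging all but finitely many symbols. The bound of
each sample complexity by the constrained one is data processing.

The algorithm searches for a certified threshold and, failing that, tabulates the block weights. All
its tests use field operations and integer powers only, so it runs exactly on the real RAM. Its
correctness proof also supplies the quantizer for the statistical bound. -/

namespace HypTest

/-! ### Product laws, the Bayes test and data processing. -/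

theorem tsum_pi_prod {X : Type*} (n : ℕ) (g : Fin n → X → ℝ≥0∞) :
    ∑' x : Fin n → X, ∏ i, g i (x i) = ∏ i, ∑' a, g i a := by
  induction n with
  | zero => simp
  | succ n ih =>
    rw [← (Fin.consEquiv (fun _ : Fin (n + 1) => X)).tsum_eq, ENNReal.tsum_prod',
      Fin.prod_univ_succ, ← ih fun i => g i.succ, ← ENNReal.tsum_mul_right]
    refine tsum_congr fun a => ?_
    rw [← ENNReal.tsum_mul_left]
    exact tsum_congr fun x => by simp [Fin.consEquiv, Fin.prod_univ_succ]

theorem tsum_iidMass {X : Type*} (p : PMF X) (n : ℕ) : ∑' x, iidMass p n x = 1 := by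
  simp [iidMass, tsum_pi_prod n fun _ => p]

/-- The outputs are again i.i.d., so a constrained problem is an ordinary one between the image
laws. -/
theorem outMass_eq {X Y : Type*} (p : PMF X) (f : X → PMF Y) (n : ℕ) :
    outMass p f n = iidMass (p.bind f) n := by
  funext y
  simp only [outMass, iidMass, ← Finset.prod_mul_distrib]
  rw [tsum_pi_prod n fun i a => p a * f a (y i)]
  simp [PMF.bind_apply]

theorem solvesVia_iff {X Y : Type*} (p q : PMF X) (α δ : ℝ) (n : ℕ) (φ : Test Y) (f : X → PMF Y) :
    SolvesVia p q α δ n φ f ↔ Solves (p.bind f) (q.bind f) α δ n φ := by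
  simp only [SolvesVia, Solves, outMass_eq]

/-- The Bayes-optimal test. -/
noncomputable def bayesTest {X : Type*} (p q : PMF X) (α : ℝ) : Test X := fun n x =>
  @decide (ENNReal.ofReal (1 - α) * iidMass q n x ≤ ENNReal.ofReal α * iidMass p n x)
    (Classical.propDecidable _)

theorem avgError_eq {Y : Type*} (α : ℝ) (n : ℕ) (P Q : (Fin n → Y) → ℝ≥0∞) (φ : Test Y) :
    avgError α n P Q φ =
      ∑' y, if φ n y = true then ENNReal.ofReal (1 - α) * Q y else ENNReal.ofReal α * P y := by
  rw [avgError, ← ENNReal.tsum_mul_left, ← ENNReal.tsum_mul_left, ← ENNReal.tsum_add]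
  exact tsum_congr fun y => by split_ifs <;> simp

theorem avgError_bayesTest {X : Type*} (p q : PMF X) (α : ℝ) (n : ℕ) :
    avgError α n (iidMass p n) (iidMass q n) (bayesTest p q α) =
      ∑' x, min (ENNReal.ofReal α * iidMass p n x) (ENNReal.ofReal (1 - α) * iidMass q n x) := by
  rw [avgError_eq]
  refine tsum_congr fun x => ?_
  simp only [bayesTest, decide_eq_true_eq]
  split_ifs with h
  · exact (min_eq_right h).symm
  · exact (min_eq_left (not_le.1 h).le).symm

/-- Testing on the outputs is a randomised test on the inputs. The Bayes error is a sum of pointwise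
minima; each minimum is distributed over the outputs by the channel and is at most whichever term
`φ` charges there. -/
theorem avgError_bayesTest_le_outMass {X Y : Type*} (p q : PMF X) (f : X → PMF Y) (α : ℝ) (n : ℕ)
    (φ : Test Y) :
    avgError α n (iidMass p n) (iidMass q n) (bayesTest p q α) ≤
      avgError α n (outMass p f n) (outMass q f n) φ := by
  rw [avgError_bayesTest, avgError_eq]
  have h1 : ∀ x : Fin n → X, ∑' y : Fin n → Y, ∏ i, f (x i) (y i) = 1 := fun x => by
    rw [tsum_pi_prod n fun i => f (x i)]; simp
  calc _ = ∑' x, ∑' y : Fin n → Y, min (ENNReal.ofReal α * iidMass p n x)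
            (ENNReal.ofReal (1 - α) * iidMass q n x) * ∏ i, f (x i) (y i) := by
        simp only [ENNReal.tsum_mul_left, h1, mul_one]
    _ = ∑' y : Fin n → Y, ∑' x, min (ENNReal.ofReal α * iidMass p n x)
            (ENNReal.ofReal (1 - α) * iidMass q n x) * ∏ i, f (x i) (y i) := ENNReal.tsum_comm
    _ ≤ _ := by
        refine ENNReal.tsum_le_tsum fun y => ?_
        split_ifs
        · rw [outMass, ← ENNReal.tsum_mul_left]
          refine ENNReal.tsum_le_tsum fun x => ?_
          rw [← mul_assoc]
          gcongr
          exact min_le_right _ _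
        · rw [outMass, ← ENNReal.tsum_mul_left]
          refine ENNReal.tsum_le_tsum fun x => ?_
          rw [← mul_assoc]
          gcongr
          exact min_le_left _ _

theorem sampleComplexity_le_constrained {X Y : Type*} (p q : PMF X) (α δ : ℝ)
    (𝒞 : Set (X → PMF Y)) :
    sampleComplexity p q α δ ≤ constrainedSampleComplexity p q α δ 𝒞 := by
  refine le_sInf ?_
  rintro _ ⟨n, rfl, φ, f, -, h⟩
  exact sInf_le ⟨n, rfl, bayesTest p q α, (avgError_bayesTest_le_outMass p q f α n φ).trans h⟩

/-! ### The affinity determines the sample complexity up to constants. -/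

/-- The Hellinger-type affinity `∑ p^(1-l) q^l`. -/
noncomputable def affinity {X : Type*} (l : ℝ) (p q : PMF X) : ℝ≥0∞ :=
  ∑' x, p x ^ (1 - l) * q x ^ l

theorem tsum_iidMass_rpow {X : Type*} {l : ℝ} (hl0 : 0 ≤ l) (hl1 : l ≤ 1) (p q : PMF X) (n : ℕ) :
    ∑' x, iidMass p n x ^ (1 - l) * iidMass q n x ^ l = affinity l p q ^ n := by
  simp only [iidMass, ← ENNReal.prod_rpow_of_nonneg (sub_nonneg.2 hl1),
    ← ENNReal.prod_rpow_of_nonneg hl0, ← Finset.prod_mul_distrib]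
  rw [tsum_pi_prod n fun _ a => p a ^ (1 - l) * q a ^ l]
  simp [affinity]

theorem min_le_rpow_mul_rpow {l : ℝ} (hl0 : 0 ≤ l) (hl1 : l ≤ 1) (x y : ℝ≥0∞) :
    min x y ≤ x ^ (1 - l) * y ^ l := by
  calc min x y = min x y ^ (1 - l) * min x y ^ l := by
        rw [← ENNReal.rpow_add_of_nonneg _ _ (sub_nonneg.2 hl1) hl0]; simp
    _ ≤ _ := by
        have := sub_nonneg.2 hl1
        gcongr
        · exact min_le_left _ _
        · exact min_le_right _ _

/-- Chernoff's bound; the factor (1-α)^l ≤ 1 is dropped. -/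
theorem solves_bayesTest {X : Type*} {l α δ : ℝ} (hl0 : 0 ≤ l) (hl1 : l ≤ 1) (hα0 : 0 < α)
    (p q : PMF X) (n : ℕ)
    (h : ENNReal.ofReal (α ^ (1 - l)) * affinity l p q ^ n ≤ ENNReal.ofReal δ) :
    Solves p q α δ n (bayesTest p q α) := by
  refine le_trans ?_ h
  rw [avgError_bayesTest, ← tsum_iidMass_rpow hl0 hl1, ← ENNReal.tsum_mul_left]
  refine ENNReal.tsum_le_tsum fun x => (min_le_rpow_mul_rpow hl0 hl1 _ _).trans ?_
  rw [ENNReal.mul_rpow_of_nonneg _ _ (sub_nonneg.2 hl1), ENNReal.mul_rpow_of_nonneg _ _ hl0,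
    ← ENNReal.ofReal_rpow_of_pos hα0, mul_assoc]
  gcongr
  calc _ ≤ 1 ^ l * iidMass q n x ^ l := by
        gcongr
        exact ENNReal.ofReal_le_one.2 (by linarith)
    _ = _ := by simp

/-- Hölder's inequality for counting measure; with the σ-algebra `⊤` measurability is automatic. -/
theorem tsum_rpow_mul_rpow_le {Y : Type*} {l : ℝ} (hl0 : 0 ≤ l) (hl1 : l ≤ 1) (f g : Y → ℝ≥0∞) :
    ∑' y, f y ^ (1 - l) * g y ^ l ≤ (∑' y, f y) ^ (1 - l) * (∑' y, g y) ^ l := by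
  let _ : MeasurableSpace Y := ⊤
  have := ENNReal.lintegral_mul_norm_pow_le (μ := MeasureTheory.Measure.count) (f := f) (g := g)
    measurable_from_top.aemeasurable measurable_from_top.aemeasurable (sub_nonneg.2 hl1) hl0
    (sub_add_cancel _ _)
  simpa only [MeasureTheory.lintegral_count] using this

/-- Data processing for the affinity: a test with error probabilities `x`, `y` bounds it by the
affinity of the two induced binary distributions. -/
theorem exists_error_of_solves {X : Type*} {l α δ : ℝ} (hl0 : 0 ≤ l) (hl1 : l ≤ 1) (hα0 : 0 < α)
    (hα1 : α < 1) (hδ : 0 ≤ δ) {p q : PMF X} {n : ℕ} {φ : Test X} (h : Solves p q α δ n φ) :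
    ∃ x y : ℝ, 0 ≤ x ∧ x ≤ 1 ∧ 0 ≤ y ∧ y ≤ 1 ∧ x ≤ δ / α ∧ y ≤ δ / (1 - α) ∧
      affinity l p q ^ n ≤
        ENNReal.ofReal ((1 - x) ^ (1 - l) * y ^ l + x ^ (1 - l) * (1 - y) ^ l) := by
  set P := iidMass p n
  set Q := iidMass q n
  set P1 := ∑' z, if φ n z = true then P z else 0
  set P0 := ∑' z, if φ n z = true then 0 else P z with hP0
  set Q1 := ∑' z, if φ n z = true then Q z else 0 with hQ1
  set Q0 := ∑' z, if φ n z = true then 0 else Q z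
  have hP : P1 + P0 = 1 := by
    rw [← tsum_iidMass p n, ← ENNReal.tsum_add]
    exact tsum_congr fun z => by split_ifs <;> simp [P]
  have hQ : Q1 + Q0 = 1 := by
    rw [← tsum_iidMass q n, ← ENNReal.tsum_add]
    exact tsum_congr fun z => by split_ifs <;> simp [Q]
  have hP0' : P0 ≤ 1 := hP ▸ le_add_self
  have hQ1' : Q1 ≤ 1 := hQ ▸ le_self_add
  have hP0t : P0 ≠ ⊤ := ne_top_of_le_ne_top ENNReal.one_ne_top hP0'
  have hQ1t : Q1 ≠ ⊤ := ne_top_of_le_ne_top ENNReal.one_ne_top hQ1'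
  have eP1 : P1 = ENNReal.ofReal (1 - P0.toReal) := by
    rw [ENNReal.ofReal_sub _ ENNReal.toReal_nonneg, ENNReal.ofReal_toReal hP0t, ENNReal.ofReal_one]
    exact ENNReal.eq_sub_of_add_eq hP0t hP
  have eQ0 : Q0 = ENNReal.ofReal (1 - Q1.toReal) := by
    rw [ENNReal.ofReal_sub _ ENNReal.toReal_nonneg, ENNReal.ofReal_toReal hQ1t, ENNReal.ofReal_one]
    exact ENNReal.eq_sub_of_add_eq hQ1t (by rw [add_comm, hQ])
  have eP0 := (ENNReal.ofReal_toReal hP0t).symm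
  have eQ1 := (ENNReal.ofReal_toReal hQ1t).symm
  have hx1 : P0.toReal ≤ 1 := ENNReal.toReal_mono ENNReal.one_ne_top hP0'
  have hy1 : Q1.toReal ≤ 1 := ENNReal.toReal_mono ENNReal.one_ne_top hQ1'
  have hsum : ENNReal.ofReal α * P0 + ENNReal.ofReal (1 - α) * Q1 ≤ ENNReal.ofReal δ := h
  refine ⟨P0.toReal, Q1.toReal, ENNReal.toReal_nonneg, hx1, ENNReal.toReal_nonneg, hy1, ?_, ?_, ?_⟩
  · have := le_self_add.trans hsum
    rw [eP0, ← ENNReal.ofReal_mul hα0.le, ENNReal.ofReal_le_ofReal_iff hδ] at this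
    rw [le_div_iff₀ hα0]; linarith
  · have := le_add_self.trans hsum
    rw [eQ1, ← ENNReal.ofReal_mul (by linarith), ENNReal.ofReal_le_ofReal_iff hδ] at this
    rw [le_div_iff₀ (by linarith)]; linarith
  · have h1l := sub_nonneg.2 hl1
    -- Hölder is applied separately on the acceptance and the rejection region.
    have e1 : ∑' z, (if φ n z = true then P z else 0) ^ (1 - l) *
        (if φ n z = true then Q z else 0) ^ l ≤ P1 ^ (1 - l) * Q1 ^ l :=
      tsum_rpow_mul_rpow_le hl0 hl1 _ _
    have e2 : ∑' z, (if φ n z = true then 0 else P z) ^ (1 - l) *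
        (if φ n z = true then 0 else Q z) ^ l ≤ P0 ^ (1 - l) * Q0 ^ l :=
      tsum_rpow_mul_rpow_le hl0 hl1 _ _
    have e3 : affinity l p q ^ n ≤ P1 ^ (1 - l) * Q1 ^ l + P0 ^ (1 - l) * Q0 ^ l := by
      refine le_trans ?_ (add_le_add e1 e2)
      rw [← tsum_iidMass_rpow hl0 hl1, ← ENNReal.tsum_add]
      refine ENNReal.tsum_le_tsum fun z => ?_
      split_ifs <;> simp [P, Q]
    refine e3.trans_eq ?_
    have hx0 : 0 ≤ P0.toReal := ENNReal.toReal_nonneg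
    have hy0 : 0 ≤ Q1.toReal := ENNReal.toReal_nonneg
    have hx2 := sub_nonneg.2 hx1
    have hy2 := sub_nonneg.2 hy1
    rw [ENNReal.ofReal_add (by positivity) (by positivity), ENNReal.ofReal_mul (by positivity),
      ENNReal.ofReal_mul (by positivity), ← ENNReal.ofReal_rpow_of_nonneg hx2 h1l,
      ← ENNReal.ofReal_rpow_of_nonneg hy0 hl0, ← ENNReal.ofReal_rpow_of_nonneg hx0 h1l,
      ← ENNReal.ofReal_rpow_of_nonneg hy2 hl0, ← eP1, ← eQ0, ← eP0, ← eQ1]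

/-- `a` and `b` are the roundings of `log₂ (1 / α)` and `log₂ (α / δ)`. -/
structure LogCounts (α δ : ℝ) (a b : ℕ) : Prop where
  one_le_a : 1 ≤ a
  two_le_b : 2 ≤ b
  one_le : 1 ≤ 2 ^ a * α
  lt_two : 2 ^ a * α < 2
  pow_mul_le : 2 ^ b * δ ≤ α
  lt_pow_mul : α < 2 ^ (b + 1) * δ

/-- The order of the affinity used for the prior and error with logarithms `a` and `b`. -/
noncomputable def order (a b : ℕ) : ℝ := b / (4 * b + a)

theorem order_pos {α δ : ℝ} {a b : ℕ} (h : LogCounts α δ a b) : 0 < order a b := by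
  have : (2 : ℝ) ≤ b := by exact_mod_cast h.two_le_b
  unfold order
  positivity

theorem order_le {α δ : ℝ} {a b : ℕ} (h : LogCounts α δ a b) : order a b ≤ 1 / 4 := by
  have : (2 : ℝ) ≤ b := by exact_mod_cast h.two_le_b
  have : (0 : ℝ) ≤ a := by positivity
  unfold order
  rw [div_le_div_iff₀ (by positivity) (by positivity)]
  linarith

/-- Writing the left side as u^(1-2l) · (√(uv))^(2l) and using AM-GM compares order `l` with the
Hellinger order 1/2 at the cost of a factor `l`. -/
theorem rpow_mul_rpow_le_sqrt {l u v : ℝ} (hl0 : 0 < l) (hl1 : l ≤ 1 / 2) (hu : 0 ≤ u)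
    (hv : 0 ≤ v) : u ^ (1 - l) * v ^ l ≤ (1 - 2 * l) * u + 2 * l * √(u * v) := by
  have h := Real.geom_mean_le_arith_mean2_weighted (w₁ := 1 - 2 * l) (w₂ := 2 * l) (p₁ := u)
    (p₂ := √(u * v)) (by linarith) (by linarith) hu (Real.sqrt_nonneg _) (by ring)
  refine le_trans (le_of_eq ?_) h
  rw [Real.sqrt_eq_rpow, ← Real.rpow_mul (by positivity), Real.mul_rpow hu hv, ← mul_assoc,
    ← Real.rpow_add_of_nonneg hu (by linarith) (by linarith)]
  ring_nf

theorem binary_affinity_le {l x y : ℝ} (hl0 : 0 < l) (hl1 : l ≤ 1 / 2) (hx0 : 0 ≤ x) (hy0 : 0 ≤ y)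
    (hx : x ≤ 1 / 4) (hy : y ≤ 1 / 4) :
    (1 - x) ^ (1 - l) * y ^ l + x ^ (1 - l) * (1 - y) ^ l ≤ 1 - l / 4 := by
  have h1 := rpow_mul_rpow_le_sqrt (u := 1 - x) hl0 hl1 (by linarith) hy0
  have h2 := rpow_mul_rpow_le_sqrt (v := 1 - y) hl0 hl1 hx0 (by linarith)
  -- AM-GM, tight at the extremal ratio 3 : 1 attained for x = y = 1/4; 0.29 exceeds 1/(2√3). The
  -- two roots then sum to at most 0.29 · (2 + 2x + 2y) ≤ 0.87 < 7/8.
  have h3 : √((1 - x) * y) ≤ 0.29 * ((1 - x) + 3 * y) := by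
    refine Real.sqrt_le_iff.2 ⟨by norm_num; linarith, ?_⟩
    have : 0 ≤ (1 - x) * y := mul_nonneg (by linarith) hy0
    nlinarith [sq_nonneg ((1 - x) - 3 * y)]
  have h4 : √(x * (1 - y)) ≤ 0.29 * (3 * x + (1 - y)) := by
    refine Real.sqrt_le_iff.2 ⟨by norm_num; linarith, ?_⟩
    have : 0 ≤ x * (1 - y) := mul_nonneg hx0 (by linarith)
    nlinarith [sq_nonneg (3 * x - (1 - y))]
  have h5 : √((1 - x) * y) + √(x * (1 - y)) ≤ 0.87 := by norm_num at h3 h4 ⊢; linarith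
  nlinarith [mul_le_mul_of_nonneg_left h5 hl0.le]

/-- The errors satisfy x ≤ 2^(-b) and y ≤ 2^(-(a+b-2)), so bounding the other factors by 1 leaves
2^(-(a+b-2)l) + 2^(-3b/4). This is good enough if `b ≥ 16` or `a ≥ 180`. In the remaining bounded
range it may exceed 1, but there `l ≥ 1/100`, and `binary_affinity_le` gives 1 - 1/400, which is at
most 2^(-b/8000) for `b ≤ 15`. -/
theorem error_affinity_le {α δ x y : ℝ} {a b : ℕ} (h : LogCounts α δ a b) (hα0 : 0 < α)
    (hα1 : α ≤ 1 / 2) (hδ0 : 0 < δ) (hx0 : 0 ≤ x) (hx1 : x ≤ 1) (hy0 : 0 ≤ y) (hy1 : y ≤ 1)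
    (hx : x ≤ δ / α) (hy : y ≤ δ / (1 - α)) :
    (1 - x) ^ (1 - order a b) * y ^ order a b + x ^ (1 - order a b) * (1 - y) ^ order a b ≤
      2 ^ (-(b / 8000 : ℝ)) := by
  have hl0 := order_pos h
  have hl1 := order_le h
  have hb2 : (2 : ℝ) ≤ b := by exact_mod_cast h.two_le_b
  have ha1 : (1 : ℝ) ≤ a := by exact_mod_cast h.one_le_a
  have hxb : x ≤ 2 ^ (-(b : ℝ)) := by
    rw [Real.rpow_neg (by norm_num), Real.rpow_natCast]
    refine hx.trans ?_
    rw [div_le_iff₀ hα0, ← div_eq_inv_mul, le_div_iff₀ (by positivity)]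
    linarith [h.pow_mul_le]
  have hyb : y ≤ 2 ^ (-((a : ℝ) + b - 2)) := by
    have : y ≤ 2 * δ := by
      refine hy.trans ?_
      rw [div_le_iff₀ (by linarith)]
      nlinarith
    refine this.trans ?_
    rw [show -((a : ℝ) + b - 2) = 2 + (-(a : ℝ) + -(b : ℝ)) by ring, Real.rpow_add (by norm_num),
      Real.rpow_add (by norm_num), Real.rpow_neg (by norm_num), Real.rpow_neg (by norm_num),
      Real.rpow_natCast, Real.rpow_natCast, ← mul_inv, ← div_eq_mul_inv, le_div_iff₀ (by positivity)]
    have h1 := h.pow_mul_le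
    have h2 := h.lt_two
    have h3 : (0 : ℝ) < 2 ^ a := by positivity
    norm_num
    nlinarith
  have hcrude : (1 - x) ^ (1 - order a b) * y ^ order a b + x ^ (1 - order a b) *
      (1 - y) ^ order a b ≤ 2 ^ (-(((a : ℝ) + b - 2) * order a b)) + 2 ^ (-(3 / 4 * b : ℝ)) := by
    refine add_le_add ?_ ?_
    · rw [← one_mul ((2 : ℝ) ^ _), ← neg_mul, Real.rpow_mul (by norm_num)]
      have : (1 - x) ^ (1 - order a b) ≤ 1 := Real.rpow_le_one (by linarith) (by linarith) (by linarith)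
      gcongr
    · rw [← mul_one ((2 : ℝ) ^ _)]
      have h1 : (1 - y) ^ order a b ≤ 1 := Real.rpow_le_one (by linarith) (by linarith) (by linarith)
      have h2 : x ^ (1 - order a b) ≤ 2 ^ (-(3 / 4 * b : ℝ)) := by
        calc x ^ (1 - order a b) ≤ (2 ^ (-(b : ℝ))) ^ (1 - order a b) := by
              have : 0 ≤ 1 - order a b := by linarith
              gcongr
          _ = 2 ^ (-(b : ℝ) * (1 - order a b)) := by rw [Real.rpow_mul (by norm_num)]
          _ ≤ _ := by
              refine Real.rpow_le_rpow_of_exponent_le (by norm_num) ?_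
              nlinarith
      have : 0 ≤ 1 - y := by linarith
      gcongr
  have two_mono : ∀ {s t : ℝ}, s ≤ t → (2 : ℝ) ^ s ≤ 2 ^ t := fun hst =>
    Real.rpow_le_rpow_of_exponent_le (by norm_num) hst
  have hdouble : ∀ s : ℝ, (2 : ℝ) ^ s + 2 ^ s = 2 ^ (1 + s) := fun s => by
    rw [Real.rpow_add (by norm_num), Real.rpow_one]; ring
  rcases le_or_gt 16 b with hb | hb
  · have hb : (16 : ℝ) ≤ b := by exact_mod_cast hb
    have e : (b : ℝ) / 8 ≤ ((a : ℝ) + b - 2) * order a b := by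
      unfold order
      rw [mul_div_assoc', div_le_div_iff₀ (by positivity) (by positivity)]
      nlinarith
    calc _ ≤ _ := hcrude
      _ ≤ (2 : ℝ) ^ (-(b / 8 : ℝ)) + 2 ^ (-(b / 8 : ℝ)) := by
          refine add_le_add (two_mono ?_) (two_mono ?_) <;> linarith
      _ ≤ _ := by rw [hdouble]; exact two_mono (by linarith)
  have hb : (b : ℝ) ≤ 15 := by exact_mod_cast (by omega : b ≤ 15)
  rcases le_or_gt 180 a with ha | ha
  · have ha : (180 : ℝ) ≤ a := by exact_mod_cast ha
    have e : (3 : ℝ) / 2 ≤ ((a : ℝ) + b - 2) * order a b := by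
      unfold order
      rw [mul_div_assoc', div_le_div_iff₀ (by positivity) (by positivity)]
      nlinarith
    calc _ ≤ _ := hcrude
      _ ≤ (2 : ℝ) ^ (-(3 / 2 : ℝ)) + 2 ^ (-(3 / 2 : ℝ)) := by
          refine add_le_add (two_mono ?_) (two_mono ?_) <;> linarith
      _ ≤ _ := by rw [hdouble]; exact two_mono (by linarith)
  have ha : (a : ℝ) ≤ 179 := by exact_mod_cast (by omega : a ≤ 179)
  have hl : 1 / 100 ≤ order a b := by
    unfold order
    rw [div_le_div_iff₀ (by positivity) (by positivity)]
    linarith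
  have h4 : (2 : ℝ) ^ (-(b : ℝ)) ≤ 1 / 4 := by
    calc (2 : ℝ) ^ (-(b : ℝ)) ≤ 2 ^ (-(2 : ℕ) : ℝ) := two_mono (by simpa using hb2)
      _ = 1 / 4 := by rw [Real.rpow_neg (by norm_num), Real.rpow_natCast]; norm_num
  have hy4 : y ≤ 1 / 4 := by
    have : (4 : ℝ) ≤ 2 ^ b := by
      calc (4 : ℝ) = 2 ^ 2 := by norm_num
        _ ≤ 2 ^ b := pow_le_pow_right₀ (by norm_num) h.two_le_b
    refine hy.trans ?_
    rw [div_le_div_iff₀ (by linarith) (by norm_num)]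
    nlinarith [h.pow_mul_le]
  calc _ ≤ 1 - order a b / 4 := binary_affinity_le hl0 (by linarith) hx0 hy0 (hxb.trans h4) hy4
    _ ≤ -(1 / 400) + 1 := by linarith
    _ ≤ Real.exp (-(1 / 400)) := Real.add_one_le_exp _
    _ ≤ Real.exp (Real.log 2 * (-(b / 8000 : ℝ))) := by
        have := Real.log_two_lt_d9
        refine Real.exp_le_exp.2 ?_
        nlinarith
    _ = _ := by rw [Real.rpow_def_of_pos (by norm_num)]

/-- A test that solves the problem with `n` samples bounds the `n`-th power of the affinity. -/
theorem affinity_pow_le_of_solves {X : Type*} {α δ : ℝ} {a b : ℕ} (h : LogCounts α δ a b)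
    (hα0 : 0 < α) (hα1 : α ≤ 1 / 2) (hδ0 : 0 < δ) {p q : PMF X} {n : ℕ} {φ : Test X}
    (hφ : Solves p q α δ n φ) :
    affinity (order a b) p q ^ n ≤ ENNReal.ofReal (2 ^ (-(b / 8000 : ℝ))) := by
  have hl0 := order_pos h
  have hl1 := order_le h
  obtain ⟨x, y, hx0, hx1, hy0, hy1, hx, hy, hle⟩ :=
    exists_error_of_solves hl0.le (by linarith) hα0 (by linarith) hδ0.le hφ
  exact hle.trans (ENNReal.ofReal_le_ofReal
    (error_affinity_le h hα0 hα1 hδ0 hx0 hx1 hy0 hy1 hx hy))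

/-- A small `n`-th power of the affinity makes the Bayes test solve the problem. -/
theorem exists_solves_of_affinity_pow_le {X : Type*} {α δ : ℝ} {a b : ℕ} (h : LogCounts α δ a b)
    (hα0 : 0 < α) (hδ0 : 0 < δ) {p q : PMF X} {n : ℕ}
    (hn : affinity (order a b) p q ^ n ≤ ENNReal.ofReal (2 ^ (-(3 * b : ℝ)))) :
    ∃ φ : Test X, Solves p q α δ n φ := by
  have hl0 := order_pos h
  have hl1 := order_le h
  have hb2 : (2 : ℝ) ≤ b := by exact_mod_cast h.two_le_b
  refine ⟨_, solves_bayesTest hl0.le (by linarith) hα0 p q n ?_⟩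
  refine (mul_le_mul_right hn _).trans ?_
  rw [← ENNReal.ofReal_mul (by positivity)]
  refine ENNReal.ofReal_le_ofReal ?_
  -- The order satisfies a · l ≤ b. Hence α · α^(-l) · ρ^n ≤ (2^(b+1) δ) · 2^b · 2^(-3b) = 2^(1-b)
  -- δ.
  have h1 : α ^ (-order a b) ≤ 2 ^ (b : ℝ) := by
    have hα : (2 : ℝ) ^ (-(a : ℝ)) ≤ α := by
      rw [Real.rpow_neg (by norm_num), Real.rpow_natCast, ← one_div, div_le_iff₀ (by positivity)]
      linarith [h.one_le]
    calc α ^ (-order a b) ≤ (2 ^ (-(a : ℝ))) ^ (-order a b) :=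
          Real.rpow_le_rpow_of_nonpos (by positivity) hα (by linarith)
      _ = 2 ^ (a * order a b) := by rw [← Real.rpow_mul (by norm_num)]; ring_nf
      _ ≤ _ := by
          refine Real.rpow_le_rpow_of_exponent_le (by norm_num) ?_
          unfold order
          rw [mul_div_assoc', div_le_iff₀ (by positivity)]
          nlinarith
  rw [sub_eq_add_neg, Real.rpow_add hα0, Real.rpow_one]
  have h2 := h.lt_pow_mul
  calc α * α ^ (-order a b) * 2 ^ (-(3 * b : ℝ))
      ≤ (2 ^ (b + 1) * δ) * 2 ^ (b : ℝ) * 2 ^ (-(3 * b : ℝ)) := by gcongr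
    _ = δ * 2 ^ ((1 : ℝ) - b) := by
        rw [mul_assoc, ← Real.rpow_add (by norm_num), mul_right_comm, ← Real.rpow_natCast,
          ← Real.rpow_add (by norm_num), mul_comm]
        push_cast
        ring_nf
    _ ≤ δ * 1 := by
        gcongr
        exact Real.rpow_le_one_of_one_le_of_nonpos (by norm_num) (by linarith)
    _ = δ := mul_one δ

/-! ### Two-sided estimates of the pointwise gap. -/

/-- The pointwise contribution to `1 - ∑ p^(1-l) q^l`. -/
noncomputable def gap (l u v : ℝ) : ℝ := (1 - l) * u + l * v - u ^ (1 - l) * v ^ l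

theorem gap_nonneg {l u v : ℝ} (hl0 : 0 ≤ l) (hl1 : l ≤ 1) (hu : 0 ≤ u) (hv : 0 ≤ v) :
    0 ≤ gap l u v := by
  have := Real.geom_mean_le_arith_mean2_weighted (sub_nonneg.2 hl1) hl0 hu hv (by ring)
  unfold gap
  linarith

theorem mul_sub_sqrt_le_gap {l u v : ℝ} (hl0 : 0 < l) (hl1 : l ≤ 1 / 2) (hu : 0 ≤ u)
    (hv : 0 ≤ v) : l * (u + v - 2 * √(u * v)) ≤ gap l u v := by
  have := rpow_mul_rpow_le_sqrt hl0 hl1 hu hv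
  unfold gap
  linarith

/-- The Hellinger term (√u - √v)² equals (u - v)²/(√u + √v)², and (√u + √v)² ≤ 6v when u ≤ 2v. -/
theorem le_gap_of_le_two_mul {l u v : ℝ} (hl0 : 0 < l) (hl1 : l ≤ 1 / 2) (hu : 0 ≤ u)
    (huv : u ≤ 2 * v) : l * ((u - v) ^ 2 / (6 * v)) ≤ gap l u v := by
  have hv : 0 ≤ v := by linarith
  refine le_trans ?_ (mul_sub_sqrt_le_gap hl0 hl1 hu hv)
  refine mul_le_mul_of_nonneg_left ?_ hl0.le
  rcases hv.eq_or_lt with rfl | hv'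
  · simpa using hu
  rw [Real.sqrt_mul hu]
  obtain ⟨s, hs, rfl⟩ : ∃ s, 0 ≤ s ∧ u = s ^ 2 := ⟨√u, Real.sqrt_nonneg _, (Real.sq_sqrt hu).symm⟩
  obtain ⟨t, ht, rfl⟩ : ∃ t, 0 ≤ t ∧ v = t ^ 2 := ⟨√v, Real.sqrt_nonneg _, (Real.sq_sqrt hv).symm⟩
  rw [Real.sqrt_sq hs, Real.sqrt_sq ht, div_le_iff₀ (by positivity)]
  have h1 : (s + t) ^ 2 ≤ 6 * t ^ 2 := by nlinarith [sq_nonneg (s - t)]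
  nlinarith [mul_le_mul_of_nonneg_left h1 (sq_nonneg (s - t))]

theorem two_rpow_neg_le {x : ℝ} (h0 : 0 ≤ x) (h1 : x ≤ 1) : (2 : ℝ) ^ (-x) ≤ 1 - x / 2 := by
  have := Real.geom_mean_le_arith_mean2_weighted (w₁ := x) (w₂ := 1 - x) (p₁ := 1 / 2) (p₂ := 1)
    h0 (sub_nonneg.2 h1) (by norm_num) (by norm_num) (by ring)
  rw [Real.one_rpow, mul_one, one_div, Real.inv_rpow (by norm_num), ← Real.rpow_neg (by norm_num)]
    at this
  linarith

theorem mul_min_eq {l : ℝ} (hl0 : 0 < l) (j : ℝ) : l * min (1 / l) j = min 1 (l * j) := by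
  rw [mul_min_of_nonneg _ _ hl0.le, mul_one_div_cancel hl0.ne']

/-- For `j ≤ 3` the Hellinger bound suffices. For larger `j`, the geometric mean is at most u ·
2^(-lj), which leaves u(1 - l - 2^(-lj)); convexity gives 2^(-lj) ≤ 1 - lj/2 while lj ≤ 1, and `j ≥
4` lets lj/2 absorb the lost `l`. -/
theorem le_gap_of_pow_mul_le {l u v : ℝ} {j : ℕ} (hl0 : 0 < l) (hl1 : l ≤ 1 / 4) (hv : 0 ≤ v)
    (hj : 1 ≤ j) (huv : 2 ^ j * v ≤ u) : l * (u * min (1 / l) j) / 50 ≤ gap l u v := by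
  have hu : 0 ≤ u := le_trans (by positivity) huv
  rw [mul_left_comm, mul_min_eq hl0]
  rcases lt_or_ge j 4 with hj4 | hj4
  · have hj3 : (j : ℝ) ≤ 3 := by exact_mod_cast (by omega : j ≤ 3)
    have h2 : 2 * v ≤ u := by
      refine le_trans ?_ huv
      gcongr
      exact le_self_pow₀ (by norm_num) (by omega)
    have hs : √(u * v) ≤ u / 2 + v / 2 - 0.03 * u := by
      refine Real.sqrt_le_iff.2 ⟨by norm_num; linarith, ?_⟩
      nlinarith [mul_nonneg hu hv, mul_nonneg hu (sub_nonneg.2 h2)]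
    refine le_trans ?_ (mul_sub_sqrt_le_gap hl0 (by linarith) hu hv)
    calc u * min 1 (l * j) / 50 ≤ u * (l * 3) / 50 := by
          gcongr
          exact (min_le_right _ _).trans (by gcongr)
      _ = l * (0.06 * u) := by ring
      _ ≤ _ := by
          refine mul_le_mul_of_nonneg_left ?_ hl0.le
          norm_num at hs ⊢
          linarith
  · have hj4 : (4 : ℝ) ≤ j := by exact_mod_cast hj4
    have hv2 : v ≤ u * 2 ^ (-(j : ℝ)) := by
      rw [Real.rpow_neg (by norm_num), Real.rpow_natCast, ← div_eq_mul_inv,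
        le_div_iff₀ (by positivity)]
      linarith
    have h1 : u ^ (1 - l) * v ^ l ≤ u * 2 ^ (-(l * j)) := by
      calc u ^ (1 - l) * v ^ l ≤ u ^ (1 - l) * (u * 2 ^ (-(j : ℝ))) ^ l := by gcongr
        _ = u ^ (1 - l) * u ^ l * 2 ^ (-(l * j)) := by
            rw [Real.mul_rpow hu (by positivity), ← Real.rpow_mul (by norm_num), mul_assoc]
            ring_nf
        _ = _ := by
            rw [← Real.rpow_add_of_nonneg hu (by linarith) hl0.le]
            simp
    have h2 : gap l u v ≥ u * (1 - l - 2 ^ (-(l * j))) := by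
      unfold gap
      nlinarith [mul_nonneg hl0.le hv]
    refine le_trans ?_ h2
    rw [mul_div_assoc]
    refine mul_le_mul_of_nonneg_left ?_ hu
    rcases le_or_gt (l * j) 1 with hx | hx
    · have := two_rpow_neg_le (by positivity) hx
      rw [min_eq_right hx]
      nlinarith
    · rw [min_eq_left hx.le]
      have : (2 : ℝ) ^ (-(l * j)) ≤ 2 ^ (-1 : ℝ) :=
        Real.rpow_le_rpow_of_exponent_le (by norm_num) (by linarith)
      rw [Real.rpow_neg_one] at this
      linarith

/-- From log r ≥ 1 - 1/r and e^t ≥ 1 + t, the geometric mean u · exp(l log(v/u)) is at least u(1 +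
l(1 - u/v)), which leaves the χ² term. -/
theorem gap_le_sq_div {l u v : ℝ} (hl0 : 0 < l) (hu : 0 ≤ u) (hv : 0 < v) :
    gap l u v ≤ l * ((u - v) ^ 2 / v) := by
  have key : u + l * (u * (v - u) / v) ≤ u ^ (1 - l) * v ^ l := by
    rcases hu.eq_or_lt with rfl | hu'
    · simp only [zero_mul, zero_div, mul_zero, add_zero]
      positivity
    · have h1 : u ^ (1 - l) * v ^ l = u * Real.exp (l * Real.log (v / u)) := by
        rw [Real.rpow_sub hu', Real.rpow_one, Real.rpow_def_of_pos hu', Real.rpow_def_of_pos hv,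
          Real.log_div hv.ne' hu'.ne', mul_sub, Real.exp_sub]
        ring_nf
      have h2 := Real.one_sub_inv_le_log_of_pos (div_pos hv hu')
      have h3 := Real.add_one_le_exp (l * Real.log (v / u))
      have h4 : l * (1 - (v / u)⁻¹) + 1 ≤ Real.exp (l * Real.log (v / u)) := by nlinarith
      rw [h1]
      refine le_trans (le_of_eq ?_) (mul_le_mul_of_nonneg_left h4 hu)
      field_simp
      ring
  unfold gap
  have : l * ((u - v) ^ 2 / v) = (1 - l) * u + l * v - (u + l * (u * (v - u) / v)) := by
    field_simp
    ring
  linarith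

/-- The geometric mean is at least u · 2^(-l(j+1)) ≥ u(1 - l(j+1)), and j + 1 ≤ 2j. At the saturated
level, where u/v is unbounded and v may vanish, 1/l ≤ j makes the trivial bound u enough. -/
theorem gap_le_of_lt_pow_mul {l u v : ℝ} {j : ℕ} (hl0 : 0 < l) (hl1 : l ≤ 1 / 4) (hv : 0 ≤ v)
    (hj : 1 ≤ j) (hvu : v ≤ u) (h : u ≤ 2 ^ (j + 1) * v ∨ 1 / l ≤ j) :
    gap l u v ≤ 2 * l * (u * min (1 / l) j) := by
  have hu : 0 ≤ u := hv.trans hvu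
  have hj1 : (1 : ℝ) ≤ j := by exact_mod_cast hj
  rw [show 2 * l * (u * min (1 / l) j) = 2 * u * (l * min (1 / l) (j : ℝ)) by ring, mul_min_eq hl0]
  have h0 : 0 ≤ u ^ (1 - l) * v ^ l := by positivity
  have h1 : gap l u v ≤ u := by
    unfold gap
    nlinarith
  rcases le_or_gt 1 (l * j) with hc | hc
  · rw [min_eq_left hc]; linarith
  rw [min_eq_right hc.le]
  have h2 : u ≤ 2 ^ (j + 1) * v := by
    refine h.resolve_right fun h' => ?_
    rw [div_le_iff₀ hl0] at h'
    linarith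
  have hv2 : u * 2 ^ (-((j : ℝ) + 1)) ≤ v := by
    rw [Real.rpow_neg (by norm_num), ← div_eq_mul_inv, div_le_iff₀ (by positivity)]
    have : (2 : ℝ) ^ ((j : ℝ) + 1) = 2 ^ (j + 1) := by
      rw [← Real.rpow_natCast]; push_cast; rfl
    rw [this]; linarith
  have h3 : u * 2 ^ (-(l * (j + 1))) ≤ u ^ (1 - l) * v ^ l := by
    calc u * 2 ^ (-(l * (j + 1))) = u ^ (1 - l) * u ^ l * 2 ^ (-(l * (j + 1))) := by
          rw [← Real.rpow_add_of_nonneg hu (by linarith) hl0.le]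
          simp
      _ = u ^ (1 - l) * (u * 2 ^ (-((j : ℝ) + 1))) ^ l := by
          rw [Real.mul_rpow hu (by positivity), ← Real.rpow_mul (by norm_num), mul_assoc]
          ring_nf
      _ ≤ _ := by gcongr
  have h4 : 1 - l * (j + 1) ≤ 2 ^ (-(l * ((j : ℝ) + 1))) := by
    have e1 := Real.add_one_le_exp (Real.log 2 * -(l * ((j : ℝ) + 1)))
    rw [← Real.rpow_def_of_pos (by norm_num)] at e1
    have e2 := Real.log_two_lt_d9
    have e3 : 0 < l * ((j : ℝ) + 1) := by positivity
    nlinarith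
  have h5 := mul_le_mul_of_nonneg_left h4 hu
  unfold gap
  have h6 : l * (j + 1) ≤ 2 * (l * j) := by nlinarith
  nlinarith [mul_le_mul_of_nonneg_left h6 hu]

/-! ### Dyadic levels of symbols and their weights. -/

open Classical in
/-- The largest `j ≤ K` with `2 ^ j * u ≤ v`. -/
noncomputable def dyadicCount (u v : ℝ) (K : ℕ) : ℕ := Nat.findGreatest (fun j => 2 ^ j * u ≤ v) K

theorem dyadicCount_le (u v : ℝ) (K : ℕ) : dyadicCount u v K ≤ K := by
  classical exact Nat.findGreatest_le K

theorem pow_dyadicCount_mul_le {u v : ℝ} {K : ℕ} (h : u ≤ v) : 2 ^ dyadicCount u v K * u ≤ v := by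
  classical
  exact Nat.findGreatest_spec (P := fun j => 2 ^ j * u ≤ v) (Nat.zero_le K) (by simpa using h)

theorem lt_pow_dyadicCount_mul {u v : ℝ} {K : ℕ} (h : dyadicCount u v K < K) :
    v < 2 ^ (dyadicCount u v K + 1) * u := by
  classical
  exact not_le.1 (Nat.findGreatest_is_greatest (P := fun j => 2 ^ j * u ≤ v) (Nat.lt_succ_self _) h)

theorem le_dyadicCount {u v : ℝ} {K j : ℕ} (hj : j ≤ K) (h : 2 ^ j * u ≤ v) :
    j ≤ dyadicCount u v K := by
  classical
  exact Nat.le_findGreatest hj h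

theorem dyadicCount_eq {u v : ℝ} {K j : ℕ} (hu : 0 ≤ u) (hj : j ≤ K) (h : 2 ^ j * u ≤ v)
    (h' : j = K ∨ v < 2 ^ (j + 1) * u) : dyadicCount u v K = j := by
  refine le_antisymm ?_ (le_dyadicCount hj h)
  rcases h' with rfl | h'
  · exact dyadicCount_le _ _ _
  by_contra! hlt
  have h1 : 2 ^ dyadicCount u v K * u ≤ v := by
    refine pow_dyadicCount_mul_le (le_trans ?_ h)
    exact le_mul_of_one_le_left hu (one_le_pow₀ (by norm_num))
  have h2 : (2 : ℝ) ^ (j + 1) * u ≤ 2 ^ dyadicCount u v K * u := by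
    gcongr
    · norm_num
    · omega
  linarith

/-- The rounded contribution of a symbol of probabilities `u`, `v` to the affinity gap, in units
of `1 / L`. -/
noncomputable def weight (L : ℝ) (a : ℕ) (u v : ℝ) : ℝ :=
  if 2 * v ≤ u then u * min L (dyadicCount v u (a + 4)) else (u - v) ^ 2 / v

/-- The level of a symbol: symbols of the same level have comparable likelihood ratios. -/
noncomputable def level (k a : ℕ) (u v : ℝ) (x : ℕ) : ℕ :=
  if 2 * v ≤ u then dyadicCount v u (a + 4)
  else if dyadicCount |u - v| v k < k then
    a + 5 + 2 * dyadicCount |u - v| v k + (if v < u then 1 else 0)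
  else a + 5 + 2 * k + x

theorem level_lt {k a : ℕ} {u v : ℝ} {x : ℕ} (hx : x < k) : level k a u v x < a + 5 + 3 * k := by
  unfold level
  have := dyadicCount_le v u (a + 4)
  split_ifs <;> omega

theorem abs_sub_le_of_not {u v : ℝ} (hu : 0 ≤ u) (h : ¬ 2 * v ≤ u) : |u - v| ≤ v := by
  rw [abs_le]; constructor <;> linarith

theorem weight_nonneg {L : ℝ} {a : ℕ} {u v : ℝ} (hL : 0 ≤ L) (hu : 0 ≤ u) (hv : 0 ≤ v) :
    0 ≤ weight L a u v := by
  unfold weight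
  split_ifs <;> positivity

theorem one_le_dyadicCount {a : ℕ} {u v : ℝ} (h : 2 * v ≤ u) : 1 ≤ dyadicCount v u (a + 4) :=
  le_dyadicCount (by omega) (by simpa using h)

/-- The cap `a + 4` on the dyadic count is harmless: it is at least 1/l, where the minimum in the
weight has already saturated. -/
theorem gap_le_weight {l : ℝ} {a : ℕ} {u v : ℝ} (hl0 : 0 < l) (hl1 : l ≤ 1 / 4)
    (hla : 1 / l ≤ a + 4) (hu : 0 ≤ u) (hv : 0 ≤ v) :
    gap l u v ≤ 2 * l * weight (1 / l) a u v := by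
  unfold weight
  split_ifs with h
  · refine gap_le_of_lt_pow_mul hl0 hl1 hv (one_le_dyadicCount h) (by linarith) ?_
    rcases (dyadicCount_le v u (a + 4)).eq_or_lt with h' | h'
    · right; rw [h']; push_cast; exact hla
    · left; exact (lt_pow_dyadicCount_mul h').le
  · have hv' : 0 < v := by linarith
    have := gap_le_sq_div hl0 hu hv'
    have : 0 ≤ l * ((u - v) ^ 2 / v) := by positivity
    linarith

theorem sq_sub_div_le {u v : ℝ} {i : ℕ} (hv : 0 < v) (h : 2 ^ i * |u - v| ≤ v) :
    (u - v) ^ 2 / v ≤ (1 / 4) ^ i * v := by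
  have h4 : (4 : ℝ) ^ i = (2 ^ i) ^ 2 := by rw [← pow_mul, mul_comm, pow_mul]; norm_num
  have h2 : (2 ^ i * |u - v|) ^ 2 ≤ v ^ 2 := by gcongr
  rw [div_le_iff₀ hv, one_div_pow, mul_assoc, one_div_mul_eq_div, le_div_iff₀ (by positivity), h4,
    ← sq_abs (u - v)]
  linarith

/-- The 3 in `3 * M` covers both kinds of deep level: two signs per dyadic scale, and the up to `k`
singleton levels after scale `k`. Either way |u - v| ≤ 2^(-M) v. -/
theorem weight_le_of_le_level {L : ℝ} {k a M : ℕ} {u v : ℝ} {x : ℕ} (hx : x < k) (hu : 0 ≤ u)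
    (h : a + 5 + 3 * M ≤ level k a u v x) : weight L a u v ≤ (1 / 4) ^ M * v := by
  unfold level at h
  have := dyadicCount_le v u (a + 4)
  have hk := dyadicCount_le |u - v| v k
  split_ifs at h with h1 h2 h3
  · omega
  all_goals
    have hM : M ≤ dyadicCount |u - v| v k := by omega
    have hv' : 0 < v := by linarith
    have h5 : 2 ^ M * |u - v| ≤ v := by
      refine le_trans ?_ (pow_dyadicCount_mul_le (K := k) (abs_sub_le_of_not hu h1))
      gcongr
      norm_num
    rw [weight, if_neg h1]
    exact sq_sub_div_le hv' h5

/-- The reason for the form of the levels. In a far level all ratios p/q satisfy the same dyadic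
lower bound, which survives summation. In a near level |p - q|/q is constant up to a factor 2, and
the parity of the level records the sign of p - q, so nothing cancels. Symbols too close for the
first `k` scales, including those with p = q, get a level of their own, where there is nothing to
merge. -/
theorem level_cell {l : ℝ} {k a : ℕ} (hl0 : 0 < l) (hl1 : l ≤ 1 / 4) {p q : Fin k → ℝ}
    (hp : ∀ x, 0 ≤ p x) (hq : ∀ x, 0 ≤ q x) (n : ℕ) (S : Finset (Fin k))
    (hS : ∀ x ∈ S, level k a (p x) (q x) x = n) :
    l * (∑ x ∈ S, weight (1 / l) a (p x) (q x)) / 50 ≤ gap l (∑ x ∈ S, p x) (∑ x ∈ S, q x) := by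
  -- With P, Q, W the masses and the weight of a near cell, W · Q ≤ 4(P - Q)² suffices: the gap is
  -- then at least l(P - Q)²/(6Q) ≥ lW/24.
  have near : ∀ T : Finset (Fin k), (∀ x ∈ T, ¬ 2 * q x ≤ p x) →
      (∑ x ∈ T, weight (1 / l) a (p x) (q x)) * (∑ x ∈ T, q x) ≤
        4 * (∑ x ∈ T, p x - ∑ x ∈ T, q x) ^ 2 →
      l * (∑ x ∈ T, weight (1 / l) a (p x) (q x)) / 50 ≤
        gap l (∑ x ∈ T, p x) (∑ x ∈ T, q x) := by
    intro T hT hW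
    have hP : 0 ≤ ∑ x ∈ T, p x := Finset.sum_nonneg fun x _ => hp x
    have hPQ : ∑ x ∈ T, p x ≤ 2 * ∑ x ∈ T, q x := by
      rw [Finset.mul_sum]
      exact Finset.sum_le_sum fun x hx => (not_le.1 (hT x hx)).le
    refine le_trans ?_ (le_gap_of_le_two_mul hl0 (by linarith) hP hPQ)
    rw [mul_div_assoc]
    refine mul_le_mul_of_nonneg_left ?_ hl0.le
    rcases T.eq_empty_or_nonempty with rfl | hne
    · simp
    have hQ : 0 < ∑ x ∈ T, q x := Finset.sum_pos (fun x hx => by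
      have := hT x hx; have := hp x; linarith) hne
    rw [div_le_div_iff₀ (by norm_num) (by positivity)]
    nlinarith [sq_nonneg (∑ x ∈ T, p x - ∑ x ∈ T, q x)]
  have h0 : ∀ x, level k a (p x) (q x) x = if 2 * q x ≤ p x then dyadicCount (q x) (p x) (a + 4)
      else if dyadicCount |p x - q x| (q x) k < k then
        a + 5 + 2 * dyadicCount |p x - q x| (q x) k + (if q x < p x then 1 else 0)
      else a + 5 + 2 * k + x := fun _ => rfl
  have hc : ∀ x, dyadicCount (q x) (p x) (a + 4) ≤ a + 4 := fun x => dyadicCount_le _ _ _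
  rcases lt_or_ge n (a + 5) with hn | hn
  · have hfar : ∀ x ∈ S, 2 * q x ≤ p x ∧ dyadicCount (q x) (p x) (a + 4) = n := by
      intro x hx
      have h1 := hS x hx
      rw [h0] at h1
      split_ifs at h1 with h2
      · exact ⟨h2, h1⟩
      all_goals omega
    rcases S.eq_empty_or_nonempty with rfl | ⟨x0, hx0⟩
    · simp [gap]
      rw [Real.zero_rpow (by linarith)]; simp
    have hn1 : 1 ≤ n := by
      rw [← (hfar x0 hx0).2]
      exact one_le_dyadicCount (hfar x0 hx0).1
    have hw : ∑ x ∈ S, weight (1 / l) a (p x) (q x) = (∑ x ∈ S, p x) * min (1 / l) n := by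
      rw [Finset.sum_mul]
      refine Finset.sum_congr rfl fun x hx => ?_
      rw [weight, if_pos (hfar x hx).1, (hfar x hx).2]
    rw [hw]
    refine le_gap_of_pow_mul_le hl0 hl1 (Finset.sum_nonneg fun x _ => hq x) hn1 ?_
    rw [Finset.mul_sum]
    refine Finset.sum_le_sum fun x hx => ?_
    rw [← (hfar x hx).2]
    exact pow_dyadicCount_mul_le (by linarith [hq x, (hfar x hx).1])
  rcases lt_or_ge n (a + 5 + 2 * k) with hn2 | hn2
  · obtain ⟨i, hi⟩ : ∃ i, i = (n - (a + 5)) / 2 := ⟨_, rfl⟩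
    have hnear : ∀ x ∈ S, ¬ 2 * q x ≤ p x ∧ dyadicCount |p x - q x| (q x) k = i ∧ i < k ∧
        (q x < p x ↔ (n - (a + 5)) % 2 = 1) := by
      intro x hx
      have h1 := hS x hx
      rw [h0] at h1
      have := hc x
      split_ifs at h1 with h2 h3 h4
      · omega
      · exact ⟨h2, by omega, by omega, by simp only [h4, true_iff]; omega⟩
      · exact ⟨h2, by omega, by omega, by simp only [h4, false_iff]; omega⟩
      · omega
    refine near S (fun x hx => (hnear x hx).1) ?_
    -- All differences have the same sign, so the merged difference is the sum of the absolute ones.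
    have habs : (∑ x ∈ S, p x - ∑ x ∈ S, q x) ^ 2 = (∑ x ∈ S, |p x - q x|) ^ 2 := by
      rw [← Finset.sum_sub_distrib]
      by_cases hs : (n - (a + 5)) % 2 = 1
      · congr 1
        refine Finset.sum_congr rfl fun x hx => ?_
        rw [abs_of_pos]
        linarith [(hnear x hx).2.2.2.2 hs]
      · rw [← neg_sq, ← Finset.sum_neg_distrib]
        congr 1
        refine Finset.sum_congr rfl fun x hx => ?_
        rw [abs_of_nonpos]
        have := mt (hnear x hx).2.2.2.1 hs
        linarith
    have hQ : ∑ x ∈ S, q x ≤ 2 ^ (i + 1) * ∑ x ∈ S, |p x - q x| := by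
      rw [Finset.mul_sum]
      refine Finset.sum_le_sum fun x hx => ?_
      obtain ⟨-, h2, h3, -⟩ := hnear x hx
      rw [← h2]
      exact (lt_pow_dyadicCount_mul (by omega)).le
    have hW : ∑ x ∈ S, weight (1 / l) a (p x) (q x) ≤ (1 / 4) ^ i * ∑ x ∈ S, q x := by
      rw [Finset.mul_sum]
      refine Finset.sum_le_sum fun x hx => ?_
      obtain ⟨h1, h2, h3, -⟩ := hnear x hx
      have hq' : 0 < q x := by linarith [hp x]
      have h5 : 2 ^ i * |p x - q x| ≤ q x := by
        rw [← h2]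
        exact pow_dyadicCount_mul_le (abs_sub_le_of_not (hp x) h1)
      rw [weight, if_neg h1]
      exact sq_sub_div_le hq' h5
    have hQ0 : 0 ≤ ∑ x ∈ S, q x := Finset.sum_nonneg fun x _ => hq x
    rw [habs]
    calc _ ≤ (1 / 4) ^ i * (∑ x ∈ S, q x) * ∑ x ∈ S, q x := by gcongr
      _ = (1 / 4) ^ i * (∑ x ∈ S, q x) ^ 2 := by ring
      _ ≤ (1 / 4) ^ i * (2 ^ (i + 1) * ∑ x ∈ S, |p x - q x|) ^ 2 := by gcongr
      _ = ((1 / 4) ^ i * (4 ^ i)) * (4 * (∑ x ∈ S, |p x - q x|) ^ 2) := by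
          rw [show (4 : ℝ) ^ i = (2 ^ i) ^ 2 by rw [← pow_mul, mul_comm, pow_mul]; norm_num]
          ring
      _ = _ := by rw [← mul_pow]; norm_num
  · have hsingle : ∀ x ∈ S, ¬ 2 * q x ≤ p x ∧ n = a + 5 + 2 * k + x := by
      intro x hx
      have h1 := hS x hx
      rw [h0] at h1
      have := hc x
      split_ifs at h1 with h2 h3 h4
      · omega
      · omega
      · omega
      · exact ⟨h2, h1.symm⟩
    refine near S (fun x hx => (hsingle x hx).1) ?_
    rcases S.eq_empty_or_nonempty with rfl | ⟨x0, hx0⟩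
    · simp
    have hS0 : S = {x0} := by
      refine Finset.eq_singleton_iff_unique_mem.2 ⟨hx0, fun x hx => Fin.ext ?_⟩
      have := (hsingle x hx).2
      have := (hsingle x0 hx0).2
      omega
    have h1 := (hsingle x0 hx0).1
    have hq' : 0 < q x0 := by linarith [hp x0]
    rw [hS0]
    simp only [Finset.sum_singleton]
    rw [weight, if_neg h1, div_mul_cancel₀ _ hq'.ne']
    nlinarith [sq_nonneg (p x0 - q x0)]

/-! ### The quantizer that resolves the best block of levels. -/

/-- The mass function of the image under `f`. -/
def push {k D : ℕ} (f : Fin k → Fin D) (p : Fin k → ℝ) (c : Fin D) : ℝ := ∑ x with f x = c, p x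

theorem push_nonneg {k D : ℕ} (f : Fin k → Fin D) {p : Fin k → ℝ} (hp : ∀ x, 0 ≤ p x) (c : Fin D) :
    0 ≤ push f p c := Finset.sum_nonneg fun x _ => hp x

theorem sum_push {k D : ℕ} (f : Fin k → Fin D) (p : Fin k → ℝ) : ∑ c, push f p c = ∑ x, p x :=
  Finset.sum_fiberwise _ _ _

theorem sum_gap {ι : Type*} [Fintype ι] (l : ℝ) {p q : ι → ℝ} (hp : ∑ x, p x = 1)
    (hq : ∑ x, q x = 1) : ∑ x, gap l (p x) (q x) = 1 - ∑ x, p x ^ (1 - l) * q x ^ l := by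
  simp only [gap, Finset.sum_sub_distrib, Finset.sum_add_distrib, ← Finset.mul_sum, hp, hq]
  ring

/-- The total weight of the symbols whose level lies in block `B` of `D - 1` consecutive levels. -/
noncomputable def blockWeight {k : ℕ} (L : ℝ) (a D : ℕ) (p q : Fin k → ℝ) (B : ℕ) : ℝ :=
  ∑ x, if level k a (p x) (q x) x / (D - 1) = B then weight L a (p x) (q x) else 0

/-- The quantizer that resolves the levels of block `B` and merges everything else. -/
noncomputable def levelMap {k D : ℕ} (hD : 2 ≤ D) (a : ℕ) (p q : Fin k → ℝ) (B : ℕ) (x : Fin k) :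
    Fin D :=
  if level k a (p x) (q x) x / (D - 1) = B then
    ⟨level k a (p x) (q x) x % (D - 1), (Nat.mod_lt _ (by omega)).trans_le (Nat.sub_le _ _)⟩
  else ⟨D - 1, by omega⟩

/-- A letter below `D - 1` is the image of exactly one level, B(D-1) + c, so `level_cell` applies to
it. The letter `D - 1` collects everything outside the block and is only used through its gap being
nonnegative. -/
theorem blockWeight_le_sum_gap {k D a : ℕ} (hD : 2 ≤ D) {l : ℝ} (hl0 : 0 < l) (hl1 : l ≤ 1 / 4)
    {p q : Fin k → ℝ} (hp : ∀ x, 0 ≤ p x) (hq : ∀ x, 0 ≤ q x) (B : ℕ) :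
    l * blockWeight (1 / l) a D p q B / 50 ≤
      ∑ c, gap l (push (levelMap hD a p q B) p c) (push (levelMap hD a p q B) q c) := by
  rw [blockWeight, ← Finset.sum_fiberwise (s := Finset.univ) (g := levelMap hD a p q B),
    Finset.mul_sum, Finset.sum_div]
  refine Finset.sum_le_sum fun c _ => ?_
  rw [push, push]
  by_cases hc : (c : ℕ) = D - 1
  · rw [Finset.sum_eq_zero]
    · rw [mul_zero, zero_div]
      exact gap_nonneg hl0.le (by linarith) (push_nonneg _ hp c) (push_nonneg _ hq c)
    · intro x hx
      have h1 := congrArg Fin.val (Finset.mem_filter.1 hx).2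
      unfold levelMap at h1
      split_ifs at h1 ⊢ with h2
      · have h3 := Nat.mod_lt (level k a (p x) (q x) x) (by omega : D - 1 > 0)
        simp only [hc] at h1
        omega
      · rfl
  · have key : ∀ x ∈ Finset.univ.filter (fun x => levelMap hD a p q B x = c),
        level k a (p x) (q x) x / (D - 1) = B ∧ level k a (p x) (q x) x % (D - 1) = c := by
      intro x hx
      have h1 := congrArg Fin.val (Finset.mem_filter.1 hx).2
      unfold levelMap at h1
      split_ifs at h1 with h2
      · exact ⟨h2, h1⟩
      · exact absurd h1.symm hc
    rw [Finset.sum_congr rfl fun x hx => if_pos (key x hx).1]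
    refine level_cell hl0 hl1 hp hq (B * (D - 1) + c) _ fun x hx => ?_
    rw [← (key x hx).1, ← (key x hx).2, Nat.div_add_mod']

/-- Levels below a + 5 + 3M lie in the first (a + 5 + 3M)/(D-1) + 1 blocks, none heavier than `B`;
deeper symbols weigh at most 4^(-M) q each. -/
theorem sum_weight_le {k D a : ℕ} {L : ℝ} (hL : 0 ≤ L) {p q : Fin k → ℝ} (hp : ∀ x, 0 ≤ p x)
    (hq : ∀ x, 0 ≤ q x) (hq1 : ∑ x, q x = 1) {B : ℕ}
    (hB : ∀ B', blockWeight L a D p q B' ≤ blockWeight L a D p q B) (M : ℕ) :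
    ∑ x, weight L a (p x) (q x) ≤
      ((a + 5 + 3 * M) / (D - 1) + 1 : ℕ) * blockWeight L a D p q B + (1 / 4) ^ M := by
  have hw := fun x => weight_nonneg (a := a) hL (hp x) (hq x)
  set R := a + 5 + 3 * M
  have h1 : ∀ x, weight L a (p x) (q x) ≤
      (∑ B' ∈ Finset.range (R / (D - 1) + 1),
        if level k a (p x) (q x) x / (D - 1) = B' then weight L a (p x) (q x) else 0) +
        (1 / 4) ^ M * q x := by
    intro x
    rw [Finset.sum_ite_eq]
    rcases lt_or_ge (level k a (p x) (q x) x) R with h | h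
    · rw [if_pos (Finset.mem_range.2 (Nat.lt_succ_of_le (Nat.div_le_div_right h.le)))]
      exact le_add_of_nonneg_right (mul_nonneg (by positivity) (hq x))
    · refine (weight_le_of_le_level x.2 (hp x) h).trans (le_add_of_nonneg_left ?_)
      split_ifs
      exacts [hw x, le_rfl]
  refine (Finset.sum_le_sum fun x _ => h1 x).trans ?_
  rw [Finset.sum_add_distrib, ← Finset.mul_sum, hq1, mul_one, Finset.sum_comm]
  refine add_le_add ?_ le_rfl
  refine (Finset.sum_le_sum fun B' _ => hB B').trans ?_
  simp

/-- The quantizer given by the best block keeps a definite share of the affinity gap. -/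
theorem gap_le_levelMap {k D a : ℕ} (hD : 2 ≤ D) {l : ℝ} (hl0 : 0 < l) (hl1 : l ≤ 1 / 4)
    (hla : 1 / l ≤ a + 4) {p q : Fin k → ℝ} (hp : ∀ x, 0 ≤ p x) (hq : ∀ x, 0 ≤ q x)
    (hp1 : ∑ x, p x = 1) (hq1 : ∑ x, q x = 1) {B : ℕ}
    (hB : ∀ B', blockWeight (1 / l) a D p q B' ≤ blockWeight (1 / l) a D p q B) {M : ℕ}
    (hM : (1 / 4) ^ M ≤ 1 - ∑ x, p x ^ (1 - l) * q x ^ l) :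
    1 - ∑ x, p x ^ (1 - l) * q x ^ l ≤ 200 * ((a + 5 + 3 * M) / (D - 1) + 1 : ℕ) *
      (1 - ∑ c, push (levelMap hD a p q B) p c ^ (1 - l) *
        push (levelMap hD a p q B) q c ^ l) := by
  set N := (a + 5 + 3 * M) / (D - 1) + 1
  have h1 := blockWeight_le_sum_gap (a := a) hD hl0 hl1 hp hq B
  rw [sum_gap l (by rw [sum_push, hp1]) (by rw [sum_push, hq1])] at h1
  have h2 := sum_weight_le (by positivity : 0 ≤ 1 / l) hp hq hq1 hB M
  have h3 : 1 - ∑ x, p x ^ (1 - l) * q x ^ l ≤ 2 * l * ∑ x, weight (1 / l) a (p x) (q x) := by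
    rw [← sum_gap l hp1 hq1, Finset.mul_sum]
    exact Finset.sum_le_sum fun x _ => gap_le_weight hl0 hl1 hla (hp x) (hq x)
  have h4 := mul_le_mul_of_nonneg_left h2 hl0.le
  have h5 : 0 ≤ (N : ℝ) := by positivity
  have h6 := mul_le_mul_of_nonneg_left h1 h5
  have h7 : (0 : ℝ) < (1 / 4) ^ M := by positivity
  -- Altogether 1 - ρ ≤ 100 N (1 - ρ') + 2l · 4^(-M). As 2l ≤ 1/2, the tail is at most (1 - ρ)/2 and
  -- is absorbed, which turns 100 into 200.
  nlinarith

/-! ### The threshold quantizer for small affinity. -/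

/-- The mass under `p` outside of `{y | q y * p x ≤ p y * q x}`. -/
noncomputable def missFst {k : ℕ} (p q : Fin k → ℝ) (x : Fin k) : ℝ :=
  ∑ y, if q y * p x ≤ p y * q x then 0 else p y

/-- The mass under `q` of `{y | q y * p x ≤ p y * q x}`. -/
noncomputable def missSnd {k : ℕ} (p q : Fin k → ℝ) (x : Fin k) : ℝ :=
  ∑ y, if q y * p x ≤ p y * q x then q y else 0

theorem missFst_nonneg {k : ℕ} {p : Fin k → ℝ} (q : Fin k → ℝ) (hp : ∀ x, 0 ≤ p x) (x : Fin k) :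
    0 ≤ missFst p q x := Finset.sum_nonneg fun y _ => by split_ifs; exacts [le_rfl, hp y]

theorem missSnd_nonneg {k : ℕ} (p : Fin k → ℝ) {q : Fin k → ℝ} (hq : ∀ x, 0 ≤ q x) (x : Fin k) :
    0 ≤ missSnd p q x := Finset.sum_nonneg fun y _ => by split_ifs; exacts [hq y, le_rfl]

/-- Markov's inequality for the region q ≤ τp: the missed p-mass is at most τ^(-l) r and the q-mass
inside at most τ^(1-l) r. The choice of τ turns the latter into r^(1/(2l)) and the former into
r^(1/(2(1-l))). -/
theorem exists_threshold {k : ℕ} {l r : ℝ} (hl0 : 0 < l) (hl1 : l ≤ 1 / 4) (hr0 : 0 < r)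
    (hr1 : r < 1) {p q : Fin k → ℝ} (hp : ∀ x, 0 ≤ p x) (hq : ∀ x, 0 ≤ q x) (hp1 : ∑ x, p x = 1)
    (hr : ∑ x, p x ^ (1 - l) * q x ^ l ≤ r) :
    ∃ x, missFst p q x ≤ r ^ (1 / 2 : ℝ) ∧ missSnd p q x ≤ r ^ (1 / (2 * l)) := by
  have h1l : 0 < 1 - l := by linarith
  obtain ⟨τ, hτ⟩ : ∃ τ, τ = r ^ ((1 / 2 - l) / (l * (1 - l))) := ⟨_, rfl⟩
  have hτ0 : 0 < τ := by rw [hτ]; positivity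
  have hP : ∑ y, (if q y ≤ τ * p y then 0 else p y) ≤ r ^ (1 / 2 : ℝ) := by
    calc ∑ y, (if q y ≤ τ * p y then 0 else p y)
        ≤ ∑ y, τ ^ (-l) * (p y ^ (1 - l) * q y ^ l) := by
          refine Finset.sum_le_sum fun y _ => ?_
          have := hp y
          have := hq y
          split_ifs with h
          · positivity
          · have h2 : p y ≤ τ⁻¹ * q y := by
              rw [← div_eq_inv_mul, le_div_iff₀ hτ0]
              linarith
            calc p y = p y ^ (1 - l) * p y ^ l := by
                  rw [← Real.rpow_add_of_nonneg (hp y) h1l.le hl0.le]; simp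
              _ ≤ p y ^ (1 - l) * (τ⁻¹ * q y) ^ l := by gcongr
              _ = _ := by
                  rw [Real.mul_rpow (by positivity) (hq y), Real.inv_rpow hτ0.le,
                    Real.rpow_neg hτ0.le]
                  ring
      _ ≤ τ ^ (-l) * r := by rw [← Finset.mul_sum]; gcongr
      _ = r ^ (1 / 2 / (1 - l)) := by
          rw [hτ, ← Real.rpow_mul hr0.le]
          nth_rewrite 2 [← Real.rpow_one r]
          rw [← Real.rpow_add hr0]
          congr 1
          field_simp
          ring
      _ ≤ r ^ (1 / 2 : ℝ) := by
          refine Real.rpow_le_rpow_of_exponent_ge hr0 hr1.le ?_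
          rw [le_div_iff₀ h1l]
          linarith
  have hQ : ∑ y, (if q y ≤ τ * p y then q y else 0) ≤ r ^ (1 / (2 * l)) := by
    calc ∑ y, (if q y ≤ τ * p y then q y else 0)
        ≤ ∑ y, τ ^ (1 - l) * (p y ^ (1 - l) * q y ^ l) := by
          refine Finset.sum_le_sum fun y _ => ?_
          have := hp y
          have := hq y
          split_ifs with h
          · calc q y = q y ^ (1 - l) * q y ^ l := by
                  rw [← Real.rpow_add_of_nonneg (hq y) h1l.le hl0.le]; simp
              _ ≤ (τ * p y) ^ (1 - l) * q y ^ l := by gcongr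
              _ = _ := by rw [Real.mul_rpow hτ0.le (hp y)]; ring
          · positivity
      _ ≤ τ ^ (1 - l) * r := by rw [← Finset.mul_sum]; gcongr
      _ = r ^ (1 / (2 * l)) := by
          rw [hτ, ← Real.rpow_mul hr0.le]
          nth_rewrite 2 [← Real.rpow_one r]
          rw [← Real.rpow_add hr0]
          congr 1
          field_simp
          ring
  -- The same region is cut out by the ratio of an actual symbol: the one with the largest q/p ≤ τ
  -- among those with p > 0. If there were none, all p-mass would be missed, against r^(1/2) < 1.
  -- This leaves only `k` thresholds to search.
  obtain ⟨x, hx⟩ : ∃ x, ∀ y, q y * p x ≤ p y * q x ↔ q y ≤ τ * p y := by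
    let A := Finset.univ.filter fun y => q y ≤ τ * p y ∧ 0 < p y
    have hA : A.Nonempty := by
      by_contra hne
      rw [Finset.not_nonempty_iff_eq_empty] at hne
      have h1 : ∑ y, (if q y ≤ τ * p y then 0 else p y) = 1 := by
        rw [← hp1]
        refine Finset.sum_congr rfl fun y _ => ?_
        split_ifs with h
        · by_contra h0
          have hy : y ∈ A := Finset.mem_filter.2
            ⟨Finset.mem_univ _, h, lt_of_le_of_ne (hp y) h0⟩
          simp [hne] at hy
        · rfl
      have := Real.rpow_lt_one hr0.le hr1 (by norm_num : (0 : ℝ) < 1 / 2)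
      linarith
    obtain ⟨x, hxA, hmax⟩ := A.exists_max_image (fun y => q y / p y) hA
    obtain ⟨-, hx1, hx2⟩ := Finset.mem_filter.1 hxA
    refine ⟨x, fun y => ⟨fun h => ?_, fun h => ?_⟩⟩
    · have h3 := mul_le_mul_of_nonneg_left hx1 (hp y)
      have h4 : p x * q y ≤ p x * (τ * p y) := by linarith
      exact le_of_mul_le_mul_left h4 hx2
    · rcases (hp y).eq_or_lt with h0 | h0
      · rw [← h0] at h ⊢
        have : q y = 0 := le_antisymm (by linarith) (hq y)
        simp [this]
      · have := hmax y (Finset.mem_filter.2 ⟨Finset.mem_univ _, h, h0⟩)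
        rw [div_le_div_iff₀ h0 hx2] at this
        linarith
  refine ⟨x, ?_, ?_⟩
  · simpa only [missFst, hx] using hP
  · simpa only [missSnd, hx] using hQ

/-- Thresholding the likelihood ratio at symbol `x` works with about `m` samples. -/
def IsCert {k : ℕ} (a b : ℕ) (p q : Fin k → ℝ) (x : Fin k) (m : ℕ) : Prop :=
  missFst p q x ^ m ≤ (1 / 2) ^ (12 * b) ∧ missSnd p q x ^ m ≤ (1 / 2) ^ (12 * (4 * b + a))

/-- Apply `exists_threshold` with r = 2^(-24b/m): the m-th powers of the two bounds are 2^(-12b) and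
2^(-12b/l), and b/l = 4b + a is an integer. A certificate can thus be checked without real
exponents. -/
theorem exists_isCert {k a b m : ℕ} (hb : 1 ≤ b) (hl1 : order a b ≤ 1 / 4) (hm : 1 ≤ m)
    {p q : Fin k → ℝ} (hp : ∀ x, 0 ≤ p x) (hq : ∀ x, 0 ≤ q x) (hp1 : ∑ x, p x = 1)
    (hr : ∑ x, p x ^ (1 - order a b) * q x ^ order a b ≤ 2 ^ (-(24 * b / m : ℝ))) :
    ∃ x, IsCert a b p q x m := by
  have hb' : (1 : ℝ) ≤ b := by exact_mod_cast hb
  have hm' : (1 : ℝ) ≤ m := by exact_mod_cast hm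
  have hl0 : 0 < order a b := by unfold order; positivity
  obtain ⟨x, hx1, hx2⟩ := exists_threshold hl0 hl1 (by positivity)
    (Real.rpow_lt_one_of_one_lt_of_neg (by norm_num) (neg_neg_of_pos (by positivity))) hp hq hp1 hr
  refine ⟨x, (pow_le_pow_left₀ (missFst_nonneg q hp x) hx1 m).trans_eq ?_,
    (pow_le_pow_left₀ (missSnd_nonneg p hq x) hx2 m).trans_eq ?_⟩
  · rw [one_div_pow, ← Real.rpow_natCast, ← Real.rpow_natCast, ← Real.rpow_mul (by positivity),
      ← Real.rpow_mul (by positivity), one_div ((2 : ℝ) ^ _), ← Real.rpow_neg (by norm_num)]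
    congr 1
    push_cast
    field_simp
    ring
  · rw [one_div_pow, ← Real.rpow_natCast, ← Real.rpow_natCast, ← Real.rpow_mul (by positivity),
      ← Real.rpow_mul (by positivity), one_div ((2 : ℝ) ^ _), ← Real.rpow_neg (by norm_num)]
    congr 1
    unfold order
    push_cast
    field_simp
    ring

/-- The quantizer that thresholds the likelihood ratio at symbol `x`. -/
noncomputable def thresholdMap {k D : ℕ} (hD : 2 ≤ D) (p q : Fin k → ℝ) (x y : Fin k) : Fin D :=
  if q y * p x ≤ p y * q x then ⟨0, by omega⟩ else ⟨1, by omega⟩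

/-- Only the letters 0 and 1 have mass, and each contributes at most 2^(-9b/m). The factor 2 from
adding them is at most 2^(3b/m), because `m ≤ 3b`. -/
theorem affinity_thresholdMap_le {k D a b m : ℕ} (hD : 2 ≤ D) (hb : 1 ≤ b)
    (hl1 : order a b ≤ 1 / 4) (hm : 1 ≤ m) (hmb : m ≤ 3 * b) {p q : Fin k → ℝ}
    (hp : ∀ x, 0 ≤ p x) (hq : ∀ x, 0 ≤ q x) (hp1 : ∑ x, p x = 1) (hq1 : ∑ x, q x = 1) {x : Fin k}
    (hx : IsCert a b p q x m) :
    (∑ c, push (thresholdMap (D := D) hD p q x) p c ^ (1 - order a b) *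
      push (thresholdMap hD p q x) q c ^ order a b) ^ m ≤ 2 ^ (-(3 * b : ℝ)) := by
  have hb' : (1 : ℝ) ≤ b := by exact_mod_cast hb
  have hm' : (1 : ℝ) ≤ m := by exact_mod_cast hm
  have hmb' : (m : ℝ) ≤ 3 * b := by exact_mod_cast hmb
  have hl0 : 0 < order a b := by unfold order; positivity
  set l := order a b with hl
  set f : Fin k → Fin D := thresholdMap hD p q x with hf
  have push_le : ∀ {p : Fin k → ℝ}, (∀ x, 0 ≤ p x) → ∑ x, p x = 1 → ∀ c, push f p c ≤ 1 :=
    fun {p} hp hp1 c => hp1 ▸ sum_push f p ▸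
      Finset.single_le_sum (f := push f p) (fun c _ => push_nonneg f hp c) (Finset.mem_univ c)
  have e1 : missFst p q x ≤ 2 ^ (-(12 * b / m : ℝ)) := by
    refine le_of_pow_le_pow_left₀ (by omega : m ≠ 0) (by positivity) (hx.1.trans_eq ?_)
    rw [← Real.rpow_natCast _ m, ← Real.rpow_mul (by norm_num), one_div_pow,
      ← Real.rpow_natCast, one_div, ← Real.rpow_neg (by norm_num)]
    congr 1
    push_cast
    field_simp
  have e2 : missSnd p q x ≤ 2 ^ (-(12 * (4 * b + a) / m : ℝ)) := by
    refine le_of_pow_le_pow_left₀ (by omega : m ≠ 0) (by positivity) (hx.2.trans_eq ?_)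
    rw [← Real.rpow_natCast _ m, ← Real.rpow_mul (by norm_num), one_div_pow,
      ← Real.rpow_natCast, one_div, ← Real.rpow_neg (by norm_num)]
    congr 1
    push_cast
    field_simp
  have bm : 1 ≤ 3 * b / (m : ℝ) := by rw [le_div_iff₀ (by positivity)]; linarith
  have e3 : missFst p q x ^ (1 - l) ≤ 2 ^ (-(9 * b / m : ℝ)) := by
    have h1l : 0 ≤ 1 - l := by linarith
    refine (Real.rpow_le_rpow (missFst_nonneg q hp x) e1 h1l).trans ?_
    rw [← Real.rpow_mul (by norm_num)]
    refine Real.rpow_le_rpow_of_exponent_le (by norm_num) ?_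
    have : 0 ≤ (b / m : ℝ) := by positivity
    rw [mul_div_assoc, mul_div_assoc]
    nlinarith
  have e4 : missSnd p q x ^ l ≤ 2 ^ (-(9 * b / m : ℝ)) := by
    refine (Real.rpow_le_rpow (missSnd_nonneg p hq x) e2 hl0.le).trans ?_
    rw [← Real.rpow_mul (by norm_num)]
    refine Real.rpow_le_rpow_of_exponent_le (by norm_num) ?_
    have : -(12 * (4 * b + a) / m : ℝ) * l = -(12 * (b / m : ℝ)) := by
      rw [hl, order]; field_simp
    rw [this, mul_div_assoc]
    have : 0 ≤ (b / m : ℝ) := by positivity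
    linarith
  let c0 : Fin D := ⟨0, by omega⟩
  let c1 : Fin D := ⟨1, by omega⟩
  have hne : c1 ≠ c0 := fun h => by simpa [c0, c1] using congrArg Fin.val h
  have hQ0 : push f q c0 = missSnd p q x := by
    rw [push, missSnd, Finset.sum_filter]
    refine Finset.sum_congr rfl fun y _ => ?_
    simp only [hf, thresholdMap]
    by_cases h : q y * p x ≤ p y * q x
    · rw [if_pos h, if_pos rfl, if_pos h]
    · rw [if_neg h, if_neg hne, if_neg h]
  have hP1 : push f p c1 = missFst p q x := by
    rw [push, missFst, Finset.sum_filter]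
    refine Finset.sum_congr rfl fun y _ => ?_
    simp only [hf, thresholdMap]
    by_cases h : q y * p x ≤ p y * q x
    · rw [if_pos h, if_neg hne.symm, if_pos h]
    · rw [if_neg h, if_pos rfl, if_neg h]
  have hrest : ∀ c, c ≠ c0 → c ≠ c1 → push f p c = 0 := by
    intro c h0 h1
    rw [push, Finset.sum_eq_zero]
    intro y hy
    have := (Finset.mem_filter.1 hy).2
    simp only [hf, thresholdMap] at this
    split_ifs at this
    exacts [absurd this.symm h0, absurd this.symm h1]
  have hsum : ∑ c, push f p c ^ (1 - l) * push f q c ^ l ≤ 2 ^ (-(6 * b / m : ℝ)) := by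
    have h1l : 0 < 1 - l := by linarith
    calc ∑ c, push f p c ^ (1 - l) * push f q c ^ l
        = push f p c0 ^ (1 - l) * push f q c0 ^ l + push f p c1 ^ (1 - l) * push f q c1 ^ l := by
          refine Fintype.sum_eq_add c0 c1 hne.symm fun c hc => ?_
          rw [hrest c hc.1 hc.2, Real.zero_rpow h1l.ne', zero_mul]
      _ ≤ 1 * 2 ^ (-(9 * b / m : ℝ)) + 2 ^ (-(9 * b / m : ℝ)) * 1 := by
          have := push_nonneg f hp c0
          have := push_nonneg f hq c1
          rw [hQ0, hP1]
          gcongr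
          · exact Real.rpow_nonneg (missSnd_nonneg p hq x) _
          · exact Real.rpow_le_one (push_nonneg f hp c0) (push_le hp hp1 c0) h1l.le
          · exact Real.rpow_le_one (push_nonneg f hq c1) (push_le hq hq1 c1) hl0.le
      _ = 2 ^ (1 + -(9 * b / m : ℝ)) := by rw [Real.rpow_add (by norm_num), Real.rpow_one]; ring
      _ ≤ _ := by
          refine Real.rpow_le_rpow_of_exponent_le (by norm_num) ?_
          rw [mul_div_assoc] at bm ⊢
          rw [mul_div_assoc]
          linarith
  calc _ ≤ ((2 : ℝ) ^ (-(6 * b / m : ℝ))) ^ m := by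
        gcongr
        exact Finset.sum_nonneg fun c _ => mul_nonneg (Real.rpow_nonneg (push_nonneg f hp c) _)
          (Real.rpow_nonneg (push_nonneg f hq c) _)
    _ = 2 ^ (-(6 * b : ℝ)) := by
        rw [← Real.rpow_natCast, ← Real.rpow_mul (by norm_num)]
        congr 1
        field_simp
    _ ≤ _ := Real.rpow_le_rpow_of_exponent_le (by norm_num) (by linarith)

/-! ### Either quantizer has the required sample complexity. -/

/-- The quantizers that the algorithm may output: the best certified threshold, or the best block
of levels if there is no certified threshold. -/
def IsGoodMap {k D : ℕ} (hD : 2 ≤ D) (a b : ℕ) (p q : Fin k → ℝ) (f : Fin k → Fin D) : Prop :=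
  (∃ x m, 1 ≤ m ∧ m ≤ 3 * b ∧ IsCert a b p q x m ∧
    (∀ x' m', 1 ≤ m' → m' < m → ¬ IsCert a b p q x' m') ∧ f = thresholdMap hD p q x) ∨
  ((∀ x m, 1 ≤ m → m ≤ 3 * b → ¬ IsCert a b p q x m) ∧
    ∃ B, (∀ B', blockWeight (1 / order a b) a D p q B' ≤ blockWeight (1 / order a b) a D p q B) ∧
      f = levelMap hD a p q B)

theorem natCast_le_of_logCounts {α δ : ℝ} {a b : ℕ} (h : LogCounts α δ a b) (hα0 : 0 < α) :
    (a : ℝ) ≤ 1 + 3 / 2 * Real.log (1 / α) := by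
  have h1 := Real.log_lt_log (by positivity) h.lt_two
  rw [Real.log_mul (by positivity) hα0.ne', Real.log_pow] at h1
  rw [one_div, Real.log_inv]
  have h2 := Real.log_two_gt_d9
  have ha : (1 : ℝ) ≤ a := by exact_mod_cast h.one_le_a
  nlinarith

theorem block_count_le {D a b n M : ℕ} (hD : 2 ≤ D) {α δ : ℝ} (h : LogCounts α δ a b)
    (hα0 : 0 < α) (hα1 : α ≤ 1 / 2) (hn : 1 ≤ n) (hM : (M : ℝ) ≤ 13 + Real.log n) :
    (((a + 5 + 3 * M) / (D - 1) + 1 : ℕ) : ℝ) ≤ 173 * max 1 (Real.log (n / α) / D) := by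
  have hD' : (2 : ℝ) ≤ D := by exact_mod_cast hD
  have hn' : (1 : ℝ) ≤ n := by exact_mod_cast hn
  have ha := natCast_le_of_logCounts h hα0
  have hlog : Real.log (n / α) = Real.log n + Real.log (1 / α) := by
    rw [← Real.log_mul (by positivity) (by positivity), mul_one_div]
  have hlogn : 0 ≤ Real.log n := Real.log_nonneg hn'
  have hlogα : 69 / 100 ≤ Real.log (1 / α) := by
    have h1 : Real.log 2 ≤ Real.log (1 / α) :=
      Real.log_le_log (by norm_num) (by rw [le_div_iff₀ hα0]; linarith)
    have := Real.log_two_gt_d9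
    linarith
  have h1 : (((a + 5 + 3 * M) / (D - 1) + 1 : ℕ) : ℝ) ≤ (a + 5 + 3 * M) / (D - 1) + 1 := by
    have := Nat.cast_div_le (α := ℝ) (m := a + 5 + 3 * M) (n := D - 1)
    rw [Nat.cast_sub (by omega)] at this
    push_cast at this ⊢
    linarith
  have h2 : ((a : ℝ) + 5 + 3 * M) / (D - 1) ≤ 172 * (Real.log (n / α) / D) := by
    rw [mul_div_assoc', div_le_div_iff₀ (by linarith) (by linarith), hlog]
    -- The left side is at most 45 + (3/2) log(1/α) + 3 log n, and log(1/α) ≥ 69/100 absorbs the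
    -- constant. Replacing D - 1 by D/2 then doubles 86 to 172.
    have h3 : (a : ℝ) + 5 + 3 * M ≤ 86 * (Real.log n + Real.log (1 / α)) := by linarith
    have h4 : (0 : ℝ) ≤ 86 * (Real.log n + Real.log (1 / α)) := by linarith
    nlinarith
  have := le_max_right 1 (Real.log (n / α) / D)
  have := le_max_left 1 (Real.log (n / α) / D)
  linarith

theorem exists_pow_affinity_le_of_isGoodMap {k D a b n : ℕ} (hD : 2 ≤ D) {α δ : ℝ}
    (h : LogCounts α δ a b) (hα0 : 0 < α) (hα1 : α ≤ 1 / 2) {p q : Fin k → ℝ}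
    (hp : ∀ x, 0 ≤ p x) (hq : ∀ x, 0 ≤ q x) (hp1 : ∑ x, p x = 1) (hq1 : ∑ x, q x = 1)
    (hn : 1 ≤ n) {f : Fin k → Fin D} (hf : IsGoodMap hD a b p q f)
    (hρ : (∑ x, p x ^ (1 - order a b) * q x ^ order a b) ^ n ≤ 2 ^ (-(b / 16000 : ℝ))) :
    ∃ N : ℕ, (∑ c, push f p c ^ (1 - order a b) * push f q c ^ order a b) ^ N ≤
        2 ^ (-(3 * b : ℝ)) ∧
      (N : ℝ) ≤ 173 * 600 * 2 ^ 23 * n * max 1 (Real.log (n / α) / D) := by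
  have hl0 := order_pos h
  have hl1 := order_le h
  have hb2 : (2 : ℝ) ≤ b := by exact_mod_cast h.two_le_b
  have hn' : (1 : ℝ) ≤ n := by exact_mod_cast hn
  have hD' : (2 : ℝ) ≤ D := by exact_mod_cast hD
  set l := order a b with hl
  set ρ := ∑ x, p x ^ (1 - l) * q x ^ l with hρdef
  have hρ0 : 0 ≤ ρ := Finset.sum_nonneg fun x _ => mul_nonneg (Real.rpow_nonneg (hp x) _)
    (Real.rpow_nonneg (hq x) _)
  -- Here 24/384000 = 1/16000, so a certificate exists at m = 384000 n and the minimal one is no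
  -- larger.
  have hρn : ρ ≤ 2 ^ (-(24 * b / (384000 * n : ℕ) : ℝ)) := by
    refine le_of_pow_le_pow_left₀ (by omega : n ≠ 0) (by positivity) (hρ.trans_eq ?_)
    rw [← Real.rpow_natCast, ← Real.rpow_mul (by norm_num)]
    congr 1
    push_cast
    field_simp
    norm_num
  have hmax : (1 : ℝ) ≤ max 1 (Real.log (n / α) / D) := le_max_left _ _
  rcases hf with ⟨x, m, hm1, hmb, hx, hmin, rfl⟩ | ⟨hno, B, hB, rfl⟩
  · refine ⟨m, affinity_thresholdMap_le hD (by linarith [h.two_le_b]) hl1 hm1 hmb hp hq hp1 hq1 hx,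
      ?_⟩
    have hm : m ≤ 384000 * n := by
      by_contra! hlt
      obtain ⟨x', hx'⟩ := exists_isCert (by linarith [h.two_le_b]) hl1 (by omega) hp hq hp1 hρn
      exact hmin x' _ (by omega) hlt hx'
    have hm' : (m : ℝ) ≤ 384000 * n := by exact_mod_cast hm
    calc (m : ℝ) ≤ 384000 * n * 1 := by linarith
      _ ≤ 173 * 600 * 2 ^ 23 * n * max 1 (Real.log (n / α) / D) := by gcongr; norm_num
  -- Without a certificate at m = 3b, ρ must exceed 2^(-24b/(3b)) = 2^(-8).
  have hρ256 : 1 / 256 ≤ ρ := by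
    by_contra! hlt
    have hb1 := h.two_le_b
    obtain ⟨x, hx⟩ := exists_isCert (m := 3 * b) (a := a) (b := b) (by omega) hl1 (by omega) hp hq hp1
      (hlt.le.trans_eq (by
        rw [show -(24 * b / (3 * b : ℕ) : ℝ) = -(8 : ℕ) by push_cast; field_simp; norm_num,
          Real.rpow_neg (by norm_num), Real.rpow_natCast]
        norm_num))
    exact hno x _ (by omega) le_rfl hx
  -- Since ρ ≥ 1/256, log(1/ρ) ≤ 1/ρ - 1 ≤ 256(1 - ρ); and 2^23 exceeds 256 · 16000 / log 2.
  have hgap : (b : ℝ) / 2 ^ 23 ≤ n * (1 - ρ) := by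
    have hρpos : 0 < ρ := by linarith
    have h1 := Real.log_le_log (by positivity) hρ
    rw [Real.log_pow, Real.log_rpow (by norm_num)] at h1
    have h2 := Real.one_sub_inv_le_log_of_pos hρpos
    have h3 : -(256 * (1 - ρ)) ≤ 1 - ρ⁻¹ := by
      have h4 : ρ⁻¹ ≤ 256 := by rw [inv_le_comm₀ hρpos (by norm_num)]; linarith
      have h5 : ρ * ρ⁻¹ = 1 := mul_inv_cancel₀ hρpos.ne'
      rcases le_or_gt ρ 1 with h6 | h6
      · nlinarith
      · exfalso
        have := Real.log_pos h6
        have := Real.log_two_gt_d9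
        nlinarith
    have h6 := Real.log_two_gt_d9
    have h7 : (n : ℝ) * -(256 * (1 - ρ)) ≤ -(b / 16000) * Real.log 2 :=
      le_trans (mul_le_mul_of_nonneg_left (h3.trans h2) (by positivity)) h1
    nlinarith
  -- The least M with 4^(-M) ≤ 1/(2^23 n), which is at most 1 - ρ by `hgap`; minimality keeps M of
  -- order log n.
  set M := Nat.clog 4 (2 ^ 23 * n) with hM
  have hM1 : ((2 ^ 23 * n : ℕ) : ℝ) ≤ 4 ^ M := by
    exact_mod_cast Nat.le_pow_clog (by norm_num) (2 ^ 23 * n)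
  have hMgap : (1 / 4 : ℝ) ^ M ≤ 1 - ρ := by
    rw [one_div_pow, div_le_iff₀ (by positivity)]
    push_cast at hM1
    have h1 : 0 ≤ 1 - ρ := by
      by_contra! h1
      have : 0 < (b : ℝ) / 2 ^ 23 := by positivity
      nlinarith
    have h2 := mul_le_mul_of_nonneg_left hM1 h1
    rw [div_le_iff₀ (by norm_num)] at hgap
    nlinarith
  have hM2 : (M : ℝ) ≤ 13 + Real.log n := by
    have h1 : 4 ^ (M - 1) < 2 ^ 23 * n := Nat.pow_pred_clog_lt_self (by norm_num) (by omega)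
    have h2 : 4 ^ M ≤ 4 * (2 ^ 23 * n) := by
      rcases Nat.eq_zero_or_pos M with h0 | h0
      · rw [h0]; omega
      · calc 4 ^ M = 4 * 4 ^ (M - 1) := by rw [← pow_succ']; congr 1; omega
          _ ≤ _ := by omega
    have h3 : (4 : ℝ) ^ M ≤ 4 * (2 ^ 23 * n) := by exact_mod_cast h2
    have h4 := Real.log_le_log (by positivity) h3
    rw [← mul_assoc, show (4 : ℝ) * 2 ^ 23 = 2 ^ 25 by norm_num,
      show (4 : ℝ) ^ M = 2 ^ (2 * M) by rw [pow_mul]; norm_num,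
      Real.log_mul (by positivity) (by positivity), Real.log_pow, Real.log_pow] at h4
    push_cast at h4
    have h5 := Real.log_two_gt_d9
    have h6 : 0 ≤ Real.log n := Real.log_nonneg hn'
    nlinarith
  have hla : 1 / l ≤ a + 4 := by
    rw [hl, order, one_div_div, div_le_iff₀ (by positivity)]
    nlinarith [(Nat.cast_nonneg a : (0 : ℝ) ≤ a)]
  have key := gap_le_levelMap hD hl0 hl1 hla hp hq hp1 hq1 hB hMgap
  set Nb := (a + 5 + 3 * M) / (D - 1) + 1 with hNb
  set ρ' := ∑ c, push (levelMap hD a p q B) p c ^ (1 - l) * push (levelMap hD a p q B) q c ^ l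
  have hρ'0 : 0 ≤ ρ' := Finset.sum_nonneg fun c _ =>
    mul_nonneg (Real.rpow_nonneg (push_nonneg _ hp c) _) (Real.rpow_nonneg (push_nonneg _ hq c) _)
  -- 600 = 3 · 200: the factor 200 · Nb pays for the quantizer and 2^23 for `hgap`, which leaves N(1
  -- - ρ') ≥ 3b.
  refine ⟨600 * 2 ^ 23 * n * Nb, ?_, ?_⟩
  · have h1 : ρ' ≤ Real.exp (-(1 - ρ')) := by
      have := Real.add_one_le_exp (-(1 - ρ'))
      linarith
    calc ρ' ^ (600 * 2 ^ 23 * n * Nb) ≤ Real.exp (-(1 - ρ')) ^ (600 * 2 ^ 23 * n * Nb) := by gcongr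
      _ = Real.exp (-(((600 * 2 ^ 23 * n * Nb : ℕ) : ℝ) * (1 - ρ'))) := by
          rw [← Real.exp_nat_mul]; ring_nf
      _ ≤ Real.exp (Real.log 2 * -(3 * b : ℝ)) := by
          refine Real.exp_le_exp.2 ?_
          have h2 : (3 * b : ℝ) ≤ ((600 * 2 ^ 23 * n * Nb : ℕ) : ℝ) * (1 - ρ') := by
            have h3 := mul_le_mul_of_nonneg_left key (by positivity : (0 : ℝ) ≤ n)
            rw [div_le_iff₀ (by norm_num)] at hgap
            push_cast
            nlinarith
          have := Real.log_two_lt_d9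
          nlinarith
      _ = _ := by rw [Real.rpow_def_of_pos (by norm_num)]
  · have hNb' : (Nb : ℝ) ≤ 173 * max 1 (Real.log (n / α) / D) := block_count_le hD h hα0 hα1 hn hM2
    have := mul_le_mul_of_nonneg_left hNb' (by positivity : (0 : ℝ) ≤ 600 * 2 ^ 23 * n)
    push_cast
    linarith

/-! ### From mass functions to sample complexities, and reduction to finite alphabets. -/

theorem affinity_eq_ofReal {Y : Type*} [Fintype Y] {l : ℝ} (hl0 : 0 ≤ l) (hl1 : l ≤ 1)
    (p q : PMF Y) :
    affinity l p q = ENNReal.ofReal (∑ y, (p y).toReal ^ (1 - l) * (q y).toReal ^ l) := by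
  rw [affinity, tsum_fintype, ENNReal.ofReal_sum_of_nonneg fun y _ => by positivity]
  refine Finset.sum_congr rfl fun y _ => ?_
  rw [ENNReal.ofReal_mul (by positivity),
    ← ENNReal.ofReal_rpow_of_nonneg ENNReal.toReal_nonneg (sub_nonneg.2 hl1),
    ← ENNReal.ofReal_rpow_of_nonneg ENNReal.toReal_nonneg hl0, ENNReal.ofReal_toReal (p.apply_ne_top y),
    ENNReal.ofReal_toReal (q.apply_ne_top y)]

theorem toReal_map_apply {k D : ℕ} (p : PMF (Fin k)) (f : Fin k → Fin D) (c : Fin D) :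
    ((p.map f) c).toReal = push f (fun x => (p x).toReal) c := by
  rw [PMF.map_apply, tsum_fintype, ENNReal.toReal_sum, push, Finset.sum_filter]
  · refine Finset.sum_congr rfl fun x _ => ?_
    by_cases h : f x = c
    · rw [if_pos h, if_pos h.symm]
    · rw [if_neg h, if_neg (Ne.symm h), ENNReal.toReal_zero]
  · intro x _
    split_ifs
    exacts [p.apply_ne_top x, ENNReal.zero_ne_top]

theorem sum_toReal {k : ℕ} (p : PMF (Fin k)) : ∑ x, (p x).toReal = 1 := by
  rw [← ENNReal.toReal_sum fun x _ => p.apply_ne_top x, ← tsum_fintype (L := .unconditional _), p.tsum_coe,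
    ENNReal.toReal_one]

theorem exists_solves_map_of_isGoodMap {k D a b n : ℕ} (hD : 2 ≤ D) {α δ : ℝ}
    (h : LogCounts α δ a b) (hα0 : 0 < α) (hα1 : α ≤ 1 / 2) (hδ0 : 0 < δ) {p q : PMF (Fin k)}
    (hn : 1 ≤ n) {f : Fin k → Fin D}
    (hf : IsGoodMap hD a b (fun x => (p x).toReal) (fun x => (q x).toReal) f)
    (hρ : affinity (order a b) p q ^ n ≤ ENNReal.ofReal (2 ^ (-(b / 16000 : ℝ)))) :
    ∃ (N : ℕ) (φ : Test (Fin D)), Solves (p.map f) (q.map f) α δ N φ ∧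
      (N : ℝ) ≤ 173 * 600 * 2 ^ 23 * n * max 1 (Real.log (n / α) / D) := by
  have hl0 := order_pos h
  have hl1 := order_le h
  have nn : ∀ {ι : Type} [Fintype ι] (p q : ι → ℝ), (∀ x, 0 ≤ p x) → (∀ x, 0 ≤ q x) →
      0 ≤ ∑ x, p x ^ (1 - order a b) * q x ^ order a b := fun p q hp hq =>
    Finset.sum_nonneg fun x _ => mul_nonneg (Real.rpow_nonneg (hp x) _)
      (Real.rpow_nonneg (hq x) _)
  rw [affinity_eq_ofReal hl0.le (by linarith), ← ENNReal.ofReal_pow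
    (nn _ _ (fun _ => ENNReal.toReal_nonneg) fun _ => ENNReal.toReal_nonneg),
    ENNReal.ofReal_le_ofReal_iff (by positivity)] at hρ
  obtain ⟨N, hN, hle⟩ := exists_pow_affinity_le_of_isGoodMap hD h hα0 hα1
    (fun _ => ENNReal.toReal_nonneg) (fun _ => ENNReal.toReal_nonneg) (sum_toReal p) (sum_toReal q)
    hn hf hρ
  obtain ⟨φ, hφ⟩ := exists_solves_of_affinity_pow_le (p := p.map f) (q := q.map f) (n := N) h hα0
    hδ0 (by
      rw [affinity_eq_ofReal hl0.le (by linarith), ← ENNReal.ofReal_pow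
        (nn _ _ (fun _ => ENNReal.toReal_nonneg) fun _ => ENNReal.toReal_nonneg)]
      refine ENNReal.ofReal_le_ofReal ?_
      simpa only [toReal_map_apply] using hN)
  exact ⟨N, φ, hφ, hle⟩

/-- Merging all but finitely many symbols changes the affinity by an arbitrarily small amount. -/
theorem exists_map_affinity_le {X : Type*} {l : ℝ} (hl0 : 0 ≤ l) (hl1 : l < 1) (p q : PMF X)
    {t : ℝ≥0∞} (ht : affinity l p q < t) :
    ∃ (k : ℕ) (g : X → Fin k), affinity l (p.map g) (q.map g) ≤ t := by
  classical
  have h1l : 0 < 1 - l := by linarith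
  -- If the merged symbol has p-mass at most ε and q-mass at most 1, it adds at most ε^(1-l), which
  -- is exactly the available slack.
  obtain ⟨ε, hε⟩ : ∃ ε, ε = (t - affinity l p q) ^ (1 - l)⁻¹ := ⟨_, rfl⟩
  have hε0 : 0 < ε := by
    rw [hε]
    exact ENNReal.rpow_pos_of_nonneg (tsub_pos_of_lt ht) (by positivity)
  have hp := ENNReal.tendsto_tsum_compl_atTop_zero (f := p) (by simp [p.tsum_coe])
  obtain ⟨F, hF⟩ := (hp.eventually (gt_mem_nhds hε0)).exists
  let g : X → Fin (F.card + 1) := fun x =>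
    if hx : x ∈ F then (F.equivFin ⟨x, hx⟩).castSucc else Fin.last _
  have hsymm : ∀ (r : PMF X) (i : Fin F.card), (r.map g) i.castSucc = r (F.equivFin.symm i) := by
    intro r i
    rw [PMF.map_apply, tsum_eq_single (F.equivFin.symm i : X)]
    · simp [g]
    · intro x hx
      refine if_neg fun heq => hx ?_
      by_cases hxF : x ∈ F
      · simp only [g, hxF, dif_pos] at heq
        rw [Fin.castSucc_injective _ heq]
        simp
      · simp only [g, hxF, dif_neg, not_false_iff] at heq
        exact absurd heq i.castSucc_lt_last.ne
  have hlast : (p.map g) (Fin.last _) ≤ ε := by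
    refine le_trans (le_of_eq ?_) hF.le
    have : (∑' x : { x // x ∉ F }, p x) = ∑' x, ({x | x ∉ F} : Set X).indicator p x :=
      tsum_subtype ({x | x ∉ F} : Set X) p
    rw [this, PMF.map_apply]
    refine tsum_congr fun x => ?_
    by_cases hxF : x ∈ F
    · simp only [g, hxF, dif_pos, Set.indicator, Set.mem_ofPred_eq, not_true, if_false]
      exact if_neg (Fin.castSucc_lt_last _).ne'
    · simp [g, hxF]
  refine ⟨_, g, ?_⟩
  rw [affinity, tsum_fintype, Fin.sum_univ_castSucc]
  simp only [hsymm]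
  calc _ ≤ affinity l p q + ε ^ (1 - l) * 1 ^ l := by
        refine add_le_add ?_ ?_
        · rw [affinity, ← tsum_fintype (L := .unconditional _)]
          exact ENNReal.tsum_comp_le_tsum_of_injective
            (Subtype.val_injective.comp F.equivFin.symm.injective)
            fun x => p x ^ (1 - l) * q x ^ l
        · gcongr
          exact PMF.coe_le_one _ _
    _ = affinity l p q + (t - affinity l p q) := by
        rw [hε, ← ENNReal.rpow_mul, inv_mul_cancel₀ h1l.ne']
        simp
    _ = t := add_tsub_cancel_of_le ht.le

theorem exists_logCounts {α δ : ℝ} (hα0 : 0 < α) (hα1 : α ≤ 1 / 2) (hδ0 : 0 < δ)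
    (hδ : δ < α / 4) : ∃ a b, LogCounts α δ a b := by
  classical
  have hex : ∃ a : ℕ, 1 ≤ 2 ^ a * α := by
    obtain ⟨a, ha⟩ := pow_unbounded_of_one_lt (1 / α) (one_lt_two (α := ℝ))
    exact ⟨a, by rw [div_lt_iff₀ hα0] at ha; exact ha.le⟩
  have h1 : 1 ≤ Nat.find hex := by
    by_contra! h
    have := Nat.find_spec hex
    rw [Nat.lt_one_iff.1 h] at this
    linarith
  have h2 : 2 ^ (Nat.find hex - 1) * α < 1 := not_le.1 (Nat.find_min hex (by omega))
  obtain ⟨b, hb1, hb2⟩ := exists_nat_pow_near (x := α / δ) (y := 2)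
    (by rw [le_div_iff₀ hδ0]; linarith) (by norm_num)
  rw [le_div_iff₀ hδ0] at hb1
  rw [div_lt_iff₀ hδ0] at hb2
  refine ⟨Nat.find hex, b, h1, ?_, Nat.find_spec hex, ?_, hb1, hb2⟩
  · by_contra! h
    have : (2 : ℝ) ^ (b + 1) ≤ 2 ^ 2 := pow_le_pow_right₀ (by norm_num) (by omega)
    nlinarith
  · obtain ⟨c, hc⟩ := Nat.exists_eq_add_of_le' h1
    rw [hc, Nat.add_sub_cancel] at h2
    rw [hc, pow_succ]
    linarith

/-- The constant of the bounds. -/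
noncomputable def commConst : ℝ≥0 := 173 * 600 * 2 ^ 23

theorem one_le_commConst : 1 ≤ commConst := by
  unfold commConst
  norm_num

theorem natCast_le_commBound {n N D : ℕ} {α : ℝ}
    (h : (N : ℝ) ≤ 173 * 600 * 2 ^ 23 * n * max 1 (Real.log (n / α) / D)) :
    (((N : ℕ∞) : ℝ≥0∞)) ≤ commConst * commBound n α D := by
  have e : (commConst : ℝ≥0∞) * commBound n α D =
      ENNReal.ofReal (173 * 600 * 2 ^ 23 * n * max 1 (Real.log (n / α) / D)) := by
    have hc : (commConst : ℝ≥0∞) = ENNReal.ofReal (173 * 600 * 2 ^ 23) := by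
      rw [ENNReal.ofReal, commConst]
      congr 1
      refine NNReal.eq ?_
      rw [Real.coe_toNNReal _ (by norm_num)]
      push_cast
      rfl
    rw [commBound, hc, mul_assoc (173 * 600 * 2 ^ 23 : ℝ), ENNReal.ofReal_mul (p := 173 * 600 * 2 ^ 23) (by norm_num),
      ENNReal.ofReal_mul (p := (n : ℝ)) (by positivity), ENNReal.ofReal_max, ENNReal.ofReal_one,
      ENNReal.ofReal_natCast]
    simp
  rw [e, ENat.toENNReal_coe, ← ENNReal.ofReal_natCast]
  exact ENNReal.ofReal_le_ofReal h

theorem exists_solves_of_sampleComplexity_ne_top {X : Type*} {p q : PMF X} {α δ : ℝ}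
    (h : sampleComplexity p q α δ ≠ ⊤) :
    ∃ n : ℕ, sampleComplexity p q α δ = n ∧ ∃ φ : Test X, Solves p q α δ n φ := by
  have hne : {m : ℕ∞ | ∃ n : ℕ, m = n ∧ ∃ φ : Test X, Solves p q α δ n φ}.Nonempty := by
    by_contra hne
    rw [Set.not_nonempty_iff_eq_empty] at hne
    exact h (by rw [sampleComplexity, hne, sInf_empty])
  obtain ⟨n, hn, hφ⟩ := csInf_mem hne
  exact ⟨n, hn, hφ⟩

theorem commBound_top (α : ℝ) (D : ℕ) : (commConst : ℝ≥0∞) * commBound ⊤ α D = ⊤ := by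
  have h1 : (commConst : ℝ≥0∞) ≠ 0 := by
    have := one_le_commConst
    simpa using (zero_lt_one.trans_le this).ne'
  have h2 : commBound ⊤ α D = ⊤ := by
    rw [commBound, ENat.toENNReal_top, ENNReal.top_mul]
    exact (zero_lt_one.trans_le (le_max_left _ _)).ne'
  rw [h2, ENNReal.mul_top h1]

theorem one_le_of_solves {X : Type*} {α δ : ℝ} {a b : ℕ} (h : LogCounts α δ a b)
    (hα0 : 0 < α) (hα1 : α ≤ 1 / 2) (hδ0 : 0 < δ) {p q : PMF X} {n : ℕ} {φ : Test X}
    (hφ : Solves p q α δ n φ) : 1 ≤ n := by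
  by_contra! hn
  have h1 := affinity_pow_le_of_solves h hα0 hα1 hδ0 hφ
  have hb2 : (2 : ℝ) ≤ b := by exact_mod_cast h.two_le_b
  rw [Nat.lt_one_iff.1 hn, pow_zero, ENNReal.one_le_ofReal] at h1
  have := Real.rpow_lt_one_of_one_lt_of_neg (x := 2) (z := -(b / 8000 : ℝ)) (by norm_num)
    (neg_neg_of_pos (by positivity))
  linarith

/-- The strictness leaves room for the perturbation of the affinity when an infinite alphabet is
truncated. -/
theorem two_rpow_lt {α δ : ℝ} {a b : ℕ} (h : LogCounts α δ a b) :
    (2 : ℝ) ^ (-(b / 8000 : ℝ)) < 2 ^ (-(b / 16000 : ℝ)) := by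
  have hb2 : (2 : ℝ) ≤ b := by exact_mod_cast h.two_le_b
  exact Real.rpow_lt_rpow_of_exponent_lt (by norm_num) (by linarith)

theorem constrainedSampleComplexity_le_of_solves {X : Type*} {D N : ℕ} {p q : PMF X} {α δ : ℝ}
    {f : X → Fin D} {φ : Test (Fin D)} (hφ : Solves (p.map f) (q.map f) α δ N φ)
    {𝒞 : Set (X → PMF (Fin D))} (hf : detChannel f ∈ 𝒞) :
    constrainedSampleComplexity p q α δ 𝒞 ≤ N :=
  sInf_le ⟨N, rfl, φ, detChannel f, hf, (solvesVia_iff p q α δ N φ _).2 hφ⟩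

/-- The sample complexity of a good quantizer on a finite alphabet. -/
theorem constrainedSampleComplexity_le_of_isGoodMap {k D a b : ℕ} (hD : 2 ≤ D) {α δ : ℝ}
    (h : LogCounts α δ a b) (hα0 : 0 < α) (hα1 : α ≤ 1 / 2) (hδ0 : 0 < δ) (p q : PMF (Fin k))
    {f : Fin k → Fin D}
    (hf : IsGoodMap hD a b (fun x => (p x).toReal) (fun x => (q x).toReal) f) :
    (constrainedSampleComplexity p q α δ {detChannel f} : ℝ≥0∞) ≤
      commConst * commBound (sampleComplexity p q α δ) α D := by
  by_cases htop : sampleComplexity p q α δ = ⊤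
  · rw [htop, commBound_top]; exact le_top
  obtain ⟨n, hn, φ, hφ⟩ := exists_solves_of_sampleComplexity_ne_top htop
  obtain ⟨N, ψ, hψ, hN⟩ := exists_solves_map_of_isGoodMap hD h hα0 hα1 hδ0
    (one_le_of_solves h hα0 hα1 hδ0 hφ) hf ((affinity_pow_le_of_solves h hα0 hα1 hδ0 hφ).trans
      (ENNReal.ofReal_le_ofReal (two_rpow_lt h).le))
  rw [hn]
  refine le_trans ?_ (natCast_le_commBound hN)
  exact ENat.toENNReal_le.2 (constrainedSampleComplexity_le_of_solves hψ rfl)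

/-- The statistical cost of communication, on an arbitrary alphabet. -/
theorem commSampleComplexity_le {X : Type*} {D a b : ℕ} (hD : 2 ≤ D) {α δ : ℝ}
    (h : LogCounts α δ a b) (hα0 : 0 < α) (hα1 : α ≤ 1 / 2) (hδ0 : 0 < δ) (p q : PMF X)
    (hgood : ∀ (k : ℕ) (p q : PMF (Fin k)), ∃ f : Fin k → Fin D,
      IsGoodMap hD a b (fun x => (p x).toReal) (fun x => (q x).toReal) f) :
    (commSampleComplexity p q α δ D : ℝ≥0∞) ≤
      commConst * commBound (sampleComplexity p q α δ) α D := by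
  by_cases htop : sampleComplexity p q α δ = ⊤
  · rw [htop, commBound_top]; exact le_top
  obtain ⟨n, hn, φ, hφ⟩ := exists_solves_of_sampleComplexity_ne_top htop
  have hn1 := one_le_of_solves h hα0 hα1 hδ0 hφ
  have hn0 : n ≠ 0 := by omega
  have hn' : (n : ℝ) ≠ 0 := by exact_mod_cast hn0
  have hpow : ENNReal.ofReal (2 ^ (-(b / 16000 / n : ℝ))) ^ n =
      ENNReal.ofReal (2 ^ (-(b / 16000 : ℝ))) := by
    rw [← ENNReal.ofReal_pow (by positivity), ← Real.rpow_natCast, ← Real.rpow_mul (by norm_num)]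
    congr 2
    field_simp
  have hlt : affinity (order a b) p q < ENNReal.ofReal (2 ^ (-(b / 16000 / n : ℝ))) := by
    by_contra! hge
    refine absurd (pow_le_pow_left' hge n) (not_le.2 ?_)
    rw [hpow]
    refine (affinity_pow_le_of_solves h hα0 hα1 hδ0 hφ).trans_lt ?_
    exact (ENNReal.ofReal_lt_ofReal_iff (by positivity)).2 (two_rpow_lt h)
  have hl1 := order_le h
  obtain ⟨k, g, hg⟩ := exists_map_affinity_le (order_pos h).le (by linarith) p q hlt
  -- The quantizer is chosen for the truncated laws, and its composition with the truncation is a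
  -- quantizer of the original alphabet.
  obtain ⟨f, hf⟩ := hgood k (p.map g) (q.map g)
  obtain ⟨N, ψ, hψ, hN⟩ := exists_solves_map_of_isGoodMap hD h hα0 hα1 hδ0 hn1 hf (by
    rw [← hpow]
    gcongr)
  rw [PMF.map_comp, PMF.map_comp] at hψ
  rw [hn]
  refine le_trans ?_ (natCast_le_commBound hN)
  exact ENat.toENNReal_le.2 (constrainedSampleComplexity_le_of_solves hψ (Set.mem_univ _))

end HypTest

namespace RealRAM

open HypTest

/-! ### Frame conditions and Hoare-style rules with running times. -/

/-- Write sets are syntactic lists, so that `decide` settles which registers and arrays a program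
leaves alone. -/
def Instr.modN : Instr → List ℕ
  | .natConst r _ | .natAdd r _ _ | .natSub r _ _ | .natLoad r _ _ => [r]
  | _ => []

def Instr.modR : Instr → List ℕ
  | .realConst r _ | .realAdd r _ _ | .realSub r _ _ | .realMul r _ _ | .realDiv r _ _
  | .realLoad r _ _ => [r]
  | _ => []

def Instr.modNA : Instr → List ℕ
  | .natStore arr _ _ => [arr]
  | _ => []

def Instr.modRA : Instr → List ℕ
  | .realStore arr _ _ => [arr]
  | _ => []

/-- The union over the instructions of a program of the lists given by `m`. -/
def Prog.collect (m : Instr → List ℕ) : Prog → List ℕ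
  | .skip => []
  | .instr i => m i
  | .seq c₁ c₂ | .ite _ c₁ c₂ => c₁.collect m ++ c₂.collect m
  | .loop _ c => c.collect m

/-- `s'` agrees with `s` on everything that `c` does not write to. -/
structure Frame (c : Prog) (s s' : State) : Prop where
  n : ∀ r, r ∉ c.collect Instr.modN → s'.nreg r = s.nreg r
  r : ∀ r, r ∉ c.collect Instr.modR → s'.rreg r = s.rreg r
  na : ∀ r, r ∉ c.collect Instr.modNA → s'.narr r = s.narr r
  ra : ∀ r, r ∉ c.collect Instr.modRA → s'.rarr r = s.rarr r

theorem Frame.refl (c : Prog) (s : State) : Frame c s s :=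
  ⟨fun _ _ => rfl, fun _ _ => rfl, fun _ _ => rfl, fun _ _ => rfl⟩

theorem Frame.trans {c : Prog} {s s' s'' : State} (h : Frame c s s') (h' : Frame c s' s'') :
    Frame c s s'' :=
  ⟨fun r hr => (h'.n r hr).trans (h.n r hr), fun r hr => (h'.r r hr).trans (h.r r hr),
    fun r hr => (h'.na r hr).trans (h.na r hr), fun r hr => (h'.ra r hr).trans (h.ra r hr)⟩

theorem Frame.mono {c d : Prog} {s s' : State} (h : Frame c s s')
    (hsub : ∀ m, c.collect m ⊆ d.collect m) : Frame d s s' :=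
  ⟨fun r hr => h.n r fun h' => hr (hsub _ h'), fun r hr => h.r r fun h' => hr (hsub _ h'),
    fun r hr => h.na r fun h' => hr (hsub _ h'), fun r hr => h.ra r fun h' => hr (hsub _ h')⟩

theorem Instr.frame (i : Instr) (s : State) : Frame (.instr i) s (i.apply s) := by
  cases i <;> constructor <;> intro r hr <;>
    simp_all [Prog.collect, Instr.modN, Instr.modR, Instr.modNA, Instr.modRA, Instr.apply,
      State.setN, State.setR]

theorem Exec.frame {c : Prog} {s s' : State} {t : ℕ} (h : Exec c s t s') : Frame c s s' := by
  induction h with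
  | skip s => exact .refl _ _
  | instr i s => exact i.frame s
  | seq _ _ ih₁ ih₂ =>
    exact (ih₁.mono fun m => List.subset_append_left _ _).trans
      (ih₂.mono fun m => List.subset_append_right _ _)
  | iteTrue _ _ ih => exact ih.mono fun m => List.subset_append_left _ _
  | iteFalse _ _ ih => exact ih.mono fun m => List.subset_append_right _ _
  | loopFalse _ => exact .refl _ _
  | loopTrue _ _ _ ih₁ ih₂ => exact (ih₁.mono (d := .loop _ _) fun m => List.Subset.refl _).trans ih₂

/-- Started in `s`, the program `c` halts within `T` steps in a state that satisfies `Q`. -/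
def Runs (c : Prog) (s : State) (T : ℕ) (Q : State → Prop) : Prop :=
  ∃ t s', Exec c s t s' ∧ t ≤ T ∧ Q s'

theorem Runs.mono {c : Prog} {s : State} {T T' : ℕ} {Q Q' : State → Prop} (h : Runs c s T Q)
    (hT : T ≤ T') (hQ : ∀ s', Frame c s s' → Q s' → Q' s') : Runs c s T' Q' := by
  obtain ⟨t, s', he, ht, hq⟩ := h
  exact ⟨t, s', he, ht.trans hT, hQ s' he.frame hq⟩

theorem Runs.skip {s : State} {T : ℕ} {Q : State → Prop} (h : Q s) : Runs .skip s T Q :=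
  ⟨0, s, .skip s, Nat.zero_le _, h⟩

theorem Runs.instr {i : Instr} {s : State} {Q : State → Prop} (h : Q (i.apply s)) :
    Runs (.instr i) s 1 Q :=
  ⟨1, _, .instr i s, le_rfl, h⟩

/-- The continuation receives the frame of the first part, so postconditions need only mention what
has changed. -/
theorem Runs.seq {c₁ c₂ : Prog} {s : State} {T₁ T₂ : ℕ} {Q₁ Q : State → Prop}
    (h₁ : Runs c₁ s T₁ Q₁) (h₂ : ∀ s₁, Frame c₁ s s₁ → Q₁ s₁ → Runs c₂ s₁ T₂ Q) :
    Runs (.seq c₁ c₂) s (T₁ + T₂) Q := by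
  obtain ⟨t₁, s₁, he₁, ht₁, hq₁⟩ := h₁
  obtain ⟨t₂, s₂, he₂, ht₂, hq₂⟩ := h₂ s₁ he₁.frame hq₁
  exact ⟨_, s₂, .seq he₁ he₂, add_le_add ht₁ ht₂, hq₂⟩

theorem Runs.ite {b : Cond} {c₁ c₂ : Prog} {s : State} {T : ℕ} {Q : State → Prop}
    (h₁ : b.Holds s → Runs c₁ s T Q) (h₂ : ¬ b.Holds s → Runs c₂ s T Q) :
    Runs (.ite b c₁ c₂) s (T + 1) Q := by
  by_cases hb : b.Holds s
  · obtain ⟨t, s', he, ht, hq⟩ := h₁ hb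
    exact ⟨_, s', .iteTrue hb he, by omega, hq⟩
  · obtain ⟨t, s', he, ht, hq⟩ := h₂ hb
    exact ⟨_, s', .iteFalse hb he, by omega, hq⟩

/-- Loops with invariant `I` and variant `μ`. -/
theorem Runs.loop {b : Cond} {c : Prog} {s : State} {T : ℕ} {I Q : State → Prop} (μ : State → ℕ)
    (h0 : I s)
    (hstep : ∀ s₁, Frame c s s₁ → I s₁ → b.Holds s₁ →
      Runs c s₁ T fun s₂ => I s₂ ∧ μ s₂ < μ s₁)
    (hQ : ∀ s₁, Frame c s s₁ → I s₁ → ¬ b.Holds s₁ → Q s₁) :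
    Runs (.loop b c) s (μ s * (T + 1) + 1) Q := by
  -- Induction on a bound for the variant, with frames taken relative to the fixed start `s`. Each
  -- pass costs `T + 1` with its test; the last 1 is the failing test.
  suffices ∀ n s₁, μ s₁ ≤ n → Frame c s s₁ → I s₁ → Runs (.loop b c) s₁ (n * (T + 1) + 1) Q from
    this _ s le_rfl (.refl _ _) h0
  intro n
  induction n with
  | zero =>
    intro s₁ hn hf hI
    by_cases hb : b.Holds s₁
    · obtain ⟨t, s₂, -, -, -, hlt⟩ := hstep s₁ hf hI hb
      omega
    · exact ⟨1, s₁, .loopFalse hb, by omega, hQ s₁ hf hI hb⟩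
  | succ n ih =>
    intro s₁ hn hf hI
    by_cases hb : b.Holds s₁
    · obtain ⟨t, s₂, he, ht, hI₂, hlt⟩ := hstep s₁ hf hI hb
      obtain ⟨t', s₃, he', ht', hq⟩ := ih s₂ (by omega) (hf.trans he.frame) hI₂
      refine ⟨_, s₃, .loopTrue hb he he', ?_, hq⟩
      rw [Nat.succ_mul]
      omega
    · refine ⟨1, s₁, .loopFalse hb, by omega, hQ s₁ hf hI hb⟩

/-- Straight-line code. -/
def block : List Instr → Prog
  | [] => .skip
  | i :: l => .seq (.instr i) (block l)

/-- The effect of straight-line code. -/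
noncomputable def run : List Instr → State → State
  | [], s => s
  | i :: l, s => run l (i.apply s)

theorem Runs.block {l : List Instr} {s : State} {Q : State → Prop} (h : Q (run l s)) :
    Runs (block l) s l.length Q := by
  induction l generalizing s with
  | nil => exact .skip h
  | cons i l ih =>
    obtain ⟨t, s', he, ht, hq⟩ := ih h
    exact ⟨_, s', .seq (.instr i s) he, by simp only [List.length_cons]; omega, hq⟩

@[simp] theorem run_nil (s : State) : run [] s = s := rfl

@[simp] theorem run_cons (i : Instr) (l : List Instr) (s : State) :
    run (i :: l) s = run l (i.apply s) := rfl

attribute [simp] Instr.apply State.setN State.setR Function.update_apply Cond.Holds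

/-! ### The program -/

/-! ### Computation of the parameters. -/

/-- Natural registers 9 and 31 serve as the constants 1 and 0, real registers 3 and 4 as 1 and 1/2.
Registers are copied by adding 0 or multiplying by 1. -/
def initProg : Prog := block
  [.natConst 9 1, .realConst 3 1, .realConst 4 (1 / 2), .realMul 5 0 3, .realConst 6 1,
    .realAdd 8 1 1, .realConst 9 1]

/-- The count is kept both as a natural and as a real, because the machine has no conversion between
them. -/
def countAProg : Prog := .loop (.realLt 5 3) <| block
  [.realAdd 5 5 5, .realMul 6 6 4, .realAdd 7 7 3, .natAdd 2 2 9]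

/-- Real register 8 starts at 2δ, so after j passes it holds 2^(j+1) δ, and the loop stops at the
last j with 2^j δ ≤ α. -/
def countBProg : Prog := .loop (.realLe 8 0) <| block
  [.realAdd 8 8 8, .realMul 9 9 4, .realAdd 10 10 3, .natAdd 3 3 9]

/-- The powers with exponents 12b and 12(4b + a) come from cubing and repeated squaring. Natural
register 4 starts at 3b + 1, meaning that no certificate is known; register 10 keeps this value for
the final test. -/
def paramProg : Prog := block
  [.realAdd 11 10 10, .realAdd 11 11 11, .realAdd 11 11 7, .realDiv 2 11 10,
    .realMul 12 9 9, .realMul 12 12 9, .realMul 12 12 12, .realMul 12 12 12,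
    .realMul 14 6 6, .realMul 14 14 6, .realMul 14 14 14, .realMul 14 14 14,
    .realMul 13 12 12, .realMul 13 13 13, .realMul 13 13 14,
    .natAdd 4 3 3, .natAdd 4 4 3, .natAdd 4 4 9, .natAdd 10 4 31]

def setupProg : Prog := .seq initProg (.seq countAProg (.seq countBProg paramProg))

/-- The state holds the input and the derived parameters. -/
structure Params (k D a b : ℕ) (p q : Fin k → ℝ) (s : State) : Prop where
  n0 : s.nreg 0 = k
  n1 : s.nreg 1 = D
  n2 : s.nreg 2 = a
  n9 : s.nreg 9 = 1
  n10 : s.nreg 10 = 3 * b + 1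
  n31 : s.nreg 31 = 0
  r2 : s.rreg 2 = 1 / HypTest.order a b
  r3 : s.rreg 3 = 1
  r12 : s.rreg 12 = (1 / 2) ^ (12 * b)
  r13 : s.rreg 13 = (1 / 2) ^ (12 * (4 * b + a))
  p : ∀ x : Fin k, s.rarr 0 x = p x
  q : ∀ x : Fin k, s.rarr 1 x = q x

theorem runs_countA {α δ : ℝ} {a b : ℕ} (h : HypTest.LogCounts α δ a b) (hα : 0 < α) {s : State}
    (h5 : s.rreg 5 = α) (h3 : s.rreg 3 = 1) (h4 : s.rreg 4 = 1 / 2) (h6 : s.rreg 6 = 1)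
    (h7 : s.rreg 7 = 0) (h2 : s.nreg 2 = 0) (h9 : s.nreg 9 = 1) :
    Runs countAProg s (a * 5 + 1)
      fun s' => s'.nreg 2 = a ∧ s'.rreg 6 = (1 / 2) ^ a ∧ s'.rreg 7 = a := by
  have := Runs.loop (b := .realLt 5 3) (s := s) (T := 4)
    (c := block [.realAdd 5 5 5, .realMul 6 6 4, .realAdd 7 7 3, .natAdd 2 2 9])
    (I := fun s' => s'.nreg 2 ≤ a ∧ s'.rreg 5 = 2 ^ s'.nreg 2 * α ∧
      s'.rreg 6 = (1 / 2) ^ s'.nreg 2 ∧ s'.rreg 7 = s'.nreg 2)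
    (Q := fun s' => s'.nreg 2 = a ∧ s'.rreg 6 = (1 / 2) ^ a ∧ s'.rreg 7 = a)
    (μ := fun s' => a - s'.nreg 2) (by simp [h2, h5, h6, h7]) ?_ ?_
  · simp only [h2, Nat.sub_zero] at this
    exact this
  · rintro s₁ hf ⟨hle, e5, e6, e7⟩ hb
    have f3 := hf.r 3 (by decide)
    have f4 := hf.r 4 (by decide)
    have f9 := hf.n 9 (by decide)
    refine .block ?_
    have hlt : s₁.nreg 2 < a := by
      refine lt_of_le_of_ne hle fun heq => ?_
      simp only [Cond.Holds, e5, f3, h3, heq] at hb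
      linarith [h.one_le]
    simp [f3, f4, f9, h3, h4, h9, e5, e6, e7, pow_succ]
    exact ⟨⟨hlt, by ring⟩, by omega⟩
  · rintro s₁ hf ⟨hle, e5, e6, e7⟩ hb
    have f3 := hf.r 3 (by decide)
    have heq : s₁.nreg 2 = a := by
      refine le_antisymm hle ?_
      by_contra! hlt
      simp only [Cond.Holds, e5, f3, h3, not_lt] at hb
      have h1 : (2 : ℝ) ^ (s₁.nreg 2 + 1) ≤ 2 ^ a := pow_le_pow_right₀ (by norm_num) hlt
      rw [pow_succ] at h1
      nlinarith [h.lt_two]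
    rw [heq] at e6 e7
    exact ⟨heq, e6, e7⟩

theorem runs_countB {α δ : ℝ} {a b : ℕ} (h : HypTest.LogCounts α δ a b) (hδ : 0 < δ) {s : State}
    (h0 : s.rreg 0 = α) (h3 : s.rreg 3 = 1) (h4 : s.rreg 4 = 1 / 2) (h8 : s.rreg 8 = δ + δ)
    (h9' : s.rreg 9 = 1) (h10 : s.rreg 10 = 0) (hn3 : s.nreg 3 = 0) (h9 : s.nreg 9 = 1) :
    Runs countBProg s (b * 5 + 1)
      fun s' => s'.nreg 3 = b ∧ s'.rreg 9 = (1 / 2) ^ b ∧ s'.rreg 10 = b := by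
  have := Runs.loop (b := .realLe 8 0) (s := s) (T := 4)
    (c := block [.realAdd 8 8 8, .realMul 9 9 4, .realAdd 10 10 3, .natAdd 3 3 9])
    (I := fun s' => s'.nreg 3 ≤ b ∧ s'.rreg 8 = 2 ^ (s'.nreg 3 + 1) * δ ∧
      s'.rreg 9 = (1 / 2) ^ s'.nreg 3 ∧ s'.rreg 10 = s'.nreg 3)
    (Q := fun s' => s'.nreg 3 = b ∧ s'.rreg 9 = (1 / 2) ^ b ∧ s'.rreg 10 = b)
    (μ := fun s' => b - s'.nreg 3) (by simp [hn3, h8, h9', h10, two_mul]) ?_ ?_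
  · simp only [hn3, Nat.sub_zero] at this
    exact this
  · rintro s₁ hf ⟨hle, e8, e9, e10⟩ hb
    have f0 := hf.r 0 (by decide)
    have f3 := hf.r 3 (by decide)
    have f4 := hf.r 4 (by decide)
    have f9 := hf.n 9 (by decide)
    refine .block ?_
    have hlt : s₁.nreg 3 < b := by
      refine lt_of_le_of_ne hle fun heq => ?_
      simp only [Cond.Holds, e8, f0, h0, heq] at hb
      linarith [h.lt_pow_mul]
    simp [f3, f4, f9, h3, h4, h9, e8, e9, e10, pow_succ]
    exact ⟨⟨hlt, by ring⟩, by omega⟩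
  · rintro s₁ hf ⟨hle, e8, e9, e10⟩ hb
    have f0 := hf.r 0 (by decide)
    have heq : s₁.nreg 3 = b := by
      refine le_antisymm hle ?_
      by_contra! hlt
      simp only [Cond.Holds, e8, f0, h0, not_le] at hb
      have h1 : (2 : ℝ) ^ (s₁.nreg 3 + 1) ≤ 2 ^ b := pow_le_pow_right₀ (by norm_num) hlt
      nlinarith [h.pow_mul_le]
    rw [heq] at e9 e10
    exact ⟨heq, e9, e10⟩

theorem runs_setup {k D a b : ℕ} {α δ : ℝ} (h : HypTest.LogCounts α δ a b) (hα : 0 < α)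
    (hδ : 0 < δ) (p q : PMF (Fin k)) :
    Runs setupProg (inputState p q α δ D) (5 * a + 5 * b + 28) fun s =>
      Params k D a b (fun x => (p x).toReal) (fun x => (q x).toReal) s ∧ s.nreg 4 = 3 * b + 1 ∧
        s.rarr 2 = fun _ => 0 := by
  have hb2 : (2 : ℝ) ≤ b := by exact_mod_cast h.two_le_b
  refine Runs.mono (Runs.seq (T₁ := 7) (Q₁ := fun s => s.nreg 9 = 1 ∧ s.rreg 3 = 1 ∧
    s.rreg 4 = 1 / 2 ∧ s.rreg 5 = α ∧ s.rreg 6 = 1 ∧ s.rreg 8 = δ + δ ∧ s.rreg 9 = 1)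
    (.block (by simp [inputState])) fun s₁ hf₁ ⟨h9, h3, h4, h5, h6, h8, h9'⟩ =>
    Runs.seq (runs_countA h hα h5 h3 h4 h6 ((hf₁.r 7 (by decide)).trans (by simp [inputState]))
      ((hf₁.n 2 (by decide)).trans (by simp [inputState])) h9) fun s₂ hf₂ ⟨e2, e6, e7⟩ =>
    Runs.seq (runs_countB h hδ
      (by rw [hf₂.r 0 (by decide), hf₁.r 0 (by decide)]; simp [inputState])
      (by rw [hf₂.r 3 (by decide), h3]) (by rw [hf₂.r 4 (by decide), h4])
      (by rw [hf₂.r 8 (by decide), h8]) (by rw [hf₂.r 9 (by decide), h9'])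
      (by rw [hf₂.r 10 (by decide), hf₁.r 10 (by decide)]; simp [inputState])
      (by rw [hf₂.n 3 (by decide), hf₁.n 3 (by decide)]; simp [inputState])
      (by rw [hf₂.n 9 (by decide), h9])) fun s₃ hf₃ ⟨g3, g9, g10⟩ =>
    Runs.block (Q := fun s => s.nreg 4 = 3 * b + 1 ∧ s.nreg 10 = 3 * b + 1 ∧
      s.rreg 2 = 1 / HypTest.order a b ∧ s.rreg 12 = (1 / 2) ^ (12 * b) ∧
      s.rreg 13 = (1 / 2) ^ (12 * (4 * b + a)) ∧ s.nreg 2 = a ∧ s.nreg 9 = 1 ∧ s.rreg 3 = 1)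
      ?_) (by simp; omega) ?_
  · have e6' : s₃.rreg 6 = (1 / 2) ^ a := by rw [hf₃.r 6 (by decide), e6]
    have e7' : s₃.rreg 7 = a := by rw [hf₃.r 7 (by decide), e7]
    have f9 : s₃.nreg 9 = 1 := by rw [hf₃.n 9 (by decide), hf₂.n 9 (by decide), h9]
    have f31 : s₃.nreg 31 = 0 := by
      rw [hf₃.n 31 (by decide), hf₂.n 31 (by decide), hf₁.n 31 (by decide)]; simp [inputState]
    have f2 : s₃.nreg 2 = a := by rw [hf₃.n 2 (by decide), e2]
    have f3 : s₃.rreg 3 = 1 := by rw [hf₃.r 3 (by decide), hf₂.r 3 (by decide), h3]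
    simp only [run_cons, run_nil, Instr.apply, State.setN, State.setR, Function.update_apply]
    norm_num only [if_true, if_false, reduceIte, e6', e7', f9, f31, f2, f3, g3, g9, g10]
    refine ⟨by omega, by omega, ?_, ?_, ?_, trivial, trivial, trivial⟩
    · rw [HypTest.order, one_div_div]
      congr 1
      ring
    · rw [mul_comm 12 b, pow_mul]; ring
    · rw [show 12 * (4 * b + a) = b * 48 + a * 12 by ring, pow_add, pow_mul, pow_mul]; ring
  · rintro s hf ⟨h4, h10, h2, h12, h13, f2, f9, f3⟩
    have f0 := hf.n 0 (by decide)
    have f1 := hf.n 1 (by decide)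
    have f31 := hf.n 31 (by decide)
    have g0 := hf.ra 0 (by decide)
    have g1 := hf.ra 1 (by decide)
    have g2 := hf.ra 2 (by decide)
    refine ⟨⟨f0, f1.trans rfl, f2, f9, h10, f31.trans rfl, h2, f3, h12, h13, fun x => ?_,
      fun x => ?_⟩, h4, ?_⟩
    · rw [g0]; simp [inputState]
    · rw [g1]; simp [inputState]
    · rw [g2]; funext j; simp [inputState]

theorem Params.of_frame {k D a b : ℕ} {p q : Fin k → ℝ} {c : Prog} {s s' : State}
    (h : Params k D a b p q s) (hf : Frame c s s')
    (hn : ∀ r ∈ [0, 1, 2, 9, 10, 31], r ∉ c.collect Instr.modN)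
    (hr : ∀ r ∈ [2, 3, 12, 13], r ∉ c.collect Instr.modR)
    (ha : ∀ r ∈ [0, 1], r ∉ c.collect Instr.modRA) : Params k D a b p q s' := by
  have e := fun r hr' => hf.n r (hn r hr')
  have e' := fun r hr' => hf.r r (hr r hr')
  have e'' := fun r hr' => hf.ra r (ha r hr')
  simp only [List.mem_cons, List.not_mem_nil, or_false, forall_eq_or_imp, forall_eq] at e e' e''
  obtain ⟨e0, e1, e2, e9, e10, e31⟩ := e
  obtain ⟨r2, r3, r12, r13⟩ := e'
  exact ⟨e0.trans h.n0, e1.trans h.n1, e2.trans h.n2, e9.trans h.n9, e10.trans h.n10,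
    e31.trans h.n31, r2.trans h.r2, r3.trans h.r3, r12.trans h.r12, r13.trans h.r13,
    fun x => by rw [e''.1, h.p], fun x => by rw [e''.2, h.q]⟩

/-! ### Search for the best certified threshold. -/

/-- The sum over the first `i` indices. -/
def partialSum {k : ℕ} (F : Fin k → ℝ) (i : ℕ) : ℝ := ∑ y : Fin k, if y.val < i then F y else 0

@[simp] theorem partialSum_zero {k : ℕ} (F : Fin k → ℝ) : partialSum F 0 = 0 := by
  simp [partialSum]

theorem partialSum_self {k : ℕ} (F : Fin k → ℝ) : partialSum F k = ∑ y, F y := by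
  simp [partialSum]

theorem partialSum_succ {k : ℕ} (F : Fin k → ℝ) {i : ℕ} (hi : i < k) :
    partialSum F (i + 1) = partialSum F i + F ⟨i, hi⟩ := by
  have : F ⟨i, hi⟩ = ∑ y : Fin k, if y = ⟨i, hi⟩ then F y else 0 := by simp
  rw [this, partialSum, partialSum, ← Finset.sum_add_distrib]
  refine Finset.sum_congr rfl fun y _ => ?_
  by_cases h1 : y.val < i
  · have h2 : y ≠ ⟨i, hi⟩ := fun h => by simp [h] at h1
    simp [h1, h2, Nat.lt_succ_of_lt h1]
  · by_cases h2 : y = ⟨i, hi⟩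
    · simp [h2]
    · have h3 : ¬ y.val < i + 1 := fun h => h2 (Fin.ext (by simp; omega))
      simp [h1, h2, h3]

/-- Ratios are compared by cross multiplication, so zero masses need no separate treatment. -/
def compareBlock : List Instr :=
  [.realLoad 19 0 7, .realLoad 20 1 7, .realMul 21 20 15, .realMul 22 19 16]

def scanBody : Prog := .seq (block compareBlock)
  (.seq (.ite (.realLe 21 22) (.instr (.realAdd 18 18 20)) (.instr (.realAdd 17 17 19)))
    (.instr (.natAdd 7 7 9)))

def scanProg : Prog := .loop (.natLt 7 0) scanBody

theorem runs_compare {k D a b : ℕ} {p q : Fin k → ℝ} {s : State} (h : Params k D a b p q s)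
    {x y : Fin k} (h15 : s.rreg 15 = p x) (h16 : s.rreg 16 = q x) (h7 : s.nreg 7 = y) :
    Runs (block compareBlock) s 4 fun s' => s'.rreg 19 = p y ∧ s'.rreg 20 = q y ∧
      s'.rreg 21 = q y * p x ∧ s'.rreg 22 = p y * q x := by
  refine .block ?_
  simp [compareBlock, h15, h16, h7, h.p, h.q]

theorem runs_scan {k D a b : ℕ} {p q : Fin k → ℝ} {s : State} (h : Params k D a b p q s)
    {x : Fin k} (h15 : s.rreg 15 = p x) (h16 : s.rreg 16 = q x) (h17 : s.rreg 17 = 0)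
    (h18 : s.rreg 18 = 0) (h7 : s.nreg 7 = 0) :
    Runs scanProg s (k * 8 + 1)
      fun s' => s'.rreg 17 = missFst p q x ∧ s'.rreg 18 = missSnd p q x := by
  have := Runs.loop (b := .natLt 7 0) (s := s) (T := 7) (c := scanBody)
    (I := fun s' => s'.nreg 7 ≤ k ∧
      s'.rreg 17 = partialSum (fun y => if q y * p x ≤ p y * q x then 0 else p y) (s'.nreg 7) ∧
      s'.rreg 18 = partialSum (fun y => if q y * p x ≤ p y * q x then q y else 0) (s'.nreg 7))
    (Q := fun s' => s'.rreg 17 = missFst p q x ∧ s'.rreg 18 = missSnd p q x)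
    (μ := fun s' => k - s'.nreg 7) (by simp [h7, h17, h18]) ?_ ?_
  · simp only [h7, Nat.sub_zero] at this
    exact this
  · rintro s₁ hf ⟨hle, e17, e18⟩ hb
    have hP := h.of_frame hf (by decide) (by decide) (by decide)
    have hlt : s₁.nreg 7 < k := by simpa [hP.n0] using hb
    have f15 := (hf.r 15 (by decide)).trans h15
    have f16 := (hf.r 16 (by decide)).trans h16
    refine Runs.mono (Runs.seq (runs_compare hP (y := ⟨s₁.nreg 7, hlt⟩) f15 f16 rfl)
      fun s₂ hf₂ ⟨g19, g20, g21, g22⟩ => Runs.seq (T₁ := 2) (Q₁ := fun s' =>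
        s'.rreg 17 = partialSum (fun y => if q y * p x ≤ p y * q x then 0 else p y)
          (s₁.nreg 7 + 1) ∧
        s'.rreg 18 = partialSum (fun y => if q y * p x ≤ p y * q x then q y else 0)
          (s₁.nreg 7 + 1)) (.ite (fun hb => .instr ?_) (fun hb => .instr ?_))
        fun s₃ hf₃ ⟨g17, g18⟩ => .instr (Q := fun s' => (s'.nreg 7 ≤ k ∧
          s'.rreg 17 = partialSum (fun y => if q y * p x ≤ p y * q x then 0 else p y)
            (s'.nreg 7) ∧
          s'.rreg 18 = partialSum (fun y => if q y * p x ≤ p y * q x then q y else 0)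
            (s'.nreg 7)) ∧ k - s'.nreg 7 < k - s₁.nreg 7) ?_) (by norm_num) fun _ _ h => h
    · have f17 := hf₂.r 17 (by decide)
      have f18 := hf₂.r 18 (by decide)
      simp only [Cond.Holds, g21, g22] at hb
      simp [partialSum_succ _ hlt, f17, f18, e17, e18, g20, hb]
    · have f17 := hf₂.r 17 (by decide)
      have f18 := hf₂.r 18 (by decide)
      simp only [Cond.Holds, g21, g22] at hb
      simp [partialSum_succ _ hlt, f17, f18, e17, e18, g19, hb]
    · have f7 : s₃.nreg 7 = s₁.nreg 7 := (hf₃.n 7 (by decide)).trans (hf₂.n 7 (by decide))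
      have f9 : s₃.nreg 9 = 1 := (hf₃.n 9 (by decide)).trans ((hf₂.n 9 (by decide)).trans hP.n9)
      simp [f7, f9, g17, g18]
      omega
  · rintro s₁ hf ⟨hle, e17, e18⟩ hb
    have hP := h.of_frame hf (by decide) (by decide) (by decide)
    have heq : s₁.nreg 7 = k := le_antisymm hle (by simpa [hP.n0] using hb)
    rw [heq, partialSum_self] at e17 e18
    exact ⟨e17, e18⟩

/-- Natural register 4 is both the best `m` so far and the loop bound: a success lowers it to the
current exponent, which ends the loop, and later symbols are only tried at smaller exponents. -/
def powerBody : Prog := .seq (block [.natAdd 8 8 9, .realMul 19 19 17, .realMul 20 20 18])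
  (.ite (.realLe 19 12) (.ite (.realLe 20 13) (block [.natAdd 4 8 31, .natAdd 5 6 31]) .skip) .skip)

def powerProg : Prog := .loop (.natLt 8 4) powerBody

theorem runs_power {k D a b : ℕ} {p q : Fin k → ℝ} {s : State} (h : Params k D a b p q s)
    {x : Fin k} (h17 : s.rreg 17 = missFst p q x) (h18 : s.rreg 18 = missSnd p q x)
    (h8 : s.nreg 8 = 0) (h19 : s.rreg 19 = 1) (h20 : s.rreg 20 = 1) (h6 : s.nreg 6 = x) :
    Runs powerProg s (s.nreg 4 * 8 + 1) fun s' => s'.nreg 4 ≤ s.nreg 4 ∧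
      (∀ m, 1 ≤ m → m < s'.nreg 4 → ¬ IsCert a b p q x m) ∧
      (s'.nreg 4 = s.nreg 4 ∧ s'.nreg 5 = s.nreg 5 ∨
        1 ≤ s'.nreg 4 ∧ IsCert a b p q x (s'.nreg 4) ∧ s'.nreg 5 = x) := by
  have := Runs.loop (b := .natLt 8 4) (s := s) (T := 7) (c := powerBody)
    (I := fun s' => s'.nreg 8 ≤ s'.nreg 4 ∧ s'.nreg 4 ≤ s.nreg 4 ∧
      s'.rreg 19 = missFst p q x ^ s'.nreg 8 ∧ s'.rreg 20 = missSnd p q x ^ s'.nreg 8 ∧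
      (∀ m, 1 ≤ m → m ≤ s'.nreg 8 → m < s'.nreg 4 → ¬ IsCert a b p q x m) ∧
      (s'.nreg 4 = s.nreg 4 ∧ s'.nreg 5 = s.nreg 5 ∨
        1 ≤ s'.nreg 4 ∧ IsCert a b p q x (s'.nreg 4) ∧ s'.nreg 5 = x))
    (Q := fun s' => s'.nreg 4 ≤ s.nreg 4 ∧
      (∀ m, 1 ≤ m → m < s'.nreg 4 → ¬ IsCert a b p q x m) ∧
      (s'.nreg 4 = s.nreg 4 ∧ s'.nreg 5 = s.nreg 5 ∨
        1 ≤ s'.nreg 4 ∧ IsCert a b p q x (s'.nreg 4) ∧ s'.nreg 5 = x))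
    (μ := fun s' => s'.nreg 4 - s'.nreg 8) ?_ ?_ ?_
  · simp only [h8, Nat.sub_zero] at this
    exact this
  · simp only [h8, h19, h20, pow_zero, Nat.zero_le, le_refl, true_and, true_or, and_true]
    intro m h1 h2
    omega
  · rintro s₁ hf ⟨hle, hle', e19, e20, hno, hyes⟩ hb
    have hP := h.of_frame hf (by decide) (by decide) (by decide)
    have hlt : s₁.nreg 8 < s₁.nreg 4 := hb
    have f17 := (hf.r 17 (by decide)).trans h17
    have f18 := (hf.r 18 (by decide)).trans h18
    have f6 := (hf.n 6 (by decide)).trans h6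
    refine Runs.seq (T₁ := 3) (T₂ := 4) (Q₁ := fun s' => s'.nreg 8 = s₁.nreg 8 + 1 ∧
      s'.rreg 19 = missFst p q x ^ (s₁.nreg 8 + 1) ∧
      s'.rreg 20 = missSnd p q x ^ (s₁.nreg 8 + 1)) (.block ?_) fun s₂ hf₂ ⟨g8, g19, g20⟩ => ?_
    · simp [e19, e20, f17, f18, hP.n9, pow_succ]
    have hP₂ := hP.of_frame hf₂ (by decide) (by decide) (by decide)
    have f4 := hf₂.n 4 (by decide)
    have f5 := hf₂.n 5 (by decide)
    have f6' := (hf₂.n 6 (by decide)).trans f6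
    have keep : ¬ IsCert a b p q x (s₁.nreg 8 + 1) → (s₂.nreg 8 ≤ s₂.nreg 4 ∧
        s₂.nreg 4 ≤ s.nreg 4 ∧
        s₂.rreg 19 = missFst p q x ^ s₂.nreg 8 ∧ s₂.rreg 20 = missSnd p q x ^ s₂.nreg 8 ∧
        (∀ m, 1 ≤ m → m ≤ s₂.nreg 8 → m < s₂.nreg 4 → ¬ IsCert a b p q x m) ∧
        (s₂.nreg 4 = s.nreg 4 ∧ s₂.nreg 5 = s.nreg 5 ∨
          1 ≤ s₂.nreg 4 ∧ IsCert a b p q x (s₂.nreg 4) ∧ s₂.nreg 5 = x)) ∧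
        s₂.nreg 4 - s₂.nreg 8 < s₁.nreg 4 - s₁.nreg 8 := by
      intro hc
      rw [f4, f5, g8]
      refine ⟨⟨hlt, hle', g19, g20, fun m h1 h2 h3 => ?_, hyes⟩, by omega⟩
      rcases h2.eq_or_lt with rfl | h4
      · exact hc
      · exact hno m h1 (by omega) h3
    refine .ite (fun hb₁ => .ite (fun hb₂ => .block (l := [.natAdd 4 8 31, .natAdd 5 6 31]) ?_)
      fun hb₂ => .skip (keep fun hc => hb₂ ?_)) fun hb₁ => Runs.skip (keep fun hc => hb₁ ?_)
    · simp only [Cond.Holds, g19, g20, hP₂.r12, hP₂.r13] at hb₁ hb₂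
      simp only [run_cons, run_nil, Instr.apply, State.setN, Function.update_apply]
      norm_num only [if_true, if_false, reduceIte, hP₂.n31, g8, g19, g20, f6']
      refine ⟨⟨by omega, by omega, trivial, trivial, fun m h1 h2 h3 => ?_, Or.inr
        ⟨by omega, ⟨hb₁, hb₂⟩, Nat.add_zero _⟩⟩, by omega⟩
      exact hno m h1 (by omega) (by omega)
    · simp only [Cond.Holds, g20, hP₂.r13]
      exact hc.2
    · simp only [Cond.Holds, g19, hP₂.r12]
      exact hc.1
  · rintro s₁ hf ⟨hle, hle', e19, e20, hno, hyes⟩ hb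
    have hge : s₁.nreg 4 ≤ s₁.nreg 8 := not_lt.1 hb
    exact ⟨hle', fun m h1 h2 => hno m h1 (by omega) h2, hyes⟩

def certBody : Prog :=
  .seq (block [.realLoad 15 0 6, .realLoad 16 1 6, .realConst 17 0, .realConst 18 0, .natConst 7 0])
    (.seq scanProg (.seq (block [.natConst 8 0, .realConst 19 1, .realConst 20 1])
      (.seq powerProg (.instr (.natAdd 6 6 9)))))

def certProg : Prog := .seq (.instr (.natConst 6 0)) (.loop (.natLt 6 0) certBody)

/-- The best certificate among the symbols below `i`. -/
def BestCert {k : ℕ} (a b : ℕ) (p q : Fin k → ℝ) (i : ℕ) (s : State) : Prop :=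
  s.nreg 4 ≤ 3 * b + 1 ∧
    (s.nreg 4 = 3 * b + 1 ∨ ∃ x : Fin k, s.nreg 5 = x ∧ 1 ≤ s.nreg 4 ∧
      IsCert a b p q x (s.nreg 4)) ∧
    ∀ x : Fin k, x.val < i → ∀ m, 1 ≤ m → m < s.nreg 4 → ¬ IsCert a b p q x m

theorem runs_cert {k D a b : ℕ} {p q : Fin k → ℝ} {s : State} (h : Params k D a b p q s)
    (h4 : s.nreg 4 = 3 * b + 1) :
    Runs certProg s (k * (8 * k + 24 * b + 20) + 2) (BestCert a b p q k) := by
  refine Runs.mono (Runs.seq (T₁ := 1) (T₂ := k * (8 * k + 24 * b + 20) + 1)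
    (Q₁ := fun s' => s'.nreg 6 = 0) (.instr (by simp))
    fun s₀ hf₀ h6 => Runs.mono (Runs.loop (T := 8 * k + 24 * b + 19)
      (I := fun s' => s'.nreg 6 ≤ k ∧ BestCert a b p q (s'.nreg 6) s')
      (μ := fun s' => k - s'.nreg 6) (Q := BestCert a b p q k) ?_ ?_ ?_) (by simp [h6])
      fun _ _ h => h) (by omega) fun _ _ h => h
  · have f4 := (hf₀.n 4 (by decide)).trans h4
    rw [h6]
    exact ⟨Nat.zero_le _, f4.le, .inl f4, fun x hx => absurd hx (Nat.not_lt_zero _)⟩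
  · rintro s₁ hf ⟨hle, hle4, hyes, hno⟩ hb
    have hP := (h.of_frame hf₀ (by decide) (by decide) (by decide)).of_frame hf
      (by decide) (by decide) (by decide)
    have hlt : s₁.nreg 6 < k := by simpa [hP.n0] using hb
    obtain ⟨x, hx⟩ : ∃ x : Fin k, s₁.nreg 6 = x := ⟨⟨_, hlt⟩, rfl⟩
    refine Runs.mono (Runs.seq (T₁ := 5) (T₂ := k * 8 + 1 + (3 + ((3 * b + 1) * 8 + 1 + 1)))
      (Q₁ := fun s' => s'.rreg 15 = p x ∧ s'.rreg 16 = q x ∧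
      s'.rreg 17 = 0 ∧ s'.rreg 18 = 0 ∧ s'.nreg 7 = 0) (.block (by simp [hx, hP.p, hP.q]))
      fun s₂ hf₂ ⟨g15, g16, g17, g18, g7⟩ => ?_) (by omega) fun _ _ h => h
    have hP₂ := hP.of_frame hf₂ (by decide) (by decide) (by decide)
    refine (Runs.seq
      (runs_scan hP₂ g15 g16 g17 g18 g7) fun s₃ hf₃ ⟨e17, e18⟩ =>
      Runs.seq (T₁ := 3) (Q₁ := fun s' => s'.nreg 8 = 0 ∧ s'.rreg 19 = 1 ∧ s'.rreg 20 = 1)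
        (.block (by simp)) fun s₄ hf₄ ⟨g8, g19, g20⟩ => ?_)
    have hP₄ := (hP₂.of_frame hf₃ (by decide) (by decide) (by decide)).of_frame hf₄
      (by decide) (by decide) (by decide)
    have f6 : s₄.nreg 6 = x := by
      rw [hf₄.n 6 (by decide), hf₃.n 6 (by decide), hf₂.n 6 (by decide), hx]
    have f4 : s₄.nreg 4 = s₁.nreg 4 := by
      rw [hf₄.n 4 (by decide), hf₃.n 4 (by decide), hf₂.n 4 (by decide)]
    have f5 : s₄.nreg 5 = s₁.nreg 5 := by
      rw [hf₄.n 5 (by decide), hf₃.n 5 (by decide), hf₂.n 5 (by decide)]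
    refine Runs.seq ((runs_power hP₄ ((hf₄.r 17 (by decide)).trans e17)
      ((hf₄.r 18 (by decide)).trans e18) g8 g19 g20 f6).mono (by omega) fun _ _ h => h)
      fun s₅ hf₅ ⟨i1, i2, i3⟩ => .instr ?_
    have f9 : s₅.nreg 9 = 1 := (hf₅.n 9 (by decide)).trans hP₄.n9
    have f6' : s₅.nreg 6 = x := (hf₅.n 6 (by decide)).trans f6
    rw [f4] at i1 i3
    rw [f5] at i3
    simp only [BestCert, Instr.apply, State.setN, Function.update_apply]
    norm_num only [if_true, if_false, reduceIte, f9, f6', hx]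
    refine ⟨⟨by omega, by omega, ?_, fun y hy m hm1 hm2 => ?_⟩, by omega⟩
    · rcases i3 with ⟨j1, j2⟩ | ⟨j1, j2, j3⟩
      · rw [j1, j2]; exact hyes
      · exact .inr ⟨x, j3, j1, j2⟩
    · rcases Nat.lt_succ_iff_lt_or_eq.1 hy with h1 | h1
      · exact hno y (by omega) m hm1 (by omega)
      · rw [Fin.ext h1]; exact i2 m hm1 hm2
  · rintro s₁ hf ⟨hle, hI⟩ hb
    have hP := (h.of_frame hf₀ (by decide) (by decide) (by decide)).of_frame hf
      (by decide) (by decide) (by decide)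
    have heq : s₁.nreg 6 = k := le_antisymm hle (by simpa [hP.n0] using hb)
    rwa [heq] at hI

/-! ### Output of the threshold quantizer. -/

def thresholdBody : Prog := .seq (block compareBlock)
  (.seq (.ite (.realLe 21 22) (.instr (.natStore 0 7 31)) (.instr (.natStore 0 7 9)))
    (.instr (.natAdd 7 7 9)))

def thresholdProg : Prog :=
  .seq (block [.realLoad 15 0 5, .realLoad 16 1 5, .natConst 7 0])
    (.loop (.natLt 7 0) thresholdBody)

theorem runs_threshold {k D a b : ℕ} (hD : 2 ≤ D) {p q : Fin k → ℝ} {s : State}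
    (h : Params k D a b p q s) {x : Fin k} (h5 : s.nreg 5 = x) :
    Runs thresholdProg s (k * 8 + 4) fun s' => Outputs s' (thresholdMap hD p q x) := by
  refine Runs.mono (Runs.seq (T₁ := 3) (T₂ := k * 8 + 1) (Q₁ := fun s' => s'.rreg 15 = p x ∧
    s'.rreg 16 = q x ∧ s'.nreg 7 = 0) (.block (by simp [h5, h.p, h.q]))
    fun s₀ hf₀ ⟨h15, h16, h7⟩ => Runs.mono (Runs.loop (T := 7) (I := fun s' => s'.nreg 7 ≤ k ∧ ∀ y : Fin k, y.val < s'.nreg 7 →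
        s'.narr 0 y = thresholdMap hD p q x y)
      (μ := fun s' => k - s'.nreg 7) (Q := fun s' => Outputs s' (thresholdMap hD p q x))
      ?_ ?_ ?_) (by simp [h7]) fun _ _ h => h) (by omega) fun _ _ h => h
  · simp [h7]
  · rintro s₁ hf ⟨hle, hI⟩ hb
    have hP := (h.of_frame hf₀ (by decide) (by decide) (by decide)).of_frame hf
      (by decide) (by decide) (by decide)
    have hlt : s₁.nreg 7 < k := by simpa [hP.n0] using hb
    obtain ⟨y, hy⟩ : ∃ y : Fin k, s₁.nreg 7 = y := ⟨⟨_, hlt⟩, rfl⟩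
    have f15 := (hf.r 15 (by decide)).trans h15
    have f16 := (hf.r 16 (by decide)).trans h16
    refine Runs.mono (Runs.seq (runs_compare hP f15 f16 hy) fun s₂ hf₂ ⟨_, _, g21, g22⟩ =>
      Runs.seq (T₁ := 2) (Q₁ := fun s' => ∀ z : Fin k, z.val < s₁.nreg 7 + 1 →
        s'.narr 0 z = thresholdMap hD p q x z) (.ite (fun hb => .instr ?_) fun hb => .instr ?_)
        fun s₃ hf₃ g => .instr ?_) le_rfl fun _ _ h => h
    · have hP₂ := hP.of_frame hf₂ (by decide) (by decide) (by decide)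
      have f7 := (hf₂.n 7 (by decide)).trans hy
      have fa := hf₂.na 0 (by decide)
      simp only [Cond.Holds, g21, g22] at hb
      intro z hz
      by_cases hzy : z = y
      · subst hzy
        simp [f7, hP₂.n31, thresholdMap, hb]
      · have : z.val ≠ y.val := fun h => hzy (Fin.ext h)
        simp only [Instr.apply, f7, fa, Function.update_apply, if_true, if_neg this]
        exact hI z (by omega)
    · have hP₂ := hP.of_frame hf₂ (by decide) (by decide) (by decide)
      have f7 := (hf₂.n 7 (by decide)).trans hy
      have fa := hf₂.na 0 (by decide)
      simp only [Cond.Holds, g21, g22] at hb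
      intro z hz
      by_cases hzy : z = y
      · subst hzy
        simp [f7, hP₂.n9, thresholdMap, hb]
      · have : z.val ≠ y.val := fun h => hzy (Fin.ext h)
        simp only [Instr.apply, f7, fa, Function.update_apply, if_true, if_neg this]
        exact hI z (by omega)
    · have f7 : s₃.nreg 7 = s₁.nreg 7 := (hf₃.n 7 (by decide)).trans (hf₂.n 7 (by decide))
      have f9 : s₃.nreg 9 = 1 := (hf₃.n 9 (by decide)).trans ((hf₂.n 9 (by decide)).trans hP.n9)
      simp only [Instr.apply, State.setN, Function.update_apply, if_true, f7, f9]
      exact ⟨⟨hlt, g⟩, by omega⟩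
  · rintro s₁ hf ⟨hle, hI⟩ hb
    have hP := (h.of_frame hf₀ (by decide) (by decide) (by decide)).of_frame hf
      (by decide) (by decide) (by decide)
    have heq : s₁.nreg 7 = k := le_antisymm hle (by simpa [hP.n0] using hb)
    rw [heq] at hI
    exact fun y => hI y y.2

/-! ### Levels, weights and block weights. -/

/-- The first failed comparison lowers the bound in natural register 14 to the counter, which ends
the loop. Hence the alternative in the invariant of `runs_count`. -/
def countProg : Prog := .loop (.natLt 15 14) <| .seq (.instr (.realAdd 18 18 18)) <|
  .ite (.realLe 18 19) (block [.natAdd 15 15 9, .realAdd 20 20 3]) (.instr (.natAdd 14 15 31))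

theorem runs_count {k D a b : ℕ} {p q : Fin k → ℝ} {s : State} (h : Params k D a b p q s)
    {u v : ℝ} {K : ℕ} (h18 : s.rreg 18 = u) (h19 : s.rreg 19 = v) (h14 : s.nreg 14 = K)
    (h15 : s.nreg 15 = 0) (h20 : s.rreg 20 = 0) (hu : 0 ≤ u) (huv : u ≤ v) :
    Runs countProg s (K * 5 + 1)
      fun s' => s'.nreg 15 = dyadicCount u v K ∧ s'.rreg 20 = dyadicCount u v K := by
  refine Runs.mono (Runs.loop (T := 4)
    (I := fun s' => s'.nreg 15 ≤ K ∧ 2 ^ s'.nreg 15 * u ≤ v ∧ s'.rreg 20 = s'.nreg 15 ∧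
      (s'.nreg 14 = K ∧ s'.rreg 18 = 2 ^ s'.nreg 15 * u ∨
        s'.nreg 14 = s'.nreg 15 ∧ v < 2 ^ (s'.nreg 15 + 1) * u))
    (μ := fun s' => s'.nreg 14 - s'.nreg 15)
    (Q := fun s' => s'.nreg 15 = dyadicCount u v K ∧ s'.rreg 20 = dyadicCount u v K)
    (by simp [h14, h15, h18, h20, huv]) ?_ ?_) (by simp [h14, h15]) fun _ _ h => h
  · rintro s₁ hf ⟨hle, hpow, e20, hor⟩ hb
    have hP := h.of_frame hf (by decide) (by decide) (by decide)
    have f19 := (hf.r 19 (by decide)).trans h19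
    have hlt : s₁.nreg 15 < s₁.nreg 14 := hb
    obtain ⟨e14, e18⟩ := hor.resolve_right fun h' => by omega
    refine Runs.seq (T₁ := 1) (T₂ := 3) (Q₁ := fun s' => s'.rreg 18 = 2 ^ (s₁.nreg 15 + 1) * u)
      (.instr ?_) fun s₂ hf₂ g18 => .ite (fun hb => .block ?_)
        fun hb => (Runs.instr ?_).mono (by norm_num) fun _ _ h => h
    · simp [e18, pow_succ]
      ring
    · have hP₂ := hP.of_frame hf₂ (by decide) (by decide) (by decide)
      have f14 := (hf₂.n 14 (by decide)).trans e14
      have f15 := hf₂.n 15 (by decide)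
      have f20 := (hf₂.r 20 (by decide)).trans e20
      have f19' := (hf₂.r 19 (by decide)).trans f19
      simp only [Cond.Holds, g18, f19'] at hb
      simp only [run_cons, run_nil, Instr.apply, State.setN, State.setR, Function.update_apply]
      norm_num only [if_true, if_false, reduceIte, hP₂.n9, f14, f15, f20, hP₂.r3, g18, e14]
      push_cast
      exact ⟨⟨by omega, hb, rfl, Or.inl ⟨trivial, trivial⟩⟩, by omega⟩
    · have hP₂ := hP.of_frame hf₂ (by decide) (by decide) (by decide)
      have f15 := hf₂.n 15 (by decide)
      have f20 := (hf₂.r 20 (by decide)).trans e20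
      have f19' := (hf₂.r 19 (by decide)).trans f19
      simp only [Cond.Holds, g18, f19', not_le] at hb
      simp only [Instr.apply, State.setN, Function.update_apply]
      norm_num only [if_true, if_false, reduceIte, hP₂.n31, f15, f20]
      exact ⟨⟨hle, hpow, trivial, Or.inr ⟨Nat.add_zero _, hb⟩⟩, by omega⟩
  · rintro s₁ hf ⟨hle, hpow, e20, hor⟩ hb
    have hge : s₁.nreg 14 ≤ s₁.nreg 15 := not_lt.1 hb
    have : dyadicCount u v K = s₁.nreg 15 := by
      refine dyadicCount_eq hu hle hpow ?_
      rcases hor with ⟨h1, -⟩ | ⟨-, h2⟩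
      · exact .inl (by omega)
      · exact .inr h2
    rw [this]
    exact ⟨rfl, e20⟩

/-- This and `nearProg` leave the level in natural register 16 and the weight in real register 21.
-/
def farProg : Prog := .seq (block [.realMul 18 16 3, .realMul 19 15 3, .natAdd 14 11 31]) <|
  .seq countProg <| .seq
    (.ite (.realLe 2 20) (.instr (.realMul 21 15 2)) (.instr (.realMul 21 15 20)))
    (.instr (.natAdd 16 15 31))

def nearProg : Prog := .seq
  (.ite (.realLt 16 15) (block [.realSub 18 15 16, .natConst 17 1])
    (block [.realSub 18 16 15, .natConst 17 0])) <|
  .seq (block [.realMul 21 18 18, .realDiv 21 21 16, .realMul 19 16 3, .natAdd 14 0 31]) <|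
  .seq countProg <|
    .ite (.natLt 15 0) (block [.natAdd 16 11 9, .natAdd 16 16 15, .natAdd 16 16 15, .natAdd 16 16 17])
      (.instr (.natAdd 16 12 6))

def symbolProg : Prog := .seq
  (block [.realLoad 15 0 6, .realLoad 16 1 6, .realAdd 17 16 16, .natConst 15 0, .realConst 20 0])
  (.ite (.realLe 17 15) farProg nearProg)

/-- The additional parameters of the second part of the program. -/
structure LevelParams (k D a b : ℕ) (p q : Fin k → ℝ) (s : State) : Prop
    extends Params k D a b p q s where
  n11 : s.nreg 11 = a + 4
  n12 : s.nreg 12 = a + 5 + 2 * k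
  n13 : s.nreg 13 = D - 1
  n20 : s.nreg 20 = a + 5 + 3 * k

theorem LevelParams.of_frame {k D a b : ℕ} {p q : Fin k → ℝ} {c : Prog} {s s' : State}
    (h : LevelParams k D a b p q s) (hf : Frame c s s')
    (hn : ∀ r ∈ [0, 1, 2, 9, 10, 31, 11, 12, 13, 20], r ∉ c.collect Instr.modN)
    (hr : ∀ r ∈ [2, 3, 12, 13], r ∉ c.collect Instr.modR)
    (ha : ∀ r ∈ [0, 1], r ∉ c.collect Instr.modRA) : LevelParams k D a b p q s' where
  toParams := h.toParams.of_frame hf (fun r hr => hn r (by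
    simp only [List.mem_cons, List.not_mem_nil, or_false] at hr ⊢; tauto)) hr ha
  n11 := (hf.n 11 (hn 11 (by simp))).trans h.n11
  n12 := (hf.n 12 (hn 12 (by simp))).trans h.n12
  n13 := (hf.n 13 (hn 13 (by simp))).trans h.n13
  n20 := (hf.n 20 (hn 20 (by simp))).trans h.n20

theorem runs_far {k D a b : ℕ} {p q : Fin k → ℝ} {s : State} (h : LevelParams k D a b p q s)
    {x : Fin k} (h15 : s.rreg 15 = p x) (h16 : s.rreg 16 = q x) (hn15 : s.nreg 15 = 0)
    (h20 : s.rreg 20 = 0) (hq : 0 ≤ q x) (hpq : 2 * q x ≤ p x) :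
    Runs farProg s (5 * a + 28) fun s' => s'.nreg 16 = level k a (p x) (q x) x ∧
      s'.rreg 21 = weight (1 / order a b) a (p x) (q x) := by
  refine Runs.mono (Runs.seq (T₁ := 3) (T₂ := (a + 4) * 5 + 1 + (2 + 1))
    (Q₁ := fun s' => s'.rreg 18 = q x ∧ s'.rreg 19 = p x ∧
    s'.nreg 14 = a + 4) (.block (by simp [h15, h16, h.r3, h.n11, h.n31]))
    fun s₁ hf₁ ⟨g18, g19, g14⟩ => ?_) (by omega) fun _ _ h => h
  have h₁ := h.of_frame hf₁ (by decide) (by decide) (by decide)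
  refine Runs.seq (runs_count h₁.toParams g18 g19 g14 ((hf₁.n 15 (by decide)).trans hn15)
    ((hf₁.r 20 (by decide)).trans h20) hq (by linarith)) fun s₂ hf₂ ⟨g15, g20⟩ => ?_
  have h₂ := h₁.of_frame hf₂ (by decide) (by decide) (by decide)
  have f15 : s₂.rreg 15 = p x := by rw [hf₂.r 15 (by decide), hf₁.r 15 (by decide), h15]
  have hw : weight (1 / order a b) a (p x) (q x) =
      p x * min (1 / order a b) (dyadicCount (q x) (p x) (a + 4)) := if_pos hpq
  refine Runs.seq (Q₁ := fun s' => s'.rreg 21 = weight (1 / order a b) a (p x) (q x))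
    (.ite (fun hb => .instr ?_) fun hb => .instr ?_) fun s₃ hf₃ g21 => .instr ?_
  · simp only [Cond.Holds, h₂.r2, g20] at hb
    rw [hw, min_eq_left hb]
    simp [f15, h₂.r2]
  · simp only [Cond.Holds, h₂.r2, g20, not_le] at hb
    rw [hw, min_eq_right hb.le]
    simp [f15, g20]
  · have h₃ := h₂.of_frame hf₃ (by decide) (by decide) (by decide)
    have hl : level k a (p x) (q x) x = dyadicCount (q x) (p x) (a + 4) := if_pos hpq
    simp [hf₃.n 15 (by decide), g15, h₃.n31, g21, hl]

theorem runs_near {k D a b : ℕ} {p q : Fin k → ℝ} {s : State} (h : LevelParams k D a b p q s)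
    {x : Fin k} (h15 : s.rreg 15 = p x) (h16 : s.rreg 16 = q x) (hn15 : s.nreg 15 = 0)
    (h20 : s.rreg 20 = 0) (h6 : s.nreg 6 = x) (hp : 0 ≤ p x) (hpq : ¬ 2 * q x ≤ p x) :
    Runs nearProg s (5 * k + 13) fun s' => s'.nreg 16 = level k a (p x) (q x) x ∧
      s'.rreg 21 = weight (1 / order a b) a (p x) (q x) := by
  refine Runs.mono (Runs.seq (T₁ := 2 + 1) (T₂ := 4 + (k * 5 + 1 + (4 + 1)))
    (Q₁ := fun s' => s'.rreg 18 = |p x - q x| ∧ s'.nreg 17 = if q x < p x then 1 else 0)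
    (.ite (fun hb => .block (l := [.realSub 18 15 16, .natConst 17 1]) ?_)
      fun hb => .block (l := [.realSub 18 16 15, .natConst 17 0]) ?_)
    fun s₁ hf₁ ⟨g18, g17⟩ => ?_) (by omega) fun _ _ h => h
  · simp only [Cond.Holds, h15, h16] at hb
    simp [h15, h16, hb, abs_of_pos]
  · simp only [Cond.Holds, h15, h16] at hb
    have := abs_of_nonpos (sub_nonpos.2 (not_lt.1 hb))
    simp [h15, h16, hb, this]
  have h₁ := h.of_frame hf₁ (by decide) (by decide) (by decide)
  have f16 := (hf₁.r 16 (by decide)).trans h16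
  refine Runs.seq (T₁ := 4) (Q₁ := fun s' => s'.rreg 21 = weight (1 / order a b) a (p x) (q x) ∧
    s'.rreg 19 = q x ∧ s'.nreg 14 = k) (.block ?_) fun s₂ hf₂ ⟨g21, g19, g14⟩ => ?_
  · simp [g18, f16, h₁.r3, h₁.n0, h₁.n31, weight, hpq, sq]
  have h₂ := h₁.of_frame hf₂ (by decide) (by decide) (by decide)
  refine Runs.seq (runs_count h₂.toParams ((hf₂.r 18 (by decide)).trans g18) g19 g14
    (by rw [hf₂.n 15 (by decide), hf₁.n 15 (by decide), hn15])
    (by rw [hf₂.r 20 (by decide), hf₁.r 20 (by decide), h20]) (abs_nonneg _)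
    (abs_sub_le_of_not hp hpq)) fun s₃ hf₃ ⟨g15, g20⟩ => ?_
  have h₃ := h₂.of_frame hf₃ (by decide) (by decide) (by decide)
  have f17 := (hf₃.n 17 (by decide)).trans ((hf₂.n 17 (by decide)).trans g17)
  have f6 : s₃.nreg 6 = x := by
    rw [hf₃.n 6 (by decide), hf₂.n 6 (by decide), hf₁.n 6 (by decide), h6]
  have f21 := (hf₃.r 21 (by decide)).trans g21
  refine .ite (fun hb => .block (l := [.natAdd 16 11 9, .natAdd 16 16 15, .natAdd 16 16 15,
    .natAdd 16 16 17]) ?_) fun hb => (Runs.instr ?_).mono (by norm_num) fun _ _ h => h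
  · simp only [Cond.Holds, g15, h₃.n0] at hb
    have hl : level k a (p x) (q x) x = a + 5 + 2 * dyadicCount |p x - q x| (q x) k +
        if q x < p x then 1 else 0 := by rw [level, if_neg hpq, if_pos hb]
    simp [hl, f17, f21, g15, h₃.n11, h₃.n9]
    ring
  · simp only [Cond.Holds, g15, h₃.n0] at hb
    have hl : level k a (p x) (q x) x = a + 5 + 2 * k + x := by
      rw [level, if_neg hpq, if_neg hb]
    simp [hl, f21, h₃.n12, f6]

theorem runs_symbol {k D a b : ℕ} {p q : Fin k → ℝ} {s : State} (h : LevelParams k D a b p q s)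
    {x : Fin k} (h6 : s.nreg 6 = x) (hp : 0 ≤ p x) (hq : 0 ≤ q x) :
    Runs symbolProg s (5 * (a + k) + 34) fun s' => s'.nreg 16 = level k a (p x) (q x) x ∧
      s'.rreg 21 = weight (1 / order a b) a (p x) (q x) := by
  refine Runs.mono (Runs.seq (T₁ := 5) (T₂ := 5 * (a + k) + 28 + 1) (Q₁ := fun s' =>
    s'.rreg 15 = p x ∧ s'.rreg 16 = q x ∧
    s'.rreg 17 = 2 * q x ∧ s'.nreg 15 = 0 ∧ s'.rreg 20 = 0) (.block ?_)
    fun s₁ hf₁ ⟨g15, g16, g17, gn15, g20⟩ => ?_) (by omega) fun _ _ h => h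
  · simp [h6, h.p, h.q, two_mul]
  have h₁ := h.of_frame hf₁ (by decide) (by decide) (by decide)
  refine .ite (fun hb => ?_) fun hb => ?_
  · simp only [Cond.Holds, g15, g17] at hb
    exact (runs_far h₁ g15 g16 gn15 g20 hq hb).mono (by omega) fun _ _ h => h
  · simp only [Cond.Holds, g15, g17] at hb
    exact (runs_near h₁ g15 g16 gn15 g20 ((hf₁.n 6 (by decide)).trans h6) hp hb).mono
      (by omega) fun _ _ h => h

/-- Division by repeated subtraction; the dividend is a level, below a + 5 + 3k, so the cost stays
polynomial. -/
def divProg : Prog := .seq (.instr (.natConst 18 0)) <|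
  .loop (.natLe 13 16) (block [.natSub 16 16 13, .natAdd 18 18 9])

theorem runs_div {k D a b : ℕ} (hD : 2 ≤ D) {p q : Fin k → ℝ} {s : State}
    (h : LevelParams k D a b p q s) {n : ℕ} (h16 : s.nreg 16 = n) :
    Runs divProg s (n * 3 + 2)
      fun s' => s'.nreg 18 = n / (D - 1) ∧ s'.nreg 16 = n % (D - 1) := by
  refine Runs.mono (Runs.seq (T₁ := 1) (T₂ := n * 3 + 1) (Q₁ := fun s' => s'.nreg 18 = 0)
    (.instr (by simp)) fun s₀ hf₀ h18 => Runs.mono (Runs.loop (T := 2)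
      (I := fun s' => s'.nreg 16 + (D - 1) * s'.nreg 18 = n) (μ := fun s' => s'.nreg 16)
      (Q := fun s' => s'.nreg 18 = n / (D - 1) ∧ s'.nreg 16 = n % (D - 1)) ?_ ?_ ?_)
      (by simp [hf₀.n 16 (by decide), h16]) fun _ _ h => h) (by omega) fun _ _ h => h
  · simp [hf₀.n 16 (by decide), h16, h18]
  · rintro s₁ hf hI hb
    have h₁ := (h.of_frame hf₀ (by decide) (by decide) (by decide)).of_frame hf
      (by decide) (by decide) (by decide)
    have hle : D - 1 ≤ s₁.nreg 16 := by simpa [h₁.n13] using hb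
    refine .block ?_
    simp [h₁.n13, h₁.n9, mul_add]
    omega
  · rintro s₁ hf hI hb
    have h₁ := (h.of_frame hf₀ (by decide) (by decide) (by decide)).of_frame hf
      (by decide) (by decide) (by decide)
    simp only [Cond.Holds, h₁.n13, not_le] at hb
    have := (Nat.div_mod_unique (by omega : 0 < D - 1)).2 ⟨hI, hb⟩
    exact ⟨this.1.symm, this.2.symm⟩

/-- Natural array 1 receives the block, natural array 0 the position inside the block, and real
array 2 accumulates the block weights. -/
def storeBlock : List Instr :=
  [.natStore 1 6 18, .natStore 0 6 16, .realLoad 22 2 18, .realAdd 22 22 21, .realStore 2 18 22,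
    .natAdd 6 6 9]

def tableBody : Prog := .seq symbolProg (.seq divProg (block storeBlock))

def tableProg : Prog := .seq (block
  [.natAdd 11 2 9, .natAdd 11 11 9, .natAdd 11 11 9, .natAdd 11 11 9, .natAdd 12 11 9,
    .natAdd 12 12 0, .natAdd 12 12 0, .natSub 13 1 9, .natAdd 20 12 0, .natConst 6 0])
  (.loop (.natLt 6 0) tableBody)

/-- The levels of the symbols below `i`, divided by `D - 1`, and the block weights are stored. -/
def Table {k : ℕ} (D a b : ℕ) (p q : Fin k → ℝ) (i : ℕ) (s : State) : Prop :=
  (∀ y : Fin k, y.val < i → s.narr 1 y = level k a (p y) (q y) y / (D - 1) ∧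
    s.narr 0 y = level k a (p y) (q y) y % (D - 1)) ∧
  ∀ B, s.rarr 2 B = partialSum (fun y => if level k a (p y) (q y) y / (D - 1) = B then
    weight (1 / order a b) a (p y) (q y) else 0) i

theorem runs_table {k D a b : ℕ} (hD : 2 ≤ D) {p q : Fin k → ℝ} (hp : ∀ x, 0 ≤ p x)
    (hq : ∀ x, 0 ≤ q x) {s : State} (h : Params k D a b p q s) (h2 : s.rarr 2 = fun _ => 0) :
    Runs tableProg s (k * (8 * a + 14 * k + 58) + 11) fun s' =>
      LevelParams k D a b p q s' ∧ Table D a b p q k s' := by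
  refine Runs.mono (Runs.seq (T₁ := 10) (T₂ := k * (8 * a + 14 * k + 58) + 1)
    (Q₁ := fun s' => s'.nreg 11 = a + 4 ∧ s'.nreg 12 = a + 5 + 2 * k ∧ s'.nreg 13 = D - 1 ∧
      s'.nreg 20 = a + 5 + 3 * k ∧ s'.nreg 6 = 0) (.block ?_)
    fun s₀ hf₀ ⟨h11, h12, h13, h20, h6⟩ => Runs.mono (Runs.loop (T := 8 * a + 14 * k + 57)
      (I := fun s' => s'.nreg 6 ≤ k ∧ Table D a b p q (s'.nreg 6) s')
      (μ := fun s' => k - s'.nreg 6)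
      (Q := fun s' => LevelParams k D a b p q s' ∧ Table D a b p q k s') ?_ ?_ ?_)
      (by simp [h6]) fun _ _ h => h) (by omega) fun _ _ h => h
  · simp [h.n0, h.n1, h.n2, h.n9]
    omega
  · rw [h6]
    refine ⟨Nat.zero_le _, fun y hy => absurd hy (Nat.not_lt_zero _), fun B => ?_⟩
    rw [hf₀.ra 2 (by decide), h2, partialSum_zero]
  · rintro s₁ hf ⟨hle, hI₁, hI₂⟩ hb
    have h₀ : LevelParams k D a b p q s₀ :=
      ⟨h.of_frame hf₀ (by decide) (by decide) (by decide), h11, h12, h13, h20⟩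
    have h₁ := h₀.of_frame hf (by decide) (by decide) (by decide)
    have hlt : s₁.nreg 6 < k := by simpa [h₁.n0] using hb
    obtain ⟨x, hx⟩ : ∃ x : Fin k, s₁.nreg 6 = x := ⟨⟨_, hlt⟩, rfl⟩
    have hlev := level_lt (a := a) (u := p x) (v := q x) x.2
    refine Runs.mono (Runs.seq (T₂ := (a + 5 + 3 * k) * 3 + 2 + 6)
      (runs_symbol h₁ hx (hp x) (hq x)) fun s₂ hf₂ ⟨g16, g21⟩ => ?_) (by omega) fun _ _ h => h
    have h₂ := h₁.of_frame hf₂ (by decide) (by decide) (by decide)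
    refine Runs.seq ((runs_div hD h₂ g16).mono (by omega) fun _ _ h => h)
      fun s₃ hf₃ ⟨g18, g16'⟩ => .block (l := storeBlock) ?_
    have h₃ := h₂.of_frame hf₃ (by decide) (by decide) (by decide)
    have f6 : s₃.nreg 6 = x := by rw [hf₃.n 6 (by decide), hf₂.n 6 (by decide), hx]
    have f21 := (hf₃.r 21 (by decide)).trans g21
    have fa0 := (hf₃.na 0 (by decide)).trans (hf₂.na 0 (by decide))
    have fa1 := (hf₃.na 1 (by decide)).trans (hf₂.na 1 (by decide))
    have fr2 := (hf₃.ra 2 (by decide)).trans (hf₂.ra 2 (by decide))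
    simp only [storeBlock, Table, run_cons, run_nil, Instr.apply, State.setN, State.setR,
      Function.update_apply]
    norm_num only [if_true, if_false, reduceIte, h₃.n9, f6, f21, g18, g16', fa0, fa1, fr2]
    rw [hx] at hI₁ hI₂
    refine ⟨⟨by omega, fun y hy => ?_, fun B => ?_⟩, by omega⟩
    · by_cases hyx : y = x
      · subst hyx; simp
      · have hne : y.val ≠ x.val := fun h => hyx (Fin.ext h)
        rw [Function.update_of_ne hne, Function.update_of_ne hne]
        exact hI₁ y (by omega)
    · rw [partialSum_succ _ x.2]
      by_cases hB : B = level k a (p x) (q x) x / (D - 1)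
      · subst hB; rw [Function.update_self, hI₂]; simp
      · rw [Function.update_of_ne hB, hI₂, if_neg (Ne.symm hB), add_zero]
  · rintro s₁ hf ⟨hle, hI⟩ hb
    have h₀ : LevelParams k D a b p q s₀ :=
      ⟨h.of_frame hf₀ (by decide) (by decide) (by decide), h11, h12, h13, h20⟩
    have h₁ := h₀.of_frame hf (by decide) (by decide) (by decide)
    have heq : s₁.nreg 6 = k := le_antisymm hle (by simpa [h₁.n0] using hb)
    rw [heq] at hI
    exact ⟨h₁, hI⟩

/-! ### Choice of the best block and output of its quantizer. -/

def bestBody : Prog := .seq (.instr (.realLoad 22 2 6)) <| .seq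
  (.ite (.realLt 23 22) (block [.realMul 23 22 3, .natAdd 19 6 31]) .skip) (.instr (.natAdd 6 6 9))

def bestProg : Prog := .seq (block [.natConst 19 0, .natConst 6 0, .realLoad 23 2 6])
  (.loop (.natLt 6 20) bestBody)

theorem runs_best {k D a b : ℕ} {p q : Fin k → ℝ} {s : State} (h : LevelParams k D a b p q s) :
    Runs bestProg s ((a + 5 + 3 * k) * 6 + 4) fun s' =>
      ∀ B < a + 5 + 3 * k, s.rarr 2 B ≤ s.rarr 2 (s'.nreg 19) := by
  refine Runs.mono (Runs.seq (T₁ := 3) (T₂ := (a + 5 + 3 * k) * 6 + 1)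
    (Q₁ := fun s' => s'.nreg 19 = 0 ∧ s'.nreg 6 = 0 ∧ s'.rreg 23 = s.rarr 2 0) (.block (by simp))
    fun s₀ hf₀ ⟨h19, h6, h23⟩ => Runs.mono (Runs.loop (T := 5)
      (I := fun s' => s'.nreg 6 ≤ a + 5 + 3 * k ∧ s'.rreg 23 = s.rarr 2 (s'.nreg 19) ∧
        ∀ B < s'.nreg 6, s.rarr 2 B ≤ s'.rreg 23)
      (μ := fun s' => a + 5 + 3 * k - s'.nreg 6)
      (Q := fun s' => ∀ B < a + 5 + 3 * k, s.rarr 2 B ≤ s.rarr 2 (s'.nreg 19)) ?_ ?_ ?_)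
      (by simp [h6]) fun _ _ h => h) (by omega) fun _ _ h => h
  · simp [h6, h19, h23]
  · rintro s₁ hf ⟨hle, e23, hI⟩ hb
    have h₁ := (h.of_frame hf₀ (by decide) (by decide) (by decide)).of_frame hf
      (by decide) (by decide) (by decide)
    have hlt : s₁.nreg 6 < a + 5 + 3 * k := by simpa [h₁.n20] using hb
    have fr2 := (hf.ra 2 (by decide)).trans (hf₀.ra 2 (by decide))
    refine Runs.seq (T₁ := 1) (T₂ := 3 + 1) (Q₁ := fun s' => s'.rreg 22 = s.rarr 2 (s₁.nreg 6))
      (.instr (by simp [fr2])) fun s₂ hf₂ g22 => ?_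
    have h₂ := h₁.of_frame hf₂ (by decide) (by decide) (by decide)
    have f6 := hf₂.n 6 (by decide)
    have f19 := hf₂.n 19 (by decide)
    have f23 := (hf₂.r 23 (by decide)).trans e23
    refine Runs.seq (Q₁ := fun s' => s'.rreg 23 = s.rarr 2 (s'.nreg 19) ∧
      ∀ B < s₁.nreg 6 + 1, s.rarr 2 B ≤ s'.rreg 23)
      (.ite (fun hb => .block (l := [.realMul 23 22 3, .natAdd 19 6 31]) ?_) fun hb => .skip ?_)
      fun s₃ hf₃ ⟨g23, g⟩ => .instr ?_
    · simp only [Cond.Holds, g22, f23, ← e23] at hb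
      simp only [run_cons, run_nil, Instr.apply, State.setN, State.setR, Function.update_apply]
      norm_num only [if_true, if_false, reduceIte, h₂.r3, h₂.n31, g22, f6]
      rw [mul_one, Nat.add_zero]
      refine ⟨rfl, fun B hB => ?_⟩
      rcases Nat.lt_succ_iff_lt_or_eq.1 hB with h1 | h1
      · exact (hI B h1).trans hb.le
      · rw [h1]
    · simp only [Cond.Holds, g22, f23, ← e23, not_lt] at hb
      rw [f19, f23, ← e23]
      refine ⟨rfl, fun B hB => ?_⟩
      rcases Nat.lt_succ_iff_lt_or_eq.1 hB with h1 | h1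
      · exact hI B h1
      · rw [h1]; exact hb
    · have f6' : s₃.nreg 6 = s₁.nreg 6 := (hf₃.n 6 (by decide)).trans f6
      have f9 : s₃.nreg 9 = 1 := (hf₃.n 9 (by decide)).trans h₂.n9
      simp only [Instr.apply, State.setN, Function.update_apply]
      norm_num only [if_true, if_false, reduceIte, f6', f9]
      exact ⟨⟨hlt, g23, g⟩, by omega⟩
  · rintro s₁ hf ⟨hle, e23, hI⟩ hb
    have h₁ := (h.of_frame hf₀ (by decide) (by decide) (by decide)).of_frame hf
      (by decide) (by decide) (by decide)
    have heq : s₁.nreg 6 = a + 5 + 3 * k := le_antisymm hle (by simpa [h₁.n20] using hb)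
    rw [heq, e23] at hI
    exact hI

/-- Natural array 0 already holds the letters for symbols of the best block; all others are
overwritten by `D - 1`. Equality of blocks is tested by two comparisons. -/
def emitBody : Prog := .seq (.instr (.natLoad 18 1 6)) <| .seq
  (.ite (.natLe 18 19) (.ite (.natLe 19 18) .skip (.instr (.natStore 0 6 13)))
    (.instr (.natStore 0 6 13))) (.instr (.natAdd 6 6 9))

def emitProg : Prog := .seq (.instr (.natConst 6 0)) (.loop (.natLt 6 0) emitBody)

theorem runs_emit {k D a b : ℕ} (hD : 2 ≤ D) {p q : Fin k → ℝ} {s : State}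
    (h : LevelParams k D a b p q s) (hT : Table D a b p q k s) :
    Runs emitProg s (k * 6 + 2) fun s' => Outputs s' (levelMap hD a p q (s.nreg 19)) := by
  refine Runs.mono (Runs.seq (T₁ := 1) (T₂ := k * 6 + 1) (Q₁ := fun s' => s'.nreg 6 = 0)
    (.instr (by simp)) fun s₀ hf₀ h6 => Runs.mono (Runs.loop (T := 5)
      (I := fun s' => s'.nreg 6 ≤ k ∧
        (∀ y : Fin k, y.val < s'.nreg 6 → s'.narr 0 y = levelMap hD a p q (s.nreg 19) y) ∧
        ∀ y : Fin k, s'.nreg 6 ≤ y.val → s'.narr 0 y = level k a (p y) (q y) y % (D - 1))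
      (μ := fun s' => k - s'.nreg 6)
      (Q := fun s' => Outputs s' (levelMap hD a p q (s.nreg 19))) ?_ ?_ ?_)
      (by simp [h6]) fun _ _ h => h) (by omega) fun _ _ h => h
  · rw [h6]
    refine ⟨Nat.zero_le _, fun y hy => absurd hy (Nat.not_lt_zero _), fun y _ => ?_⟩
    rw [hf₀.na 0 (by decide)]
    exact (hT.1 y y.2).2
  · rintro s₁ hf ⟨hle, hI₁, hI₂⟩ hb
    have h₁ := (h.of_frame hf₀ (by decide) (by decide) (by decide)).of_frame hf
      (by decide) (by decide) (by decide)
    have hlt : s₁.nreg 6 < k := by simpa [h₁.n0] using hb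
    obtain ⟨x, hx⟩ : ∃ x : Fin k, s₁.nreg 6 = x := ⟨⟨_, hlt⟩, rfl⟩
    have fa1 := (hf.na 1 (by decide)).trans (hf₀.na 1 (by decide))
    have f19 := (hf.n 19 (by decide)).trans (hf₀.n 19 (by decide))
    refine Runs.seq (T₁ := 1) (T₂ := 3 + 1)
      (Q₁ := fun s' => s'.nreg 18 = level k a (p x) (q x) x / (D - 1))
      (.instr (by simp [fa1, hx, (hT.1 x x.2).1])) fun s₂ hf₂ g18 => ?_
    have h₂ := h₁.of_frame hf₂ (by decide) (by decide) (by decide)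
    have f6 := (hf₂.n 6 (by decide)).trans hx
    have fa0 := hf₂.na 0 (by decide)
    have f19' := (hf₂.n 19 (by decide)).trans f19
    have hstore : ¬ level k a (p x) (q x) x / (D - 1) = s.nreg 19 →
        (∀ y : Fin k, y.val < s₁.nreg 6 + 1 → ((Instr.natStore 0 6 13).apply s₂).narr 0 y =
          levelMap hD a p q (s.nreg 19) y) ∧
        ∀ y : Fin k, s₁.nreg 6 + 1 ≤ y.val → ((Instr.natStore 0 6 13).apply s₂).narr 0 y =
          level k a (p y) (q y) y % (D - 1) := by
      intro hne
      simp only [Instr.apply, Function.update_apply, if_true, fa0, f6, h₂.n13]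
      refine ⟨fun y hy => ?_, fun y hy => ?_⟩
      · by_cases hyx : y = x
        · subst hyx; simp [levelMap, hne]
        · have hne : y.val ≠ x.val := fun h => hyx (Fin.ext h)
          rw [if_neg hne]
          exact hI₁ y (by omega)
      · rw [if_neg (by omega)]
        exact hI₂ y (by omega)
    refine Runs.seq (T₁ := 3) (Q₁ := fun s' =>
        (∀ y : Fin k, y.val < s₁.nreg 6 + 1 → s'.narr 0 y = levelMap hD a p q (s.nreg 19) y) ∧
        ∀ y : Fin k, s₁.nreg 6 + 1 ≤ y.val → s'.narr 0 y = level k a (p y) (q y) y % (D - 1))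
      (.ite (fun hb₁ => .ite (T := 1) (fun hb₂ => .skip ?_) fun hb₂ => .instr (hstore ?_))
        fun hb₁ => Runs.mono (.instr (hstore ?_)) (by norm_num) fun _ _ h => h)
      fun s₃ hf₃ ⟨g1, g2⟩ => .instr ?_
    · simp only [Cond.Holds, g18, f19'] at hb₁ hb₂
      rw [fa0]
      refine ⟨fun y hy => ?_, fun y hy => hI₂ y (by omega)⟩
      by_cases hyx : y = x
      · subst hyx
        rw [hI₂ y hx.le, levelMap, if_pos (le_antisymm hb₁ hb₂)]
      · have hne : y.val ≠ x.val := fun h => hyx (Fin.ext h)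
        exact hI₁ y (by omega)
    · simp only [Cond.Holds, g18, f19'] at hb₂
      exact fun h => hb₂ h.ge
    · simp only [Cond.Holds, g18, f19'] at hb₁
      exact fun h => hb₁ h.le
    · have f6' : s₃.nreg 6 = s₁.nreg 6 := (hf₃.n 6 (by decide)).trans (hf₂.n 6 (by decide))
      have f9 : s₃.nreg 9 = 1 := (hf₃.n 9 (by decide)).trans h₂.n9
      simp only [Instr.apply, State.setN, Function.update_apply, if_true, f6', f9]
      exact ⟨⟨hlt, g1, g2⟩, by omega⟩
  · rintro s₁ hf ⟨hle, hI₁, hI₂⟩ hb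
    have h₁ := (h.of_frame hf₀ (by decide) (by decide) (by decide)).of_frame hf
      (by decide) (by decide) (by decide)
    have heq : s₁.nreg 6 = k := le_antisymm hle (by simpa [h₁.n0] using hb)
    rw [heq] at hI₁
    exact fun y => hI₁ y y.2

def levelProg : Prog := .seq tableProg (.seq bestProg emitProg)

theorem runs_level {k D a b : ℕ} (hD : 2 ≤ D) {p q : Fin k → ℝ} (hp : ∀ x, 0 ≤ p x)
    (hq : ∀ x, 0 ≤ q x) {s : State} (h : Params k D a b p q s) (h2 : s.rarr 2 = fun _ => 0) :
    Runs levelProg s (k * (8 * a + 14 * k + 82) + 6 * a + 47) fun s' => ∃ B,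
      (∀ B', blockWeight (1 / order a b) a D p q B' ≤ blockWeight (1 / order a b) a D p q B) ∧
      Outputs s' (levelMap hD a p q B) := by
  refine Runs.mono (Runs.seq (T₂ := (a + 5 + 3 * k) * 6 + 4 + (k * 6 + 2))
    (runs_table hD hp hq h h2) fun s₁ hf₁ ⟨h₁, hT⟩ => Runs.seq (runs_best h₁)
    fun s₂ hf₂ hbest => Runs.mono (runs_emit hD
      (h₁.of_frame hf₂ (by decide) (by decide) (by decide)) ?_) le_rfl
      fun s₃ _ hout => ⟨s₂.nreg 19, ?_, hout⟩) ?_ fun _ _ h => h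
  · unfold Table
    rw [hf₂.na 0 (by decide), hf₂.na 1 (by decide), hf₂.ra 2 (by decide)]
    exact hT
  · have : k * (8 * a + 14 * k + 82) = k * (8 * a + 14 * k + 58) + k * 24 := by ring
    omega
  · intro B'
    have hV : ∀ B, s₁.rarr 2 B = blockWeight (1 / order a b) a D p q B := fun B => by
      rw [hT.2, partialSum_self, blockWeight]
    rcases lt_or_ge B' (a + 5 + 3 * k) with hlt | hge
    · rw [← hV, ← hV]
      exact hbest B' hlt
    · have hL : 0 ≤ 1 / order a b := by unfold order; positivity
      have hw := fun x => weight_nonneg (a := a) hL (hp x) (hq x)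
      -- Blocks that were not scanned are empty: a block index never exceeds the level.
      have h0 : blockWeight (1 / order a b) a D p q B' = 0 := by
        refine Finset.sum_eq_zero fun x _ => if_neg fun heq => ?_
        have := level_lt (a := a) (u := p x) (v := q x) x.2
        have := Nat.div_le_self (level k a (p x) (q x) x) (D - 1)
        omega
      rw [h0]
      exact Finset.sum_nonneg fun x _ => by split_ifs; exacts [hw x, le_rfl]

/-! ### The whole program and the final assembly. -/

def mainProg : Prog :=
  .seq setupProg (.seq certProg (.ite (.natLt 4 10) thresholdProg levelProg))

/-- A certificate was found exactly when natural register 4 has dropped below 3b + 1. The statement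
also yields a good quantizer for every pair of laws on a finite alphabet. -/
theorem runs_main {k D a b : ℕ} (hD : 2 ≤ D) {α δ : ℝ} (h : LogCounts α δ a b) (hα : 0 < α)
    (hδ : 0 < δ) (p q : PMF (Fin k)) :
    Runs mainProg (inputState p q α δ D) (120 * (k + a + b + 1) ^ 2) fun s => ∃ f : Fin k → Fin D,
      Outputs s f ∧ IsGoodMap hD a b (fun x => (p x).toReal) (fun x => (q x).toReal) f := by
  refine Runs.mono (Runs.seq (T₂ := k * (8 * k + 24 * b + 20) + 2 +
    (k * (8 * a + 14 * k + 90) + 6 * a + 51 + 1)) (runs_setup h hα hδ p q)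
    fun s₁ hf₁ ⟨h₁, h4, h2⟩ => Runs.seq (runs_cert h₁ h4) fun s₂ hf₂ ⟨hle, hyes, hno⟩ =>
    .ite (fun hb => ?_) fun hb => ?_) ?_ fun _ _ h => h
  · have h₂ := h₁.of_frame hf₂ (by decide) (by decide) (by decide)
    have hlt : s₂.nreg 4 < 3 * b + 1 := by simpa only [Cond.Holds, h₂.n10] using hb
    obtain ⟨x, h5, h1, hx⟩ := hyes.resolve_left hlt.ne
    refine (runs_threshold hD h₂ h5).mono ?_ fun s₃ _ hout =>
      ⟨_, hout, .inl ⟨x, _, h1, by omega, hx, fun y m hm1 hm2 => hno y y.2 m hm1 hm2, rfl⟩⟩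
    nlinarith
  · have h₂ := h₁.of_frame hf₂ (by decide) (by decide) (by decide)
    have hge : 3 * b + 1 ≤ s₂.nreg 4 := by simpa only [Cond.Holds, h₂.n10, not_lt] using hb
    refine (runs_level hD (fun _ => ENNReal.toReal_nonneg) (fun _ => ENNReal.toReal_nonneg) h₂
      ((hf₂.ra 2 (by decide)).trans h2)).mono ?_ fun s₃ _ ⟨B, hB, hout⟩ =>
      ⟨_, hout, .inr ⟨fun y m hm1 hm2 => hno y y.2 m hm1 (by omega), B, hB, rfl⟩⟩
    nlinarith
  · have e1 : 120 * (k + a + b + 1) ^ 2 = 120 * (k * k) + 120 * (a * a) + 120 * (b * b) +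
        240 * (k * a) + 240 * (k * b) + 240 * (a * b) + 240 * k + 240 * a + 240 * b + 120 := by
      ring
    have e2 : k * (8 * k + 24 * b + 20) = 8 * (k * k) + 24 * (k * b) + 20 * k := by ring
    have e3 : k * (8 * a + 14 * k + 90) = 8 * (k * a) + 14 * (k * k) + 90 * k := by ring
    rw [e1, e2, e3]
    omega

theorem natCast_b_le {α δ : ℝ} {a b : ℕ} (h : LogCounts α δ a b) (hα1 : α ≤ 1 / 2) (hδ : 0 < δ) :
    (b : ℝ) ≤ 3 / 2 * Real.log (1 / δ) := by
  have h1 : (2 : ℝ) ^ b ≤ 1 / δ := by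
    rw [le_div_iff₀ hδ]
    linarith [h.pow_mul_le]
  have h2 := Real.log_le_log (by positivity) h1
  rw [Real.log_pow] at h2
  have h3 := Real.log_two_gt_d9
  have : (0 : ℝ) ≤ b := by positivity
  nlinarith

end RealRAM

theorem theorem3 :
    ∃ C : ℝ≥0,
      -- Statistical cost
      (∀ (X : Type*) (p q : PMF X) (α δ : ℝ) (D : ℕ),
        0 < α → α ≤ 1 / 2 → 0 < δ → δ < α / 4 → 2 ≤ D →
          (HypTest.sampleComplexity p q α δ : ℝ≥0∞)
              ≤ C * (HypTest.commSampleComplexity p q α δ D : ℝ≥0∞) ∧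
          (HypTest.commSampleComplexity p q α δ D : ℝ≥0∞)
              ≤ C * HypTest.commBound (HypTest.sampleComplexity p q α δ) α D) ∧
      -- Computational cost
      (∃ (prog : RealRAM.Prog) (P : MvPolynomial (Fin 4) ℝ),
        ∀ (k : ℕ) (p q : PMF (Fin k)) (α δ : ℝ) (D : ℕ),
          0 < α → α ≤ 1 / 2 → 0 < δ → δ < α / 4 → 2 ≤ D →
            ∃ (t : ℕ) (s : RealRAM.State) (f : Fin k → Fin D),
              RealRAM.Exec prog (RealRAM.inputState p q α δ D) t s ∧
              (t : ℝ) ≤ MvPolynomial.eval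
                ![(k : ℝ), (D : ℝ), Real.log (1 / α), Real.log (1 / δ)] P ∧
              RealRAM.Outputs s f ∧
              (HypTest.constrainedSampleComplexity p q α δ {HypTest.detChannel f} : ℝ≥0∞)
                ≤ C * HypTest.commBound (HypTest.sampleComplexity p q α δ) α D) := by
  refine ⟨HypTest.commConst, fun X p q α δ D hα0 hα1 hδ0 hδ hD => ⟨?_, ?_⟩, RealRAM.mainProg,
    -- The bound 120(k + a + b + 1)² with a ≤ 1 + (3/2) log(1/α) and b ≤ (3/2) log(1/δ).
    .C 120 * (.X 0 + .C (3 / 2) * .X 2 + .C (3 / 2) * .X 3 + .C 2) ^ 2,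
    fun k p q α δ D hα0 hα1 hδ0 hδ hD => ?_⟩
  · have h1 : (1 : ℝ≥0∞) ≤ HypTest.commConst := by exact_mod_cast HypTest.one_le_commConst
    have h2 : HypTest.sampleComplexity p q α δ ≤ HypTest.commSampleComplexity p q α δ D :=
      HypTest.sampleComplexity_le_constrained p q α δ _
    exact (ENat.toENNReal_le.2 h2).trans (le_mul_of_one_le_left' h1)
  · obtain ⟨a, b, h⟩ := HypTest.exists_logCounts hα0 hα1 hδ0 hδ
    refine HypTest.commSampleComplexity_le hD h hα0 hα1 hδ0 p q fun k p q => ?_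
    -- Existence of a good quantizer is read off from a run of the program.
    obtain ⟨_, _, -, -, f, -, hf⟩ := RealRAM.runs_main hD h hα0 hδ0 p q
    exact ⟨f, hf⟩
  · obtain ⟨a, b, h⟩ := HypTest.exists_logCounts hα0 hα1 hδ0 hδ
    obtain ⟨t, s, he, ht, f, hout, hf⟩ := RealRAM.runs_main hD h hα0 hδ0 p q
    refine ⟨t, s, f, he, ?_, hout,
      HypTest.constrainedSampleComplexity_le_of_isGoodMap hD h hα0 hα1 hδ0 p q hf⟩
    have ht' : (t : ℝ) ≤ 120 * ((k : ℝ) + a + b + 1) ^ 2 := by exact_mod_cast ht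
    have ha := HypTest.natCast_le_of_logCounts h hα0
    have hb := RealRAM.natCast_b_le h hα1 hδ0
    refine ht'.trans ?_
    simp only [map_mul, map_pow, map_add, MvPolynomial.eval_C, MvPolynomial.eval_X,
      Matrix.cons_val]
    gcongr 120 * ?_ ^ 2
    linarith
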